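/- Let $u=u(\mathbf x,t)$, $\mathbf x=(x,y,z)\in\mathbb R^3$, $t\in\mathbb R$, be a real-valued Class B global solution of the 3D Zakharov–Kuznetsov equation $\partial_t u+\partial_x\Delta u+\partial_x(u^2)=0$. This means: (1) for each $T>0$ and each $s<1$, $u\in C([-T,T];H^s_{\mathbf x})$ and $\partial_t u\in C([-T,T];H^{s-3}_{\mathbf x})$; (2) for each $t\in\mathbb R$, $u(t)\in H^1_{\mathbf x}$ and $\partial_t u(t)\in H^{-2}_{\mathbf x}$, and there is $C'>0$ with $\sup_{t\in\mathbb R}\|u(t)\|_{H^1_{\mathbf x}}+\sup_{t\in\mathbb R}\|\partial_t u(t)\|_{H^{-2}_{\mathbf x}}\le C'$; (3) for each $t\in\mathbb R$, the equation $\partial_t u(t)+\partial_x\Delta u(t)+\partial_x (u(t)^2)=0$ holds as an equality for the sum of three elements of $H^{-2}_{\mathbf x}$. Suppose that $u$ decays exponentially in space, uniformly in time, around some moving centre: there are a function $\mathbf a:\mathbb R\to\mathbb R^3$ and constants $\kappa>0$ and $C$ such that for all $R>0$ $$\|u(\mathbf x+\mathbf a(t),t)\|_{L^\infty_tL^2_{\mathbf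 x}(|\mathbf x|>R)}\le C\,e^{-\kappa R}.$$ Then $u$ is smooth: there is $U\in C^\infty(\mathbb R\times\mathbb R^3)$ such that, for every $t\in\mathbb R$, $u(\mathbf x,t)=U(t,\mathbf x)$ for almost every $\mathbf x$. Moreover, for every $s\in\mathbb R$, $u(t)\in H^s_{\mathbf x}$ for every $t\in\mathbb R$ and $\sup_{t\in\mathbb R}\|u(t)\|_{H^s_{\mathbf x}}<\infty$. -/

import Mathlib

open MeasureTheory Filter Topology TemperedDistribution
open scoped ENNReal SchwartzMap LineDeriv Laplacian ContDiff

noncomputable section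

namespace ZK

/-- The space `ℝ³` with the Euclidean norm; coordinate `0` is `x`. -/
abbrev R3 : Type := EuclideanSpace ℝ (Fin 3)

/-- The unit vector in the direction of the first coordinate `x`. -/
def ex : R3 := EuclideanSpace.single 0 1

/-- A real-valued `L²` function as a tempered distribution. -/
def toDist (f : Lp ℝ 2 (volume : Measure R3)) : 𝓢'(R3, ℂ) :=
  ((Complex.ofRealCLM.compLp f : Lp ℂ 2 (volume : Measure R3)) : 𝓢'(R3, ℂ))

theorem memLp_one_sq (f : Lp ℝ 2 (volume : Measure R3)) :
    MemLp (fun x => ((f x ^ 2 : ℝ) : ℂ)) 1 (volume : Measure R3) :=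
  memLp_one_iff_integrable.2 (Lp.memLp f).integrable_sq.ofReal

/-- The square of a real-valued `L²` function (an `L¹` function) as a tempered distribution. -/
def distSq (f : Lp ℝ 2 (volume : Measure R3)) : 𝓢'(R3, ℂ) :=
  (((memLp_one_sq f).toLp : Lp ℂ 1 (volume : Measure R3)) : 𝓢'(R3, ℂ))

/-- The `H^s` norm of a tempered distribution: the `L²` norm of the (unique) `L²` function that
represents its Bessel potential of order `s`, and `∞` if the distribution is not in `H^s`. -/
def hsNorm (s : ℝ) (f : 𝓢'(R3, ℂ)) : ℝ≥0∞ :=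
  ⨅ (g : Lp ℂ 2 (volume : Measure R3))
    (_ : besselPotential R3 ℂ s f = (g : 𝓢'(R3, ℂ))), ‖g‖ₑ

/-- `w ∈ C(I; H^s)`. -/
def ContinuousOnHs (s : ℝ) (I : Set ℝ) (w : ℝ → 𝓢'(R3, ℂ)) : Prop :=
  (∀ t ∈ I, MemSobolev s 2 (w t)) ∧
    ∀ t₀ ∈ I, Tendsto (fun t => hsNorm s (w t - w t₀)) (𝓝[I] t₀) (𝓝 0)

/-- `w` is the time derivative of `u`, in the sense of distributions in space. -/
def IsTimeDeriv (u : ℝ → Lp ℝ 2 (volume : Measure R3)) (w : ℝ → 𝓢'(R3, ℂ)) : Prop :=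
  ∀ (φ : 𝓢(R3, ℂ)) (t : ℝ), HasDerivAt (fun τ => toDist (u τ) φ) (w t φ) t

/-- Class B global solutions of `∂ₜ u + ∂ₓ Δ u + ∂ₓ (u²) = 0` on `ℝ³`; `ut` is `∂ₜ u`. -/
structure IsClassBWith (u : ℝ → Lp ℝ 2 (volume : Measure R3)) (ut : ℝ → 𝓢'(R3, ℂ)) : Prop where
  timeDeriv : IsTimeDeriv u ut
  continuous : ∀ T > 0, ∀ s < 1, ContinuousOnHs s (Set.Icc (-T) T) (fun t => toDist (u t)) ∧
    ContinuousOnHs (s - 3) (Set.Icc (-T) T) ut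
  mem : ∀ t, MemSobolev 1 2 (toDist (u t)) ∧ MemSobolev (-2) 2 (ut t)
  bounded : ∃ C : ℝ, (⨆ t, hsNorm 1 (toDist (u t))) + (⨆ t, hsNorm (-2) (ut t)) ≤ ENNReal.ofReal C
  equation : ∀ t, MemSobolev (-2) 2 (∂_{ex} (Δ (toDist (u t)))) ∧
    MemSobolev (-2) 2 (∂_{ex} (distSq (u t))) ∧
    ut t + ∂_{ex} (Δ (toDist (u t))) + ∂_{ex} (distSq (u t)) = 0

/-- `u` is a Class B global solution of the 3D Zakharov–Kuznetsov equation. -/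
def IsClassB (u : ℝ → Lp ℝ 2 (volume : Measure R3)) : Prop :=
  ∃ ut : ℝ → 𝓢'(R3, ℂ), IsClassBWith u ut

/-- Exponential decay in space around the moving centre `a(t)`, uniformly in time:
`‖u(x + a(t), t)‖_{L^∞_t L²_x(|x| > R)} ≤ C e^{-κ R}` for all `R > 0`. -/
def HasExpDecay (u : ℝ → Lp ℝ 2 (volume : Measure R3)) (a : ℝ → R3) (κ C : ℝ) : Prop :=
  ∀ R > 0, ∀ᵐ t : ℝ, eLpNorm (fun x => u t (x + a t)) 2
    ((volume : Measure R3).restrict {x | R < ‖x‖}) ≤ ENNReal.ofReal (C * Real.exp (-κ * R))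

end ZK

end

/-! The mechanism is Kato smoothing. Spatial localization allows conjugation by e^{βx}, x being the
first coordinate. At each frequency, V = 𝓕(e^{βx}u) solves ∂ₜV = `symXLap` V + `symX` Q with Q =
𝓕(e^{βx}u²), and Re `symXLap` = β³ - 4π²β(|ξ|² + 2ξ₀²). The dispersive equation thus becomes
heat-like, forward in time for β > 0 and backward for β < 0. Since u is global and bounded, data may
be taken one time unit away on either side: Duhamel damps the data by e^{-b(1+|ξ|)²} and divides a
forcing of size |ξ||Q| by |ξ|². Decay of order q for Q therefore gives order q + 1 for V
(`IsClassBWith.hasWeightedDecay_add_one`).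

Such bounds are uniform in time only relative to the factor e^{βc(t)}, so the centre c must move
boundedly in unit time. The given centre is arbitrary; it is controlled through conservation of mass
(`IsClassBWith.norm_eq`) and uniform continuity in L² (`IsClassBWith.exists_norm_sub_le`): profiles
at nearby times are close and carry a fixed mass, so their balls of concentration meet. This gives
`IsClassBWith.exists_uniformlyLocalized`.

The nonlinear term Q is the convolution of û with V. The H¹ bound on û makes the decay order of V
climb through 1, 8/5, 49/25, 2. To go further, pointwise decay of û itself is needed. Localization
makes û holomorphic in a strip in its first variable, with the transforms for β = ±b on the two
boundary lines, so Phragmén–Lindelöf transfers their decay to the middle line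
(`norm_fourier_le_of_weighted`). The order then reaches 9/4 and grows by 1/8 per round
(`IsClassBWith.hasWeightedDecay_fV`).

Once û decays faster than every power, uniformly in time, the Sobolev bounds are immediate. The
unweighted equation writes ∂ₜû through polynomial symbols and a convolution, so all time derivatives
of û decay rapidly as well, and Fourier inversion produces a smooth representative in (t, x). -/

noncomputable section

namespace ZK

open FourierTransform Complex ComplexConjugate
open scoped RealInnerProductSpace

/-! ### Fourier integrals on L¹ ∩ L². -/

section FourierL2

variable {V : Type*} [NormedAddCommGroup V] [InnerProductSpace ℝ V] [FiniteDimensional ℝ V]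
  [MeasurableSpace V] [BorelSpace V]

theorem continuous_fourier {f : V → ℂ} (hf : Integrable f) : Continuous (𝓕 f) :=
  VectorFourier.fourierIntegral_continuous Real.continuous_fourierChar
    (by exact continuous_inner) hf

theorem norm_fourier_le_integral (f : V → ℂ) (ξ : V) : ‖𝓕 f ξ‖ ≤ ∫ x, ‖f x‖ :=
  VectorFourier.norm_fourierIntegral_le_integral_norm _ _ _ _ _

theorem integral_fourier_mul_eq {f g : V → ℂ} (hf : Integrable f) (hg : Integrable g) :
    ∫ ξ, 𝓕 f ξ * g ξ = ∫ x, f x * 𝓕 g x := by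
  have := VectorFourier.integral_fourierIntegral_smul_eq_flip (L := innerₗ V) (f := f) (g := g)
    (μ := volume) (ν := volume) Real.continuous_fourierChar (by exact continuous_inner) hf hg
  simp only [flip_innerₗ, smul_eq_mul] at this
  exact this

/-- The Fourier transform on `L²` is given by the Fourier integral on `L¹ ∩ L²`. -/
theorem fourier_toLp_ae_eq {f : V → ℂ} (h1 : Integrable f) (h2 : MemLp f 2) :
    ((𝓕 (h2.toLp f) : Lp ℂ 2 (volume : Measure V)) : V → ℂ) =ᵐ[volume] 𝓕 f := by
  apply ae_eq_of_integral_contDiff_smul_eq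
  · exact (Lp.memLp _).locallyIntegrable (by norm_num)
  · exact (continuous_fourier h1).locallyIntegrable
  intro g g_smooth g_cpt
  have hg₁ : HasCompactSupport (Complex.ofRealCLM ∘ g) := g_cpt.comp_left rfl
  have hg₂ : ContDiff ℝ ∞ (Complex.ofRealCLM ∘ g) := by fun_prop
  set φ : 𝓢(V, ℂ) := hg₁.toSchwartzMap hg₂ with hφ
  have hφa : ∀ x, φ x = (g x : ℂ) := fun x => by simp [hφ]
  calc
    ∫ x, g x • ((𝓕 (h2.toLp f) : Lp ℂ 2 (volume : Measure V)) : V → ℂ) x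
      = ((𝓕 (h2.toLp f) : Lp ℂ 2 (volume : Measure V)) : 𝓢'(V, ℂ)) φ := by
        simp [Lp.toTemperedDistribution_apply, hφa]
    _ = ((h2.toLp f : Lp ℂ 2 (volume : Measure V)) : 𝓢'(V, ℂ)) (𝓕 φ) := by
        rw [← Lp.fourier_toTemperedDistribution_eq, TemperedDistribution.fourier_apply]
    _ = ∫ x, f x * 𝓕 (φ : V → ℂ) x := by
        rw [Lp.toTemperedDistribution_apply]
        apply integral_congr_ae
        filter_upwards [h2.coeFn_toLp] with x hx
        rw [hx, smul_eq_mul, mul_comm, SchwartzMap.fourier_coe]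
    _ = ∫ x, g x • 𝓕 f x := by
        rw [← integral_fourier_mul_eq h1 φ.integrable]
        congr 1 with x
        rw [hφa, mul_comm]; simp

theorem memLp_fourier {f : V → ℂ} (h1 : Integrable f) (h2 : MemLp f 2) : MemLp (𝓕 f) 2 :=
  (memLp_congr_ae (fourier_toLp_ae_eq h1 h2)).1 (Lp.memLp _)

theorem eLpNorm_fourier {f : V → ℂ} (h1 : Integrable f) (h2 : MemLp f 2) :
    eLpNorm (𝓕 f) 2 volume = eLpNorm f 2 volume := by
  rw [← eLpNorm_congr_ae (fourier_toLp_ae_eq h1 h2), ← eLpNorm_congr_ae h2.coeFn_toLp,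
    ← Lp.enorm_def, ← Lp.enorm_def]
  simp only [← ofReal_norm, Lp.norm_fourier_eq]

/-- Parseval for g against k(x) = conj(e^{-2πi⟨x,ξ⟩} f(x)), whose transform at η is conj(𝓕 f(ξ -
η)). The identity holds at every ξ, not only almost everywhere. -/
theorem fourier_mul_eq_integral {f g : V → ℂ} (hf1 : Integrable f) (hf2 : MemLp f 2)
    (hg1 : Integrable g) (hg2 : MemLp g 2) (ξ : V) :
    𝓕 (fun x => f x * g x) ξ = ∫ η, 𝓕 f (ξ - η) * 𝓕 g η := by
  set k : V → ℂ := fun x => conj ((Real.fourierChar (-⟪x, ξ⟫) : ℂ) * f x) with hk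
  have hmeas : Continuous fun x : V => (Real.fourierChar (-⟪x, ξ⟫) : ℂ) :=
    continuous_subtype_val.comp (Real.continuous_fourierChar.comp (by fun_prop))
  have hkm : AEStronglyMeasurable k volume := by
    exact continuous_conj.comp_aestronglyMeasurable
      (hmeas.aestronglyMeasurable.mul hf1.aestronglyMeasurable)
  have hkn : ∀ x, ‖k x‖ = ‖f x‖ := fun x => by
    simp only [hk, RCLike.norm_conj, norm_mul, Circle.norm_coe, one_mul]
  have hk1 : Integrable k := hf1.congr' hkm (.of_forall fun x => (hkn x).symm)
  have hk2 : MemLp k 2 := hf2.congr_norm hkm (.of_forall fun x => (hkn x).symm)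
  have hfk : ∀ η, 𝓕 k η = conj (𝓕 f (ξ - η)) := by
    intro η
    rw [Real.fourier_eq, Real.fourier_eq, ← integral_conj]
    congr 1 with x
    simp only [hk, Circle.smul_def, smul_eq_mul, map_mul, ← Circle.coe_inv_eq_conj,
      ← AddChar.map_neg_eq_inv, ← mul_assoc, ← Circle.coe_mul, ← AddChar.map_add_eq_mul]
    congr 3
    rw [inner_sub_right]; ring_nf
  have h := Lp.inner_fourier_eq (hk2.toLp k) (hg2.toLp g)
  rw [L2.inner_def, L2.inner_def] at h
  have hl : ∫ a, inner ℂ ((𝓕 (hk2.toLp k) : Lp ℂ 2 (volume : Measure V)) a)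
      ((𝓕 (hg2.toLp g) : Lp ℂ 2 (volume : Measure V)) a) = ∫ η, 𝓕 f (ξ - η) * 𝓕 g η := by
    apply integral_congr_ae
    filter_upwards [fourier_toLp_ae_eq hk1 hk2, fourier_toLp_ae_eq hg1 hg2] with x h1 h2
    rw [h1, h2, hfk]; simp [mul_comm]
  have hr : ∫ a, inner ℂ ((hk2.toLp k) a) ((hg2.toLp g) a) = 𝓕 (fun x => f x * g x) ξ := by
    rw [Real.fourier_eq]
    apply integral_congr_ae
    filter_upwards [hk2.coeFn_toLp, hg2.coeFn_toLp] with x h1 h2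
    rw [h1, h2]; simp [hk, Circle.smul_def]; ring
  rw [← hr, ← h, hl]

end FourierL2

/-! ### Sobolev norms read on the Fourier side. -/

section Distributions

theorem toDist_apply (f : Lp ℝ 2 (volume : Measure R3)) (φ : 𝓢(R3, ℂ)) :
    toDist f φ = ∫ x, φ x * (f x : ℂ) := by
  rw [toDist, Lp.toTemperedDistribution_apply]
  apply integral_congr_ae
  filter_upwards [Complex.ofRealCLM.coeFn_compLp f] with x hx
  rw [hx]; simp

theorem distSq_apply (f : Lp ℝ 2 (volume : Measure R3)) (φ : 𝓢(R3, ℂ)) :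
    distSq f φ = ∫ x, φ x * ((f x ^ 2 : ℝ) : ℂ) := by
  rw [distSq, Lp.toTemperedDistribution_apply]
  apply integral_congr_ae
  filter_upwards [(memLp_one_sq f).coeFn_toLp] with x hx
  rw [hx]; simp

theorem toTemperedDistribution_injective {p : ℝ≥0∞} [Fact (1 ≤ p)]
    {f g : Lp ℂ p (volume : Measure R3)} (h : (f : 𝓢'(R3, ℂ)) = (g : 𝓢'(R3, ℂ))) : f = g :=
  LinearMap.ker_eq_bot.1 (Lp.ker_toTemperedDistributionCLM_eq_bot (F := ℂ)
    (μ := (volume : Measure R3)) (p := p)) h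

/-- The order-zero Bessel potential is the identity and an L² function is determined by its
distribution, so the infimum defining `hsNorm` has only one competitor. -/
theorem enorm_sub_le_hsNorm_zero (f g : Lp ℝ 2 (volume : Measure R3)) :
    ‖f - g‖ₑ ≤ hsNorm 0 (toDist f - toDist g) := by
  refine le_iInf₂ fun k hk => ?_
  have h1 : k = Complex.ofRealCLM.compLp (f - g) := by
    apply toTemperedDistribution_injective
    rw [← hk, besselPotential_zero]
    simp only [toDist, ContinuousLinearMap.id_apply, ← Lp.toTemperedDistributionCLM_apply,
      ← map_sub]
    congr 1
    exact ((Complex.ofRealCLM.compLpL 2 (volume : Measure R3)).map_sub f g).symm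
  rw [h1, Lp.enorm_def, Lp.enorm_def]
  refine le_of_eq (eLpNorm_congr_norm_ae ?_)
  filter_upwards [Complex.ofRealCLM.coeFn_compLp (f - g)] with x hx
  rw [hx]; simp

/-- A real-valued `L²` function as a complex-valued one. -/
abbrev toComplexLp (f : Lp ℝ 2 (volume : Measure R3)) : Lp ℂ 2 (volume : Measure R3) :=
  Complex.ofRealCLM.compLp f

theorem besselPotential_toDist_eq_iff_Lp (s : ℝ) (f : Lp ℝ 2 (volume : Measure R3))
    (g : Lp ℂ 2 (volume : Measure R3)) :
    besselPotential R3 ℂ s (toDist f) = (g : 𝓢'(R3, ℂ)) ↔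
      (fun ξ : R3 => (((1 + ‖ξ‖ ^ 2) ^ (s / 2) : ℝ) : ℂ) *
        (𝓕 (toComplexLp f) : Lp ℂ 2 (volume : Measure R3)) ξ)
        =ᵐ[volume] (𝓕 g : Lp ℂ 2 (volume : Measure R3)) := by
  set J : R3 → ℂ := fun ξ => (((1 + ‖ξ‖ ^ 2) ^ (s / 2) : ℝ) : ℂ) with hJ
  have hJt : J.HasTemperateGrowth := by rw [hJ]; fun_prop
  have e1 : besselPotential R3 ℂ s (toDist f) = (g : 𝓢'(R3, ℂ)) ↔
      smulLeftCLM ℂ J (𝓕 (toDist f)) = ((𝓕 g : Lp ℂ 2 (volume : Measure R3)) : 𝓢'(R3, ℂ)) := by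
    rw [← Lp.fourier_toTemperedDistribution_eq,
      ← fourier_besselPotential_eq_smulLeftCLM_fourier_apply]
    exact ⟨fun h => by rw [h], fun h => by
      have h' := congrArg (fun T => 𝓕⁻ T) h
      simp only [fourierInv_fourier_eq] at h'
      exact h'⟩
  have e2 : ∀ φ : 𝓢(R3, ℂ), smulLeftCLM ℂ J (𝓕 (toDist f)) φ =
      ∫ ξ, φ ξ * (J ξ * (𝓕 (toComplexLp f) : Lp ℂ 2 (volume : Measure R3)) ξ) := by
    intro φ
    rw [toDist, Lp.fourier_toTemperedDistribution_eq, smulLeftCLM_apply_apply,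
      Lp.toTemperedDistribution_apply]
    congr 1 with x
    rw [SchwartzMap.smulLeftCLM_apply_apply hJt]
    simp only [smul_eq_mul]; ring
  rw [e1]
  constructor
  · intro h
    apply ae_eq_of_integral_contDiff_smul_eq
    · exact ((Lp.memLp _).locallyIntegrable (by norm_num)).continuous_mul hJt.1.continuous
    · exact (Lp.memLp _).locallyIntegrable (by norm_num)
    intro k k_smooth k_cpt
    have hg₁ : HasCompactSupport (Complex.ofRealCLM ∘ k) := k_cpt.comp_left rfl
    have hg₂ : ContDiff ℝ ∞ (Complex.ofRealCLM ∘ k) := by fun_prop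
    have := congrArg (fun T => T (hg₁.toSchwartzMap hg₂)) h
    simp only [e2, Lp.toTemperedDistribution_apply] at this
    simpa using this
  · intro h
    ext φ
    rw [e2, Lp.toTemperedDistribution_apply]
    apply integral_congr_ae
    filter_upwards [h] with x hx
    rw [← hx]; simp [hJ]

/-- The symbol of the Bessel potential acts on the Fourier integral of an `L¹ ∩ L²` function. -/
theorem besselPotential_toDist_eq_iff (s : ℝ) (f : Lp ℝ 2 (volume : Measure R3))
    (hf : Integrable (f : R3 → ℝ)) (g : Lp ℂ 2 (volume : Measure R3)) :
    besselPotential R3 ℂ s (toDist f) = (g : 𝓢'(R3, ℂ)) ↔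
      (fun ξ : R3 => (((1 + ‖ξ‖ ^ 2) ^ (s / 2) : ℝ) : ℂ) * 𝓕 (fun x => (f x : ℂ)) ξ)
        =ᵐ[volume] (𝓕 g : Lp ℂ 2 (volume : Measure R3)) := by
  have hF : ((𝓕 (toComplexLp f) : Lp ℂ 2 (volume : Measure R3)) : R3 → ℂ) =ᵐ[volume]
      𝓕 (fun x => (f x : ℂ)) := by
    have h2 : MemLp (fun x => (f x : ℂ)) 2 (volume : Measure R3) := (Lp.memLp f).ofReal
    have : h2.toLp _ = toComplexLp f := by
      apply Lp.ext
      filter_upwards [Complex.ofRealCLM.coeFn_compLp f, h2.coeFn_toLp] with x hx hx'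
      rw [hx, hx']; simp
    rw [← this]
    exact fourier_toLp_ae_eq hf.ofReal h2
  rw [besselPotential_toDist_eq_iff_Lp]
  have hJF : (fun ξ : R3 => (((1 + ‖ξ‖ ^ 2) ^ (s / 2) : ℝ) : ℂ) *
      (𝓕 (toComplexLp f) : Lp ℂ 2 (volume : Measure R3)) ξ) =ᵐ[volume]
      (fun ξ : R3 => (((1 + ‖ξ‖ ^ 2) ^ (s / 2) : ℝ) : ℂ) * 𝓕 (fun x => (f x : ℂ)) ξ) := by
    filter_upwards [hF] with x hx
    rw [hx]
  exact ⟨fun h => hJF.symm.trans h, fun h => hJF.trans h⟩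

theorem enorm_toComplexLp (f : Lp ℝ 2 (volume : Measure R3)) : ‖toComplexLp f‖ₑ = ‖f‖ₑ := by
  rw [Lp.enorm_def, Lp.enorm_def]
  refine eLpNorm_congr_norm_ae ?_
  filter_upwards [Complex.ofRealCLM.coeFn_compLp f] with x hx
  rw [hx]; simp

theorem enorm_le_hsNorm {s : ℝ} (hs : 0 ≤ s) (f : Lp ℝ 2 (volume : Measure R3)) :
    ‖f‖ₑ ≤ hsNorm s (toDist f) := by
  refine le_iInf₂ fun g hg => ?_
  rw [besselPotential_toDist_eq_iff_Lp] at hg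
  rw [← enorm_toComplexLp, ← ofReal_norm, ← ofReal_norm, ← Lp.norm_fourier_eq (toComplexLp f),
    ← Lp.norm_fourier_eq g, ofReal_norm, ofReal_norm, Lp.enorm_def, Lp.enorm_def]
  refine eLpNorm_mono_ae ?_
  filter_upwards [hg] with ξ hξ
  rw [← hξ, norm_mul, Complex.norm_real, Real.norm_of_nonneg (by positivity)]
  exact le_mul_of_one_le_left (norm_nonneg _)
    (Real.one_le_rpow (by nlinarith [sq_nonneg ‖ξ‖]) (by positivity))

theorem eLpNorm_bessel_fourier_le (s : ℝ) (f : Lp ℝ 2 (volume : Measure R3))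
    (hf : Integrable (f : R3 → ℝ)) :
    eLpNorm (fun ξ : R3 => (((1 + ‖ξ‖ ^ 2) ^ (s / 2) : ℝ) : ℂ) * 𝓕 (fun x => (f x : ℂ)) ξ) 2 volume
      ≤ hsNorm s (toDist f) := by
  refine le_iInf₂ fun g hg => ?_
  rw [eLpNorm_congr_ae ((besselPotential_toDist_eq_iff s f hf g).1 hg), ← Lp.enorm_def,
    ← ofReal_norm, Lp.norm_fourier_eq, ofReal_norm]

theorem memSobolev_and_hsNorm_le (s : ℝ) (f : Lp ℝ 2 (volume : Measure R3))
    (hf : Integrable (f : R3 → ℝ))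
    (h : MemLp (fun ξ : R3 => (((1 + ‖ξ‖ ^ 2) ^ (s / 2) : ℝ) : ℂ) * 𝓕 (fun x => (f x : ℂ)) ξ) 2
      volume) :
    MemSobolev s 2 (toDist f) ∧ hsNorm s (toDist f) ≤
      eLpNorm (fun ξ : R3 => (((1 + ‖ξ‖ ^ 2) ^ (s / 2) : ℝ) : ℂ) * 𝓕 (fun x => (f x : ℂ)) ξ) 2
        volume := by
  have key : besselPotential R3 ℂ s (toDist f) =
      ((𝓕⁻ (h.toLp _) : Lp ℂ 2 (volume : Measure R3)) : 𝓢'(R3, ℂ)) := by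
    rw [besselPotential_toDist_eq_iff s f hf, fourier_fourierInv_eq]
    exact h.coeFn_toLp.symm
  refine ⟨⟨_, key⟩, (iInf₂_le (𝓕⁻ (h.toLp _)) key).trans ?_⟩
  rw [← ofReal_norm, ← Lp.norm_fourier_eq, fourier_fourierInv_eq, ofReal_norm, Lp.enorm_def,
    eLpNorm_congr_ae h.coeFn_toLp]

end Distributions

/-! ### Consequences of the class B axioms. -/

section ClassB

variable {u : ℝ → Lp ℝ 2 (volume : Measure R3)} {ut : ℝ → 𝓢'(R3, ℂ)}

theorem IsClassBWith.continuous_L2 (h : IsClassBWith u ut) : Continuous u := by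
  rw [continuous_iff_continuousAt]
  intro t₀
  have hT : (0 : ℝ) < |t₀| + 1 := by positivity
  have h0 := (h.continuous _ hT 0 one_pos).1.2 t₀
    ⟨by linarith [neg_abs_le t₀], by linarith [le_abs_self t₀]⟩
  rw [nhdsWithin_eq_nhds.2 (Icc_mem_nhds (by linarith [neg_abs_le t₀])
    (by linarith [le_abs_self t₀]))] at h0
  rw [ContinuousAt, tendsto_iff_edist_tendsto_0]
  refine tendsto_of_tendsto_of_tendsto_of_le_of_le tendsto_const_nhds h0 (fun _ => zero_le)
    fun t => ?_
  simp only [edist_eq_enorm_sub]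
  exact enorm_sub_le_hsNorm_zero _ _

/-- The weak form, the only one in which the equation is used later. Both terms carry an odd number
of derivatives, so transposition cancels the sign from moving them to the right-hand side. -/
theorem IsClassBWith.hasDerivAt_pairing (h : IsClassBWith u ut) (φ : 𝓢(R3, ℂ)) (t : ℝ) :
    HasDerivAt (fun τ => ∫ x, φ x * (u τ x : ℂ))
      ((∫ x, (Δ (∂_{ex} φ)) x * (u t x : ℂ)) + ∫ x, (∂_{ex} φ) x * ((u t x ^ 2 : ℝ) : ℂ)) t := by
  have h1 := h.timeDeriv φ t
  have h2 := congrArg (fun T => T φ) (h.equation t).2.2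
  simp only [toDist_apply] at h1
  convert h1 using 1
  simp only [add_apply, lineDerivOp_apply_apply, map_neg] at h2
  simp only [laplacian_apply_apply, toDist_apply, distSq_apply] at h2
  have h3 : (0 : 𝓢'(R3, ℂ)) φ = 0 := rfl
  rw [h3] at h2
  linear_combination -h2

theorem IsClassBWith.exists_hsNorm_one_le (h : IsClassBWith u ut) :
    ∃ B : ℝ, 0 ≤ B ∧ ∀ t, hsNorm 1 (toDist (u t)) ≤ ENNReal.ofReal B := by
  obtain ⟨B, hB⟩ := h.bounded
  exact ⟨max B 0, le_max_right _ _, fun t => (le_iSup (fun t => hsNorm 1 (toDist (u t))) t).trans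
    (le_self_add.trans (hB.trans (ENNReal.ofReal_le_ofReal (le_max_left _ _))))⟩

theorem IsClassBWith.exists_norm_le (h : IsClassBWith u ut) : ∃ B : ℝ, ∀ t, ‖u t‖ ≤ B := by
  obtain ⟨B, hB0, hB⟩ := h.exists_hsNorm_one_le
  refine ⟨B, fun t => ?_⟩
  have := (enorm_le_hsNorm zero_le_one (u t)).trans (hB t)
  rwa [← ofReal_norm, ENNReal.ofReal_le_ofReal_iff hB0] at this

end ClassB

/-! ### Choice of a centre at every time. -/

section Decay

/-- Exponential decay in `L²` around the centre `c`. -/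
def DecaysAround (f : R3 → ℝ) (c : R3) (κ C : ℝ) : Prop :=
  ∀ R > 0, eLpNorm f 2 ((volume : Measure R3).restrict {x | R < ‖x - c‖}) ≤
    ENNReal.ofReal (C * Real.exp (-κ * R))

theorem measurableSet_lt_norm_sub (R : ℝ) (c : R3) : MeasurableSet {x : R3 | R < ‖x - c‖} :=
  measurableSet_lt measurable_const (by fun_prop)

theorem eLpNorm_translate_restrict {f : R3 → ℝ} (hf : AEStronglyMeasurable f volume) (c : R3)
    (R : ℝ) : eLpNorm (fun x => f (x + c)) 2 ((volume : Measure R3).restrict {x | R < ‖x‖}) =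
      eLpNorm f 2 ((volume : Measure R3).restrict {x | R < ‖x - c‖}) := by
  have h := (measurePreserving_add_right (volume : Measure R3) c).restrict_preimage
    (measurableSet_lt_norm_sub R c)
  have h2 : (fun x => x + c) ⁻¹' {x : R3 | R < ‖x - c‖} = {x | R < ‖x‖} := by
    ext x; simp
  rw [h2] at h
  exact eLpNorm_comp_measurePreserving hf.restrict h

theorem eLpNorm_le_add_restrict_compl {f : R3 → ℝ} (hf : AEStronglyMeasurable f volume)
    {s : Set R3} (hs : MeasurableSet s) :
    eLpNorm f 2 volume ≤ eLpNorm f 2 (volume.restrict s) + eLpNorm f 2 (volume.restrict sᶜ) := by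
  rw [← eLpNorm_indicator_eq_eLpNorm_restrict hs, ← eLpNorm_indicator_eq_eLpNorm_restrict hs.compl]
  conv_lhs => rw [← Set.indicator_self_add_compl s f]
  exact eLpNorm_add_le (hf.indicator hs) (hf.indicator hs.compl) (by norm_num)

theorem eLpNorm_restrict_le_add (f g : Lp ℝ 2 (volume : Measure R3)) (s : Set R3) :
    eLpNorm f 2 (volume.restrict s) ≤ ‖f - g‖ₑ + eLpNorm g 2 (volume.restrict s) := by
  have h1 : eLpNorm f 2 (volume.restrict s) =
      eLpNorm (fun x => (f - g : Lp ℝ 2 (volume : Measure R3)) x + g x) 2 (volume.restrict s) := by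
    apply eLpNorm_congr_ae
    filter_upwards [ae_restrict_of_ae (Lp.coeFn_sub f g)] with x hx
    rw [hx]; simp
  rw [h1]
  refine (eLpNorm_add_le (Lp.aestronglyMeasurable _).restrict
    (Lp.aestronglyMeasurable _).restrict (by norm_num)).trans ?_
  gcongr
  rw [Lp.enorm_def]
  exact eLpNorm_mono_measure _ Measure.restrict_le_self

/-- If the centres were more than 2R apart, the R-ball around c would lie in the tail region of g.
Then f would be bounded by its own tail, the tail of g and ‖f - g‖, which is less than ‖f‖. -/
theorem DecaysAround.norm_sub_le {f g : Lp ℝ 2 (volume : Measure R3)} {c d : R3} {κ C R : ℝ}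
    (hf : DecaysAround f c κ C) (hg : DecaysAround g d κ C) (hR : 0 < R) (hC : 0 ≤ C)
    (h : 2 * (C * Real.exp (-κ * R)) + ‖f - g‖ < ‖f‖) : ‖c - d‖ ≤ 2 * R := by
  by_contra! hcd
  have hE : 0 ≤ C * Real.exp (-κ * R) := by positivity
  have key : ‖f‖ₑ ≤ ENNReal.ofReal (2 * (C * Real.exp (-κ * R)) + ‖f - g‖) := by
    rw [Lp.enorm_def]
    refine (eLpNorm_le_add_restrict_compl (Lp.aestronglyMeasurable f)
      (measurableSet_lt_norm_sub R c)).trans ?_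
    refine (add_le_add (hf R hR) (eLpNorm_restrict_le_add f g _)).trans ?_
    have h2 : eLpNorm g 2 (volume.restrict {x | R < ‖x - c‖}ᶜ) ≤
        ENNReal.ofReal (C * Real.exp (-κ * R)) := by
      refine (eLpNorm_mono_measure _ (Measure.restrict_mono ?_ le_rfl)).trans (hg R hR)
      intro x hx
      simp only [Set.mem_compl_iff, Set.mem_ofPred_eq, not_lt] at hx ⊢
      have : ‖c - d‖ ≤ ‖x - c‖ + ‖x - d‖ := by
        rw [← norm_neg (x - c)]
        calc ‖c - d‖ = ‖-(x - c) + (x - d)‖ := by congr 1; abel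
          _ ≤ _ := norm_add_le _ _
      linarith
    refine (add_le_add_right (add_le_add_right h2 _) _).trans ?_
    rw [← ofReal_norm, ← ENNReal.ofReal_add (norm_nonneg _) hE,
      ← ENNReal.ofReal_add hE (by positivity)]
    apply ENNReal.ofReal_le_ofReal
    linarith
  rw [← ofReal_norm, ENNReal.ofReal_le_ofReal_iff (by positivity)] at key
  linarith

/-- The hypothesis holds only for almost every time, with a null set depending on R. At an
exceptional time the centre is obtained as a limit point of centres at good times, which stay
bounded by the overlap argument; L² continuity carries the decay to the limit. -/
theorem exists_decaysAround {u : ℝ → Lp ℝ 2 (volume : Measure R3)} (hu : Continuous u) {B : ℝ}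
    (hB : ∀ t, ‖u t‖ ≤ B) {a : ℝ → R3} {κ C : ℝ} (hκ : 0 < κ) (h : HasExpDecay u a κ C) :
    ∃ (c : ℝ → R3) (D : ℝ), 0 ≤ D ∧ ∀ t, DecaysAround (u t) (c t) κ D := by
  have hB0 : 0 ≤ B := (norm_nonneg _).trans (hB 0)
  set C₂ := max C B with hC₂
  have hC₂0 : 0 ≤ C₂ := hB0.trans (le_max_right _ _)
  have hbase : ∀ t (s : Set R3), eLpNorm (u t) 2 (volume.restrict s) ≤ ENNReal.ofReal B := by
    intro t s
    refine (eLpNorm_mono_measure _ Measure.restrict_le_self).trans ?_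
    rw [← Lp.enorm_def, ← ofReal_norm]
    exact ENNReal.ofReal_le_ofReal (hB t)
  have hsmall : ∀ R ≤ 1, ENNReal.ofReal B ≤
      ENNReal.ofReal (C₂ * Real.exp κ * Real.exp (-κ * R)) := by
    intro R hR
    apply ENNReal.ofReal_le_ofReal
    rw [mul_assoc, ← Real.exp_add]
    calc B ≤ C₂ * 1 := by rw [mul_one]; exact le_max_right _ _
      _ ≤ _ := by
        gcongr
        rw [Real.one_le_exp_iff]; nlinarith
  -- Only integer radii are used, so that a single null set of times serves for all of them.
  have hG : ∀ᵐ t : ℝ, ∀ n : ℕ, 0 < n →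
      eLpNorm (u t) 2 (volume.restrict {x | (n : ℝ) < ‖x - a t‖}) ≤
        ENNReal.ofReal (C₂ * Real.exp (-κ * n)) := by
    rw [ae_all_iff]
    intro n
    by_cases hn : 0 < n
    · filter_upwards [h n (by exact_mod_cast hn)] with t ht _
      rw [eLpNorm_translate_restrict (Lp.aestronglyMeasurable _)] at ht
      refine ht.trans (ENNReal.ofReal_le_ofReal ?_)
      gcongr
      exact le_max_left _ _
    · exact .of_forall fun t h => absurd h hn
  -- Rounding R down to an integer costs the factor e^κ; radii at most 1 are covered by the global
  -- L² bound.
  have hG' : ∀ᵐ t : ℝ, DecaysAround (u t) (a t) κ (C₂ * Real.exp κ) := by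
    filter_upwards [hG] with t ht R hR
    rcases le_or_gt R 1 with h1 | h1
    · exact (hbase _ _).trans (hsmall R h1)
    have hn : 0 < ⌊R⌋₊ := Nat.floor_pos.2 h1.le
    have hfl : (⌊R⌋₊ : ℝ) ≤ R := Nat.floor_le hR.le
    have hfl' : R < ⌊R⌋₊ + 1 := Nat.lt_floor_add_one R
    refine (eLpNorm_mono_measure _ (Measure.restrict_mono ?_ le_rfl)).trans ((ht _ hn).trans ?_)
    · intro x hx; exact hfl.trans_lt hx
    · apply ENNReal.ofReal_le_ofReal
      rw [mul_assoc, ← Real.exp_add]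
      gcongr
      nlinarith
  set C₃ := C₂ * Real.exp κ with hC₃
  have hC₃0 : 0 ≤ C₃ := by positivity
  suffices H : ∀ t, ∃ c, DecaysAround (u t) c κ (C₃ * Real.exp κ) by
    choose c hc using H
    exact ⟨c, _, by positivity, hc⟩
  intro t
  by_cases h0 : u t = 0
  · refine ⟨0, fun R hR => ?_⟩
    rw [h0, eLpNorm_congr_ae (ae_restrict_of_ae (Lp.coeFn_zero ℝ 2 volume))]
    simp
  have hm : 0 < ‖u t‖ := norm_pos_iff.2 h0
  obtain ⟨τ, hτG, hτ⟩ := mem_closure_iff_seq_limit.1 ((Measure.dense_of_ae hG') t)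
  have hconv : Tendsto (fun n => u (τ n)) atTop (𝓝 (u t)) := (hu.tendsto t).comp hτ
  obtain ⟨R, hR0, hR⟩ : ∃ R > 0, 2 * (C₃ * Real.exp (-κ * R)) < ‖u t‖ / 4 := by
    have : Tendsto (fun R : ℝ => 2 * (C₃ * Real.exp (-κ * R))) atTop (𝓝 (2 * (C₃ * 0))) := by
      refine ((Real.tendsto_exp_atBot.comp ?_).const_mul _).const_mul _
      exact tendsto_id.const_mul_atTop_of_neg (neg_lt_zero.2 hκ)
    rw [mul_zero, mul_zero] at this
    obtain ⟨R, h1, h2⟩ := ((this.eventually (gt_mem_nhds (by positivity : 0 < ‖u t‖ / 4))).and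
      (eventually_gt_atTop 0)).exists
    exact ⟨R, h2, h1⟩
  -- Past N any two profiles differ by less than ‖u t‖/4 and have norm above 7‖u t‖/8, while the two
  -- tails add up to less than ‖u t‖/4: the overlap criterion applies.
  obtain ⟨N, hN⟩ := Metric.tendsto_atTop.1 hconv (‖u t‖ / 8) (by positivity)
  have hball : ∀ n, a (τ (n + N)) ∈ Metric.closedBall (a (τ N)) (2 * R) := by
    intro n
    rw [mem_closedBall_iff_norm]
    refine DecaysAround.norm_sub_le (hτG (n + N)) (hτG N) hR0 hC₃0 ?_
    have h1 := hN (n + N) (by omega)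
    have h2 := hN N le_rfl
    rw [dist_eq_norm] at h1 h2
    have h3 : ‖u (τ (n + N)) - u (τ N)‖ ≤ ‖u (τ (n + N)) - u t‖ + ‖u (τ N) - u t‖ := by
      rw [← norm_neg (u (τ N) - u t)]
      calc _ = ‖(u (τ (n + N)) - u t) + -(u (τ N) - u t)‖ := by congr 1; abel
        _ ≤ _ := norm_add_le _ _
    have h4 : ‖u t‖ ≤ ‖u (τ (n + N))‖ + ‖u (τ (n + N)) - u t‖ := by
      rw [← norm_neg (u (τ (n + N)) - u t)]
      calc _ = ‖u (τ (n + N)) + -(u (τ (n + N)) - u t)‖ := by congr 1; abel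
        _ ≤ _ := norm_add_le _ _
    linarith
  obtain ⟨c, -, ψ, hψ, hc⟩ := (isCompact_closedBall (a (τ N)) (2 * R)).tendsto_subseq hball
  refine ⟨c, fun S hS => ?_⟩
  rcases le_or_gt S 1 with h1 | h1
  · refine (hbase _ _).trans ((hsmall S h1).trans (ENNReal.ofReal_le_ofReal ?_))
    gcongr
    exact le_mul_of_one_le_right hC₃0 (Real.one_le_exp hκ.le)
  have hsub : Tendsto (fun n => u (τ (ψ n + N))) atTop (𝓝 (u t)) :=
    hconv.comp ((tendsto_add_atTop_nat N).comp hψ.tendsto_atTop)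
  have hlim : Tendsto (fun n => ‖u t - u (τ (ψ n + N))‖ₑ +
      ENNReal.ofReal (C₃ * Real.exp κ * Real.exp (-κ * S))) atTop
      (𝓝 (0 + ENNReal.ofReal (C₃ * Real.exp κ * Real.exp (-κ * S)))) := by
    refine Tendsto.add ?_ tendsto_const_nhds
    have := (tendsto_const_nhds (x := u t)).sub hsub
    rw [sub_self] at this
    simpa using this.enorm
  rw [zero_add] at hlim
  refine ge_of_tendsto hlim ?_
  -- Once the approximating centre is within 1 of c, radius S around c contains radius S - 1 around
  -- it. This is the second factor e^κ.
  filter_upwards [Metric.tendsto_nhds.1 hc 1 one_pos] with n hn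
  refine (eLpNorm_restrict_le_add (u t) (u (τ (ψ n + N))) _).trans ?_
  gcongr
  refine (eLpNorm_mono_measure _ (Measure.restrict_mono ?_ le_rfl)).trans
    ((hτG (ψ n + N) (S - 1) (by linarith)).trans (le_of_eq ?_))
  · intro x hx
    simp only [Set.mem_ofPred_eq, Function.comp_apply, dist_eq_norm] at hx hn ⊢
    have : ‖x - c‖ ≤ ‖x - a (τ (ψ n + N))‖ + ‖a (τ (ψ n + N)) - c‖ := by
      calc ‖x - c‖ = ‖(x - a (τ (ψ n + N))) + (a (τ (ψ n + N)) - c)‖ := by congr 1; abel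
        _ ≤ _ := norm_add_le _ _
    linarith
  · rw [mul_assoc C₃, ← Real.exp_add]
    congr 3; ring

end Decay

/-! ### Exponentially weighted L¹ and L² bounds. -/

section Weighted

theorem eLpNorm_two_sq {α F : Type*} [MeasurableSpace α] [NormedAddCommGroup F] (f : α → F)
    (μ : Measure α) : eLpNorm f 2 μ ^ 2 = ∫⁻ x, ‖f x‖ₑ ^ 2 ∂μ := by
  have := eLpNorm_nnreal_pow_eq_lintegral (f := f) (μ := μ) (p := 2) (by norm_num)
  simpa using this

theorem exp_le_one_add_tsum (κ : ℝ) (hκ : 0 < κ) (c x : R3) :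
    ENNReal.ofReal (Real.exp (κ * ‖x - c‖)) ≤ 1 + ∑' n : ℕ,
      Set.indicator {x : R3 | (n : ℝ) < ‖x - c‖}
        (fun _ => ENNReal.ofReal (Real.exp (κ * (n + 1)))) x := by
  by_cases h0 : ‖x - c‖ = 0
  · rw [h0]; simp
  have hpos : 0 < ‖x - c‖ := lt_of_le_of_ne (norm_nonneg _) (Ne.symm h0)
  set n := ⌈‖x - c‖⌉₊ - 1 with hn
  have hc1 : 0 < ⌈‖x - c‖⌉₊ := Nat.ceil_pos.2 hpos
  have hn1 : n + 1 = ⌈‖x - c‖⌉₊ := by omega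
  have hlt : (n : ℝ) < ‖x - c‖ := by
    have : n < ⌈‖x - c‖⌉₊ := by omega
    exact Nat.lt_ceil.1 this
  have hle : ‖x - c‖ ≤ n + 1 := by
    have := Nat.le_ceil ‖x - c‖
    rw [← hn1] at this
    exact_mod_cast this
  refine le_trans ?_ (le_add_of_nonneg_left zero_le)
  refine le_trans ?_ (ENNReal.le_tsum n)
  rw [Set.indicator_of_mem (show x ∈ {x : R3 | (n : ℝ) < ‖x - c‖} from hlt)]
  apply ENNReal.ofReal_le_ofReal
  gcongr

/-- Summation over unit shells. The squared tails decay like e^{-2κn} against weights e^{κ(n+1)},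
leaving a convergent geometric series of ratio e^{-κ}. -/
theorem DecaysAround.exists_weighted_bound {κ C B : ℝ} (hκ : 0 < κ) :
    ∃ K : ℝ, 0 ≤ K ∧ ∀ (f : Lp ℝ 2 (volume : Measure R3)) (c : R3), ‖f‖ ≤ B →
      DecaysAround f c κ C →
      Integrable (fun x => Real.exp (κ * ‖x - c‖) * f x ^ 2) ∧
        ∫ x, Real.exp (κ * ‖x - c‖) * f x ^ 2 ≤ K := by
  set D := max C (max B 0) with hD
  have hD0 : 0 ≤ D := (le_max_right _ _).trans (le_max_right _ _)
  have hr0 : 0 < Real.exp (-κ) := Real.exp_pos _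
  have hr1 : Real.exp (-κ) < 1 := by rw [Real.exp_lt_one_iff]; linarith
  have hsum : Summable fun n : ℕ => Real.exp (κ * (n + 1)) * (D * Real.exp (-κ * n)) ^ 2 := by
    have := (summable_geometric_of_lt_one hr0.le hr1).mul_left (Real.exp κ * D ^ 2)
    refine this.congr fun n => ?_
    rw [mul_pow, ← Real.exp_nat_mul, ← Real.exp_nat_mul, mul_left_comm, ← Real.exp_add,
      mul_right_comm, ← Real.exp_add, mul_comm]
    congr 2; push_cast; ring
  set S := ∑' n : ℕ, Real.exp (κ * (n + 1)) * (D * Real.exp (-κ * n)) ^ 2 with hS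
  have hS0 : 0 ≤ S := tsum_nonneg fun n => by positivity
  refine ⟨D ^ 2 + S, by positivity, fun f c hfB hf => ?_⟩
  have hn : ∀ n : ℕ, eLpNorm f 2 (volume.restrict {x | (n : ℝ) < ‖x - c‖}) ≤
      ENNReal.ofReal (D * Real.exp (-κ * n)) := by
    intro n
    rcases Nat.eq_zero_or_pos n with rfl | hpos
    · refine (eLpNorm_mono_measure _ Measure.restrict_le_self).trans ?_
      rw [← Lp.enorm_def, ← ofReal_norm]
      apply ENNReal.ofReal_le_ofReal
      rw [Nat.cast_zero, mul_zero, Real.exp_zero, mul_one]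
      exact hfB.trans ((le_max_left _ _).trans (le_max_right _ _))
    · refine (hf n (by exact_mod_cast hpos)).trans (ENNReal.ofReal_le_ofReal ?_)
      gcongr
      exact le_max_left _ _
  have hlint : ∫⁻ x, ENNReal.ofReal (Real.exp (κ * ‖x - c‖)) * ‖f x‖ₑ ^ 2 ≤
      ENNReal.ofReal (D ^ 2 + S) := by
    calc ∫⁻ x, ENNReal.ofReal (Real.exp (κ * ‖x - c‖)) * ‖f x‖ₑ ^ 2
        ≤ ∫⁻ x, (‖f x‖ₑ ^ 2 + ∑' n : ℕ, Set.indicator {x : R3 | (n : ℝ) < ‖x - c‖}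
            (fun x => ENNReal.ofReal (Real.exp (κ * (n + 1))) * ‖f x‖ₑ ^ 2) x) := by
          refine lintegral_mono fun x => ?_
          refine (mul_le_mul_left (exp_le_one_add_tsum κ hκ c x) _).trans (le_of_eq ?_)
          rw [add_mul, one_mul, ← ENNReal.tsum_mul_right]
          congr 2 with n
          simp only [Set.indicator_apply]
          split_ifs <;> simp
      _ = eLpNorm f 2 volume ^ 2 + ∑' n : ℕ, ENNReal.ofReal (Real.exp (κ * (n + 1))) *
            eLpNorm f 2 (volume.restrict {x | (n : ℝ) < ‖x - c‖}) ^ 2 := by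
          have hm : AEMeasurable (fun x => ‖f x‖ₑ ^ 2) (volume : Measure R3) :=
            ((Lp.aestronglyMeasurable f).enorm).pow_const _
          rw [lintegral_add_left' hm, lintegral_tsum, eLpNorm_two_sq]
          · congr 2 with n
            rw [lintegral_indicator (measurableSet_lt_norm_sub n c),
              lintegral_const_mul'' _ hm.restrict, eLpNorm_two_sq]
          · intro n
            exact (hm.const_mul _).indicator (measurableSet_lt_norm_sub n c)
      _ ≤ ENNReal.ofReal (D ^ 2) + ∑' n : ℕ, ENNReal.ofReal
            (Real.exp (κ * (n + 1)) * (D * Real.exp (-κ * n)) ^ 2) := by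
          gcongr with n
          · rw [← Lp.enorm_def, ← ofReal_norm, ENNReal.ofReal_pow hD0]
            gcongr
            exact hfB.trans ((le_max_left _ _).trans (le_max_right _ _))
          · rw [ENNReal.ofReal_mul (by positivity), ENNReal.ofReal_pow (by positivity)]
            gcongr
            exact hn n
      _ = ENNReal.ofReal (D ^ 2 + S) := by
          rw [ENNReal.ofReal_add (by positivity) hS0, hS,
            ENNReal.ofReal_tsum_of_nonneg (fun n => by positivity) hsum]
  have heq : ∀ x, ENNReal.ofReal (Real.exp (κ * ‖x - c‖)) * ‖f x‖ₑ ^ 2 =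
      ENNReal.ofReal (Real.exp (κ * ‖x - c‖) * f x ^ 2) := by
    intro x
    rw [ENNReal.ofReal_mul (by positivity), ← ofReal_norm, ← ENNReal.ofReal_pow (norm_nonneg _),
      Real.norm_eq_abs, sq_abs]
  have hmeas : AEStronglyMeasurable (fun x => Real.exp (κ * ‖x - c‖) * f x ^ 2)
      (volume : Measure R3) :=
    (Continuous.aestronglyMeasurable (by fun_prop)).mul ((Lp.aestronglyMeasurable f).pow 2)
  simp only [heq] at hlint
  have hnn : 0 ≤ᵐ[volume] fun x => Real.exp (κ * ‖x - c‖) * f x ^ 2 :=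
    .of_forall fun x => by positivity
  have h_int : Integrable (fun x => Real.exp (κ * ‖x - c‖) * f x ^ 2) :=
    (lintegral_ofReal_ne_top_iff_integrable hmeas hnn).1
      (ne_top_of_le_ne_top ENNReal.ofReal_ne_top hlint)
  refine ⟨h_int, ?_⟩
  rw [integral_eq_lintegral_of_nonneg_ae hnn hmeas]
  exact ENNReal.toReal_le_of_le_ofReal (by positivity) hlint

theorem integrable_exp_neg_mul_norm {k : ℝ} (hk : 0 < k) :
    Integrable (fun x : R3 => Real.exp (-k * ‖x‖)) := by
  have h4 : Integrable (fun x : R3 => (1 + ‖x‖) ^ (-(4 : ℝ))) :=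
    integrable_one_add_norm (by simp; norm_num)
  have hk4 : ∃ M : ℝ, ∀ r : ℝ, 0 ≤ r → Real.exp (-k * r) ≤ M * (1 + r) ^ (-(4 : ℝ)) := by
    refine ⟨Real.exp k * (24 / k ^ 4), fun r hr => ?_⟩
    have h1 := Real.pow_div_factorial_le_exp (x := k * (1 + r)) (by positivity) 4
    have h2 : Real.exp (-k * r) = Real.exp k * (Real.exp (k * (1 + r)))⁻¹ := by
      rw [← Real.exp_neg, ← Real.exp_add]; congr 1; ring
    rw [h2, Real.rpow_neg (by positivity), mul_assoc]
    have h3 : (1 + r) ^ (4 : ℝ) = (1 + r) ^ 4 := by norm_cast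
    rw [h3]
    gcongr
    rw [inv_le_iff_one_le_mul₀ (by positivity)]
    have h5 : (0:ℝ) < (k * (1 + r)) ^ 4 := by positivity
    norm_num [Nat.factorial] at h1
    calc (1 : ℝ) = 24 / k ^ 4 * ((1 + r) ^ 4)⁻¹ * ((k * (1 + r)) ^ 4 / 24) := by field_simp
      _ ≤ _ := by gcongr
  obtain ⟨M, hM⟩ := hk4
  refine (h4.const_mul M).mono' (Continuous.aestronglyMeasurable (by fun_prop))
    (.of_forall fun x => ?_)
  rw [Real.norm_of_nonneg (by positivity)]
  exact hM _ (norm_nonneg _)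

/-- A bound on the exponentially weighted `L²` norm of `f` around the centre `c`. -/
def WeightedBound (f : R3 → ℝ) (c : R3) (κ K : ℝ) : Prop :=
  Integrable (fun x => Real.exp (κ * ‖x - c‖) * f x ^ 2) ∧
    ∫ x, Real.exp (κ * ‖x - c‖) * f x ^ 2 ≤ K

theorem abs_coord_sub_le (x c : R3) : |x 0 - c 0| ≤ ‖x - c‖ := by
  have := PiLp.norm_apply_le (x - c) 0
  simpa using this

theorem exp_coord_le (b : ℝ) (x c : R3) :
    Real.exp (b * x 0) ≤ Real.exp (b * c 0) * Real.exp (|b| * ‖x - c‖) := by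
  rw [← Real.exp_add]
  apply Real.exp_le_exp.2
  have h1 : b * (x 0 - c 0) ≤ |b| * |x 0 - c 0| := by rw [← abs_mul]; exact le_abs_self _
  have h2 := mul_le_mul_of_nonneg_left (abs_coord_sub_le x c) (abs_nonneg b)
  linarith

theorem WeightedBound.recenter {f : R3 → ℝ} {c d : R3} {κ K D : ℝ} (hκ : 0 < κ)
    (hfm : AEStronglyMeasurable f volume)
    (h : WeightedBound f c κ K) (hD : ‖c - d‖ ≤ D) :
    WeightedBound f d κ (Real.exp (κ * D) * K) := by
  have hle : ∀ x, Real.exp (κ * ‖x - d‖) * f x ^ 2 ≤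
      Real.exp (κ * D) * (Real.exp (κ * ‖x - c‖) * f x ^ 2) := by
    intro x
    rw [← mul_assoc, ← Real.exp_add]
    gcongr
    rw [← mul_add]
    gcongr
    calc ‖x - d‖ = ‖(c - d) + (x - c)‖ := by congr 1; abel
      _ ≤ _ := (norm_add_le _ _).trans (by gcongr)
  have hi : Integrable (fun x => Real.exp (κ * ‖x - d‖) * f x ^ 2) :=
    (h.1.const_mul (Real.exp (κ * D))).mono'
      ((Continuous.aestronglyMeasurable (by fun_prop)).mul (hfm.pow 2))
      (.of_forall fun x => by rw [Real.norm_of_nonneg (by positivity)]; exact hle x)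
  refine ⟨hi, (integral_mono hi (h.1.const_mul _) hle).trans ?_⟩
  rw [integral_const_mul]
  have := h.2
  gcongr

/-- Multiplication by the exponential weight `e^{b x}` in the first coordinate. -/
def expWeight (b : ℝ) (f : R3 → ℝ) : R3 → ℂ := fun x => ((Real.exp (b * x 0) * f x : ℝ) : ℂ)

theorem aestronglyMeasurable_expWeight (b : ℝ) {f : R3 → ℝ}
    (hf : AEStronglyMeasurable f volume) : AEStronglyMeasurable (expWeight b f) volume :=
  Complex.continuous_ofReal.comp_aestronglyMeasurable
    ((Continuous.aestronglyMeasurable (by fun_prop)).mul hf)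

theorem norm_expWeight (b : ℝ) (f : R3 → ℝ) (x : R3) :
    ‖expWeight b f x‖ = Real.exp (b * x 0) * |f x| := by
  rw [expWeight, Complex.norm_real, norm_mul, Real.norm_of_nonneg (by positivity),
    Real.norm_eq_abs]

theorem WeightedBound.expWeight_L2 {f : R3 → ℝ} {c : R3} {κ K b : ℝ}
    (hfm : AEStronglyMeasurable f volume) (h : WeightedBound f c κ K) (hb : 2 * |b| ≤ κ) :
    MemLp (expWeight b f) 2 volume ∧
      ∫ x, ‖expWeight b f x‖ ^ 2 ≤ Real.exp (b * c 0) ^ 2 * K := by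
  have hle : ∀ x, ‖expWeight b f x‖ ^ 2 ≤
      Real.exp (b * c 0) ^ 2 * (Real.exp (κ * ‖x - c‖) * f x ^ 2) := by
    intro x
    rw [norm_expWeight, mul_pow, sq_abs, ← mul_assoc]
    gcongr
    calc Real.exp (b * x 0) ^ 2 ≤ (Real.exp (b * c 0) * Real.exp (|b| * ‖x - c‖)) ^ 2 := by
          gcongr; exact exp_coord_le b x c
      _ = Real.exp (b * c 0) ^ 2 * Real.exp (2 * |b| * ‖x - c‖) := by
          rw [mul_pow, ← Real.exp_nat_mul (|b| * ‖x - c‖)]; congr 2; push_cast; ring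
      _ ≤ _ := by gcongr
  have hm := aestronglyMeasurable_expWeight b hfm
  have hi : Integrable (fun x => ‖expWeight b f x‖ ^ 2) :=
    (h.1.const_mul _).mono' (hm.norm.pow 2)
      (.of_forall fun x => by rw [Real.norm_of_nonneg (by positivity)]; exact hle x)
  refine ⟨(memLp_two_iff_integrable_sq_norm hm).2 hi,
    (integral_mono hi (h.1.const_mul _) hle).trans ?_⟩
  rw [integral_const_mul]
  have := h.2
  gcongr

/-- With r = ‖x - c‖ and 4|b| ≤ κ, e^{|b|r}|f| is at most the product of e^{κr/2}|f| and e^{-κr/4}.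
The squares of the two factors are integrable, and the arithmetic-geometric mean inequality
concludes. -/
theorem WeightedBound.expWeight_L1 {f : R3 → ℝ} {c : R3} {κ K b : ℝ} (hκ : 0 < κ)
    (hfm : AEStronglyMeasurable f volume) (h : WeightedBound f c κ K) (hb : 4 * |b| ≤ κ) :
    Integrable (expWeight b f) volume ∧
      ∫ x, ‖expWeight b f x‖ ≤
        Real.exp (b * c 0) * (K + ∫ x : R3, Real.exp (-(κ / 2) * ‖x‖)) := by
  have hg : Integrable (fun x : R3 => Real.exp (-(κ / 2) * ‖x - c‖)) :=
    (integrable_exp_neg_mul_norm (half_pos hκ)).comp_sub_right c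
  have hle : ∀ x, ‖expWeight b f x‖ ≤
      Real.exp (b * c 0) * (Real.exp (κ * ‖x - c‖) * f x ^ 2 +
        Real.exp (-(κ / 2) * ‖x - c‖)) := by
    intro x
    rw [norm_expWeight]
    refine (mul_le_mul_of_nonneg_right (exp_coord_le b x c) (abs_nonneg _)).trans ?_
    rw [mul_assoc]
    gcongr
    set r := ‖x - c‖
    have hr : 0 ≤ r := norm_nonneg _
    have h1 : Real.exp (|b| * r) ≤ Real.exp (κ / 2 * r) * Real.exp (-(κ / 4) * r) := by
      rw [← Real.exp_add]
      apply Real.exp_le_exp.2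
      nlinarith
    have h2 : Real.exp (κ * r) = Real.exp (κ / 2 * r) ^ 2 := by
      rw [← Real.exp_nat_mul]; congr 1; push_cast; ring
    have h3 : Real.exp (-(κ / 2) * r) = Real.exp (-(κ / 4) * r) ^ 2 := by
      rw [← Real.exp_nat_mul]; congr 1; push_cast; ring
    rw [h2, h3, ← sq_abs (f x)]
    have h4 := mul_le_mul_of_nonneg_right h1 (abs_nonneg (f x))
    nlinarith [sq_nonneg (Real.exp (κ / 2 * r) * |f x| - Real.exp (-(κ / 4) * r)),
      sq_nonneg (Real.exp (κ / 2 * r) * |f x|), sq_nonneg (Real.exp (-(κ / 4) * r))]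
  have hi : Integrable (expWeight b f) :=
    ((h.1.add hg).const_mul _).mono' (aestronglyMeasurable_expWeight b hfm) (.of_forall hle)
  refine ⟨hi, (integral_mono hi.norm ((h.1.add hg).const_mul _) hle).trans ?_⟩
  rw [integral_const_mul, Pi.add_def, integral_add h.1 hg,
    integral_sub_right_eq_self (fun x : R3 => Real.exp (-(κ / 2) * ‖x‖)) c]
  have := h.2
  gcongr

end Weighted

/-! ### Gaussian-damped exponentials as test functions. -/

section GaussianTest

theorem norm_iteratedFDeriv_cexp_le (n : ℕ) (z : ℂ) :
    ‖iteratedFDeriv ℝ n Complex.exp z‖ ≤ ‖Complex.exp z‖ := by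
  induction n generalizing z with
  | zero => simp
  | succ n ih =>
    rw [← norm_iteratedFDeriv_fderiv]
    have h : fderiv ℝ Complex.exp = (ContinuousLinearMap.mul ℝ ℂ) ∘ Complex.exp := by
      ext1 z
      rw [((Complex.hasStrictDerivAt_exp z).hasDerivAt.complexToReal_fderiv).fderiv]
      ext w
      simp
    rw [h]
    refine ((ContinuousLinearMap.mul ℝ ℂ).norm_iteratedFDeriv_comp_left
      (n := n) (N := n) Complex.contDiff_exp.contDiffAt le_rfl).trans ?_
    calc _ ≤ 1 * ‖Complex.exp z‖ := by
          gcongr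
          · exact ContinuousLinearMap.opNorm_mul_le ℝ ℂ
          · exact ih z
      _ = _ := one_mul _

/-- The Gaussian-damped exponential `exp (ℓ x - ε |x|²)`. -/
def dampedExp (ℓ : R3 →L[ℝ] ℂ) (ε : ℝ) (x : R3) : ℂ := Complex.exp (ℓ x - (ε * ‖x‖ ^ 2 : ℝ))

theorem norm_dampedExp (ℓ : R3 →L[ℝ] ℂ) (ε : ℝ) (x : R3) :
    ‖dampedExp ℓ ε x‖ = Real.exp (ℓ x).re * Real.exp (-ε * ‖x‖ ^ 2) := by
  rw [dampedExp, Complex.norm_exp, ← Real.exp_add, Complex.sub_re, Complex.ofReal_re]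
  congr 1; ring

theorem exists_schwartz_dampedExp (ℓ : R3 →L[ℝ] ℂ) {ε : ℝ} (hε : 0 < ε) :
    ∃ φ : 𝓢(R3, ℂ), ∀ x, φ x = dampedExp ℓ ε x := by
  set q : R3 → ℂ := fun x => ℓ x - (ε * ‖x‖ ^ 2 : ℝ) with hq
  have hqt : q.HasTemperateGrowth := by rw [hq]; fun_prop
  have hd : ∀ k n : ℕ, ∃ C, ∀ x, ‖x‖ ^ k * ‖iteratedFDeriv ℝ n (dampedExp ℓ ε) x‖ ≤ C := by
    intro k n
    obtain ⟨m, C, hC0, hC⟩ := hqt.norm_iteratedFDeriv_le_uniform n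
    set D := max C 1 with hD
    have hD1 : 1 ≤ D := le_max_right _ _
    -- The additional 1 absorbs the e^{1+r} that dominates all polynomial factors. The constant
    -- e^{A²/(4ε)} below comes from completing the square in Ar - εr².
    set A := ‖ℓ‖ + 1 with hA
    refine ⟨n.factorial * D ^ n * ((k + m * n).factorial *
      Real.exp (1 + A ^ 2 / (4 * ε))), fun x => ?_⟩
    set r := ‖x‖ with hr
    have hr0 : 0 ≤ r := norm_nonneg x
    have h1 : ‖iteratedFDeriv ℝ n (Complex.exp ∘ q) x‖ ≤
        n.factorial * ‖Complex.exp (q x)‖ * (D * (1 + r) ^ m) ^ n := by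
      refine norm_iteratedFDeriv_comp_le (N := n) Complex.contDiff_exp
        (hqt.1.of_le (by exact_mod_cast le_top)) le_rfl x
        (fun i _ => norm_iteratedFDeriv_cexp_le i _) fun i hi hin => ?_
      have h2 : 1 ≤ D * (1 + r) ^ m := by
        have : (1:ℝ) ≤ (1 + r) ^ m := one_le_pow₀ (by linarith)
        nlinarith
      calc _ ≤ C * (1 + r) ^ m := hC i hin x
        _ ≤ D * (1 + r) ^ m := by gcongr; exact le_max_left _ _
        _ ≤ _ := le_self_pow₀ h2 (by omega)
    have h3 : ‖Complex.exp (q x)‖ ≤ Real.exp (‖ℓ‖ * r - ε * r ^ 2) := by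
      rw [Complex.norm_exp]
      apply Real.exp_le_exp.2
      simp only [hq, Complex.sub_re, Complex.ofReal_re]
      have := (Complex.re_le_norm (ℓ x)).trans (ℓ.le_opNorm x)
      linarith
    have h4 : (1 + r) ^ (k + m * n) ≤ (k + m * n).factorial * Real.exp (1 + r) := by
      have := Real.pow_div_factorial_le_exp (x := 1 + r) (by positivity) (k + m * n)
      rwa [div_le_iff₀' (by positivity)] at this
    have h5 : r ^ k ≤ (1 + r) ^ k := by gcongr; linarith
    have h6 : A * r - ε * r ^ 2 ≤ A ^ 2 / (4 * ε) := by
      rw [le_div_iff₀ (by positivity)]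
      nlinarith [sq_nonneg (A - 2 * ε * r)]
    calc r ^ k * ‖iteratedFDeriv ℝ n (dampedExp ℓ ε) x‖
        ≤ (1 + r) ^ k * (n.factorial * Real.exp (‖ℓ‖ * r - ε * r ^ 2) *
            (D * (1 + r) ^ m) ^ n) := by
          gcongr
          refine h1.trans ?_
          gcongr
      _ = n.factorial * D ^ n * ((1 + r) ^ (k + m * n) * Real.exp (‖ℓ‖ * r - ε * r ^ 2)) := by
          rw [mul_pow, ← pow_mul, pow_add]; ring
      _ ≤ n.factorial * D ^ n * ((k + m * n).factorial * Real.exp (1 + r) *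
            Real.exp (‖ℓ‖ * r - ε * r ^ 2)) := by gcongr
      _ ≤ _ := by
          rw [mul_assoc ((k + m * n).factorial : ℝ), ← Real.exp_add]
          gcongr ?_ * (?_ * Real.exp ?_)
          linarith
  exact ⟨⟨dampedExp ℓ ε, Complex.contDiff_exp.comp hqt.1, hd⟩, fun x => rfl⟩

/-- The logarithmic derivative of `dampedExp` in the direction of the `j`-th coordinate. -/
def dampedSymbol (ℓ : R3 →L[ℝ] ℂ) (ε : ℝ) (j : Fin 3) (x : R3) : ℂ :=
  ℓ (EuclideanSpace.single j 1) - (2 * ε * x j : ℝ)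

theorem hasDerivAt_dampedExp (ℓ : R3 →L[ℝ] ℂ) (ε : ℝ) (j : Fin 3) (x : R3) :
    HasDerivAt (fun t : ℝ => dampedExp ℓ ε (x + t • EuclideanSpace.single j (1 : ℝ)))
      (dampedSymbol ℓ ε j x * dampedExp ℓ ε x) 0 := by
  have hn : ∀ t : ℝ, ‖x + t • EuclideanSpace.single j (1 : ℝ)‖ ^ 2 =
      ‖x‖ ^ 2 + 2 * t * x j + t ^ 2 := by
    intro t
    rw [norm_add_sq_real, inner_smul_right, EuclideanSpace.inner_single_right, norm_smul]
    simp; ring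
  have h1 : HasDerivAt (fun t : ℝ => ‖x‖ ^ 2 + 2 * t * x j + t ^ 2) (2 * x j) 0 := by
    have h2 : HasDerivAt (fun t : ℝ => t) 1 0 := hasDerivAt_id _
    refine ((((h2.const_mul 2).mul_const (x j)).const_add (‖x‖ ^ 2)).add
      (h2.pow 2)).congr_deriv ?_
    simp
  have h3 : HasDerivAt (fun t : ℝ => ℓ x + (t : ℂ) * ℓ (EuclideanSpace.single j 1) -
      ((ε * (‖x‖ ^ 2 + 2 * t * x j + t ^ 2) : ℝ) : ℂ)) (dampedSymbol ℓ ε j x) 0 := by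
    have h4 : HasDerivAt (fun t : ℝ => (t : ℂ)) 1 0 := Complex.ofRealCLM.hasDerivAt
    refine (((h4.mul_const (ℓ (EuclideanSpace.single j 1))).const_add (ℓ x)).sub
      (h1.const_mul ε).ofReal_comp).congr_deriv ?_
    rw [dampedSymbol]; push_cast; ring
  have h5 : (fun t : ℝ => dampedExp ℓ ε (x + t • EuclideanSpace.single j (1 : ℝ))) =
      fun t : ℝ => Complex.exp (ℓ x + (t : ℂ) * ℓ (EuclideanSpace.single j 1) -
        ((ε * (‖x‖ ^ 2 + 2 * t * x j + t ^ 2) : ℝ) : ℂ)) := by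
    ext t
    rw [dampedExp, hn, map_add, map_smul, Complex.real_smul]
  rw [h5]
  refine h3.cexp.congr_deriv ?_
  rw [dampedExp]; simp [mul_comm]

theorem hasDerivAt_dampedSymbol (ℓ : R3 →L[ℝ] ℂ) (ε : ℝ) (i j : Fin 3) (x : R3) :
    HasDerivAt (fun t : ℝ => dampedSymbol ℓ ε i (x + t • EuclideanSpace.single j (1 : ℝ)))
      (if i = j then -(2 * ε : ℂ) else 0) 0 := by
  have h4 : HasDerivAt (fun t : ℝ => (t : ℂ)) 1 0 := Complex.ofRealCLM.hasDerivAt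
  have h5 := (h4.mul_const (if i = j then -(2 * ε : ℂ) else 0)).const_add
    (dampedSymbol ℓ ε i x)
  rw [one_mul] at h5
  refine h5.congr_of_eventuallyEq (.of_forall fun t => ?_)
  simp only [dampedSymbol, PiLp.add_apply, PiLp.smul_apply, PiLp.single_apply, smul_eq_mul]
  split_ifs <;> push_cast <;> ring

theorem lineDeriv_mul_dampedExp {ℓ : R3 →L[ℝ] ℂ} {ε : ℝ} {P : R3 → ℂ} {P' : ℂ} {x : R3} {j : Fin 3}
    (φ : 𝓢(R3, ℂ)) (hφ : ∀ x, φ x = P x * dampedExp ℓ ε x)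
    (hP : HasDerivAt (fun t : ℝ => P (x + t • EuclideanSpace.single j (1 : ℝ))) P' 0) :
    (∂_{(EuclideanSpace.single j (1 : ℝ) : R3)} φ) x =
      (P' + P x * dampedSymbol ℓ ε j x) * dampedExp ℓ ε x := by
  rw [SchwartzMap.lineDerivOp_apply]
  apply HasLineDerivAt.lineDeriv
  rw [HasLineDerivAt]
  simp only [hφ]
  refine (hP.mul (hasDerivAt_dampedExp ℓ ε j x)).congr_deriv ?_
  rw [zero_smul, add_zero]; ring

theorem lineDeriv_dampedExp {ℓ : R3 →L[ℝ] ℂ} {ε : ℝ} (φ : 𝓢(R3, ℂ))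
    (hφ : ∀ x, φ x = dampedExp ℓ ε x) (x : R3) :
    (∂_{ex} φ) x = dampedSymbol ℓ ε 0 x * dampedExp ℓ ε x := by
  have := lineDeriv_mul_dampedExp (P := fun _ => 1) (P' := 0) (x := x) (j := 0) φ
    (fun x => by rw [hφ, one_mul]) (hasDerivAt_const _ _)
  rw [ex, this]; ring

/-- The i-th symbol is affine with j-th derivative -2ε if i = j and 0 otherwise. Each of the three
directions contributes -2ε, and the direction j = 0 contributes a further -4ε because the prefactor
is differentiated too; hence 10ε. -/
theorem laplacian_lineDeriv_dampedExp {ℓ : R3 →L[ℝ] ℂ} {ε : ℝ} (φ : 𝓢(R3, ℂ))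
    (hφ : ∀ x, φ x = dampedExp ℓ ε x) (x : R3) :
    (Δ (∂_{ex} φ)) x = dampedSymbol ℓ ε 0 x *
      (∑ j, dampedSymbol ℓ ε j x ^ 2 - 10 * ε) * dampedExp ℓ ε x := by
  rw [SchwartzMap.laplacian_eq_sum (EuclideanSpace.basisFun (Fin 3) ℝ)]
  simp only [EuclideanSpace.basisFun_apply]
  have h1 : ∀ j x, (∂_{(EuclideanSpace.single j (1 : ℝ) : R3)} (∂_{ex} φ)) x =
      ((if (0 : Fin 3) = j then -(2 * ε : ℂ) else 0) +
        dampedSymbol ℓ ε 0 x * dampedSymbol ℓ ε j x) * dampedExp ℓ ε x := fun j x =>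
    lineDeriv_mul_dampedExp _ (lineDeriv_dampedExp φ hφ) (hasDerivAt_dampedSymbol ℓ ε 0 j x)
  have h2 : ∀ j, (∂_{(EuclideanSpace.single j (1 : ℝ) : R3)}
      (∂_{(EuclideanSpace.single j (1 : ℝ) : R3)} (∂_{ex} φ))) x = _ := fun j =>
    lineDeriv_mul_dampedExp _ (h1 j) (((hasDerivAt_dampedSymbol ℓ ε 0 j x).mul
      (hasDerivAt_dampedSymbol ℓ ε j j x)).const_add _)
  rw [sum_apply]
  refine (Finset.sum_congr rfl fun j _ => h2 j).trans ?_
  simp only [Fin.sum_univ_three, zero_smul, add_zero]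
  simp
  ring

/-- The growth is expressed in √ε‖x‖, the quantity the Gaussian e^{-ε‖x‖²} controls. Three
derivatives then cost a constant independent of ε. -/
theorem norm_dampedSymbol_le (ℓ : R3 →L[ℝ] ℂ) {ε : ℝ} (h0 : 0 ≤ ε) (h1 : ε ≤ 1) (j : Fin 3)
    (x : R3) : ‖dampedSymbol ℓ ε j x‖ ≤ (‖ℓ‖ + 2) * (1 + √ε * ‖x‖) := by
  have hs : ε ≤ √ε := by
    conv_lhs => rw [← Real.mul_self_sqrt h0]
    have h2 : √ε ≤ 1 := Real.sqrt_le_one.2 h1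
    nlinarith [Real.sqrt_nonneg ε]
  have h3 : ‖ℓ (EuclideanSpace.single j 1)‖ ≤ ‖ℓ‖ := by
    simpa using ℓ.le_opNorm (EuclideanSpace.single j 1)
  have h4 : ‖((2 * ε * x j : ℝ) : ℂ)‖ ≤ 2 * (√ε * ‖x‖) := by
    rw [Complex.norm_real, norm_mul, Real.norm_of_nonneg (by positivity), mul_assoc]
    gcongr
    exact PiLp.norm_apply_le x j
  refine (norm_sub_le _ _).trans ((add_le_add h3 h4).trans ?_)
  have : 0 ≤ ‖ℓ‖ := norm_nonneg _
  have : 0 ≤ √ε * ‖x‖ := by positivity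
  nlinarith

theorem one_add_pow_three_mul_exp_le {s : ℝ} (hs : 0 ≤ s) :
    (1 + s) ^ 3 * Real.exp (-s ^ 2) ≤ Real.exp 3 := by
  have h1 : (1 + s) ^ 3 ≤ Real.exp (3 * s) := by
    have := Real.add_one_le_exp s
    calc (1 + s) ^ 3 ≤ Real.exp s ^ 3 := by gcongr; linarith
      _ = _ := by rw [← Real.exp_nat_mul]; norm_num
  calc _ ≤ Real.exp (3 * s) * Real.exp (-s ^ 2) := by gcongr
    _ ≤ _ := by
      rw [← Real.exp_add]
      apply Real.exp_le_exp.2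
      nlinarith [sq_nonneg (s - 3 / 2)]

/-- Uniform bounds in `ε` for the derivatives of `dampedExp`. -/
theorem exists_dampedExp_bound (ℓ : R3 →L[ℝ] ℂ) : ∃ C, 0 ≤ C ∧ ∀ ε, 0 < ε → ε ≤ 1 → ∀ x,
    ‖dampedSymbol ℓ ε 0 x * dampedExp ℓ ε x‖ ≤ C * Real.exp (ℓ x).re ∧
    ‖dampedSymbol ℓ ε 0 x * (∑ j, dampedSymbol ℓ ε j x ^ 2 - 10 * ε) * dampedExp ℓ ε x‖ ≤
      C * Real.exp (ℓ x).re := by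
  set A := ‖ℓ‖ + 2 with hA
  have hA2 : 2 ≤ A := by have := norm_nonneg ℓ; linarith
  refine ⟨A * (3 * A ^ 2 + 10) * Real.exp 3, by positivity, fun ε h0 h1 x => ?_⟩
  set s := √ε * ‖x‖ with hs
  have hs0 : 0 ≤ s := by positivity
  have hss : Real.exp (-ε * ‖x‖ ^ 2) = Real.exp (-s ^ 2) := by
    rw [hs, mul_pow, Real.sq_sqrt h0.le]; ring_nf
  have hp : ∀ j, ‖dampedSymbol ℓ ε j x‖ ≤ A * (1 + s) := fun j =>
    norm_dampedSymbol_le ℓ h0.le h1 j x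
  have h3 := one_add_pow_three_mul_exp_le hs0
  have hE := Real.exp_pos (ℓ x).re
  have hsum : ‖∑ j, dampedSymbol ℓ ε j x ^ 2 - 10 * (ε : ℂ)‖ ≤
      (3 * A ^ 2 + 10) * (1 + s) ^ 2 := by
    refine (norm_sub_le _ _).trans ?_
    have h4 : ‖∑ j, dampedSymbol ℓ ε j x ^ 2‖ ≤ 3 * (A * (1 + s)) ^ 2 := by
      refine (norm_sum_le _ _).trans ?_
      calc _ ≤ ∑ _j : Fin 3, (A * (1 + s)) ^ 2 := by
            gcongr with j
            rw [norm_pow]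
            gcongr
            exact hp j
        _ = _ := by simp
    have h5 : ‖(10 * ε : ℂ)‖ ≤ 10 * (1 + s) ^ 2 := by
      rw [norm_mul, Complex.norm_real, Real.norm_of_nonneg h0.le]
      norm_num
      nlinarith
    linarith
  have hge : 1 ≤ (1 + s) ^ 2 := one_le_pow₀ (by linarith)
  constructor
  · rw [norm_mul, norm_dampedExp, hss]
    calc _ ≤ A * (1 + s) * (Real.exp (ℓ x).re * Real.exp (-s ^ 2)) := by gcongr; exact hp 0
      _ ≤ A * ((3 * A ^ 2 + 10) * (1 + s) ^ 2 * (1 + s)) *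
          (Real.exp (ℓ x).re * Real.exp (-s ^ 2)) := by
          gcongr
          apply le_mul_of_one_le_left (by positivity)
          nlinarith
      _ = A * (3 * A ^ 2 + 10) * ((1 + s) ^ 3 * Real.exp (-s ^ 2)) * Real.exp (ℓ x).re := by ring
      _ ≤ _ := by gcongr
  · rw [norm_mul, norm_mul, norm_dampedExp, hss]
    calc _ ≤ A * (1 + s) * ((3 * A ^ 2 + 10) * (1 + s) ^ 2) *
          (Real.exp (ℓ x).re * Real.exp (-s ^ 2)) := by gcongr; exact hp 0
      _ = A * (3 * A ^ 2 + 10) * ((1 + s) ^ 3 * Real.exp (-s ^ 2)) * Real.exp (ℓ x).re := by ring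
      _ ≤ _ := by gcongr

theorem tendsto_dampedSymbol (ℓ : R3 →L[ℝ] ℂ) (j : Fin 3) (x : R3) :
    Tendsto (fun ε : ℝ => dampedSymbol ℓ ε j x) (𝓝 0) (𝓝 (ℓ (EuclideanSpace.single j 1))) := by
  have : Continuous fun ε : ℝ => dampedSymbol ℓ ε j x := by unfold dampedSymbol; fun_prop
  simpa [dampedSymbol] using this.tendsto 0

theorem tendsto_dampedExp (ℓ : R3 →L[ℝ] ℂ) (x : R3) :
    Tendsto (fun ε : ℝ => dampedExp ℓ ε x) (𝓝 0) (𝓝 (Complex.exp (ℓ x))) := by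
  have : Continuous fun ε : ℝ => dampedExp ℓ ε x := by unfold dampedExp; fun_prop
  simpa [dampedExp] using this.tendsto 0

end GaussianTest

/-! ### Cauchy–Schwarz bounds for quadratic expressions. -/

section CauchySchwarz

theorem integral_norm_mul_norm_le {α F G : Type*} [MeasurableSpace α] {μ : Measure α}
    [NormedAddCommGroup F] [NormedAddCommGroup G] {f : α → F} {g : α → G}
    (hf : MemLp f 2 μ) (hg : MemLp g 2 μ) :
    ∫ x, ‖f x‖ * ‖g x‖ ∂μ ≤ √(∫ x, ‖f x‖ ^ 2 ∂μ) * √(∫ x, ‖g x‖ ^ 2 ∂μ) := by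
  have := integral_mul_le_Lp_mul_Lq_of_nonneg (μ := μ) (p := 2) (q := 2)
    Real.HolderConjugate.two_two
    (f := fun x => ‖f x‖) (g := fun x => ‖g x‖) (.of_forall fun x => norm_nonneg _)
    (.of_forall fun x => norm_nonneg _) (by simpa using hf.norm) (by simpa using hg.norm)
  simpa [Real.sqrt_eq_rpow] using this

theorem Lp_norm_eq_sqrt_integral (f : Lp ℝ 2 (volume : Measure R3)) :
    ‖f‖ = √(∫ x, ‖f x‖ ^ 2) := by
  rw [eq_comm, Real.sqrt_eq_iff_mul_self_eq (integral_nonneg fun x => by positivity)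
    (norm_nonneg _), ← real_inner_self_eq_norm_mul_norm, L2.inner_def]
  congr 1 with x
  rw [real_inner_self_eq_norm_sq]

/-- Factor f² - h² = (f + h)(f - h) and attach the weight to the first factor. This turns L²
continuity in time into continuity of the weighted quadratic term. -/
theorem norm_integral_sq_sub_le {w : R3 → ℂ} {f h : Lp ℝ 2 (volume : Measure R3)} {K : ℝ}
    (hf : MemLp (fun x => w x * (f x : ℂ)) 2 volume) (hh : MemLp (fun x => w x * (h x : ℂ)) 2 volume)
    (hfK : ∫ x, ‖w x * (f x : ℂ)‖ ^ 2 ≤ K) (hhK : ∫ x, ‖w x * (h x : ℂ)‖ ^ 2 ≤ K) :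
    ‖(∫ x, w x * ((f x ^ 2 : ℝ) : ℂ)) - ∫ x, w x * ((h x ^ 2 : ℝ) : ℂ)‖ ≤ 2 * √K * ‖f - h‖ := by
  have hd : MemLp (fun x => ((f x - h x : ℝ) : ℂ)) 2 (volume : Measure R3) :=
    ((Lp.memLp f).sub (Lp.memLp h)).ofReal
  have hfC : MemLp (fun x => (f x : ℂ)) 2 (volume : Measure R3) := (Lp.memLp f).ofReal
  have hhC : MemLp (fun x => (h x : ℂ)) 2 (volume : Measure R3) := (Lp.memLp h).ofReal
  have i1 : Integrable fun x => w x * ((f x ^ 2 : ℝ) : ℂ) := by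
    refine (hf.integrable_mul hfC).congr (.of_forall fun x => ?_)
    simp only [Pi.mul_apply]; push_cast; ring
  have i2 : Integrable fun x => w x * ((h x ^ 2 : ℝ) : ℂ) := by
    refine (hh.integrable_mul hhC).congr (.of_forall fun x => ?_)
    simp only [Pi.mul_apply]; push_cast; ring
  have j1 : Integrable fun x => (w x * (f x : ℂ)) * ((f x - h x : ℝ) : ℂ) := hf.integrable_mul hd
  have j2 : Integrable fun x => (w x * (h x : ℂ)) * ((f x - h x : ℝ) : ℂ) := hh.integrable_mul hd
  have e : (∫ x, w x * ((f x ^ 2 : ℝ) : ℂ)) - ∫ x, w x * ((h x ^ 2 : ℝ) : ℂ) =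
      (∫ x, (w x * (f x : ℂ)) * ((f x - h x : ℝ) : ℂ)) +
        ∫ x, (w x * (h x : ℂ)) * ((f x - h x : ℝ) : ℂ) := by
    rw [← integral_sub i1 i2, ← integral_add j1 j2]
    congr 1 with x
    push_cast; ring
  have hn : ‖f - h‖ = √(∫ x, ‖((f x - h x : ℝ) : ℂ)‖ ^ 2) := by
    rw [Lp_norm_eq_sqrt_integral]
    congr 1
    apply integral_congr_ae
    filter_upwards [Lp.coeFn_sub f h] with x hx
    rw [hx, Pi.sub_apply, Complex.norm_real]
  have key : ∀ {k : R3 → ℂ}, MemLp k 2 volume → ∫ x, ‖k x‖ ^ 2 ≤ K →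
      ‖∫ x, k x * ((f x - h x : ℝ) : ℂ)‖ ≤ √K * ‖f - h‖ := by
    intro k hk hkK
    refine (norm_integral_le_integral_norm _).trans ?_
    have hnm : ∀ x, ‖k x * ((f x - h x : ℝ) : ℂ)‖ = ‖k x‖ * ‖((f x - h x : ℝ) : ℂ)‖ :=
      fun x => norm_mul _ _
    simp only [hnm]
    refine (integral_norm_mul_norm_le hk hd).trans ?_
    rw [hn]
    gcongr
  rw [e]
  refine (norm_add_le _ _).trans ((add_le_add (key hf hfK) (key hh hhK)).trans (le_of_eq ?_))
  ring

end CauchySchwarz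

/-! ### Symbols of the conjugated operators. -/

section Phase

/-- The linear phase `b x₀ - 2πi ⟨ξ, x⟩`. -/
def phase (b : ℝ) (ξ : R3) : R3 →L[ℝ] ℂ :=
  Complex.ofRealCLM.comp (b • EuclideanSpace.proj 0) +
    (-(2 * Real.pi * I) : ℂ) • Complex.ofRealCLM.comp (innerSL ℝ ξ)

theorem phase_apply (b : ℝ) (ξ x : R3) :
    phase b ξ x = ((b * x 0 : ℝ) : ℂ) - 2 * Real.pi * I * (⟪ξ, x⟫ : ℝ) := by
  simp [phase]; ring

theorem phase_re (b : ℝ) (ξ x : R3) : (phase b ξ x).re = b * x 0 := by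
  rw [phase_apply]; simp

theorem phase_single (b : ℝ) (ξ : R3) (j : Fin 3) :
    phase b ξ (EuclideanSpace.single j 1) = (if j = 0 then (b : ℂ) else 0) -
      2 * Real.pi * I * (ξ j : ℝ) := by
  rw [phase_apply]
  rcases eq_or_ne j 0 with rfl | h
  · simp [EuclideanSpace.inner_single_right]
  · simp [h, EuclideanSpace.inner_single_right]

theorem fourier_expWeight (b : ℝ) (f : R3 → ℝ) (ξ : R3) :
    𝓕 (expWeight b f) ξ = ∫ x, cexp (phase b ξ x) * (f x : ℂ) := by
  rw [Real.fourier_eq']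
  congr 1 with x
  rw [phase_apply, expWeight, smul_eq_mul, Complex.ofReal_mul (Real.exp _), Complex.ofReal_exp, ← mul_assoc,
    ← Complex.exp_add, real_inner_comm]
  congr 2; push_cast; ring

theorem norm_cexp_phase_mul (b : ℝ) (ξ : R3) (f : R3 → ℝ) (x : R3) :
    ‖cexp (phase b ξ x) * (f x : ℂ)‖ = ‖expWeight b f x‖ := by
  rw [norm_mul, Complex.norm_exp, phase_re, norm_expWeight, Complex.norm_real, Real.norm_eq_abs]

/-- The symbol `ζ₀` of `∂ₓ` after conjugation. -/
def symX (b : ℝ) (ξ : R3) : ℂ := b - 2 * Real.pi * I * (ξ 0 : ℝ)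

/-- The symbol `ζ₀ (ζ·ζ)` of `∂ₓ Δ` after conjugation. -/
def symXLap (b : ℝ) (ξ : R3) : ℂ :=
  symX b ξ * (b ^ 2 - 4 * Real.pi * I * b * (ξ 0 : ℝ) - 4 * Real.pi ^ 2 * (‖ξ‖ ^ 2 : ℝ))

theorem symX_eq (b : ℝ) (ξ : R3) : phase b ξ (EuclideanSpace.single 0 1) = symX b ξ := by
  rw [phase_single, symX, if_pos rfl]

theorem symXLap_eq (b : ℝ) (ξ : R3) : phase b ξ (EuclideanSpace.single 0 1) *
    (∑ j, phase b ξ (EuclideanSpace.single j 1) ^ 2) = symXLap b ξ := by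
  rw [symX_eq, symXLap]
  congr 1
  simp only [phase_single, Fin.sum_univ_three, EuclideanSpace.norm_sq_eq, Real.norm_eq_abs, sq_abs]
  simp
  ring_nf
  simp only [I_sq]
  ring

/-- The source of smoothing: up to b³, the real part is -b times a positive definite quadratic form.
It vanishes for b = 0, where the equation is purely dispersive. -/
theorem symXLap_re (b : ℝ) (ξ : R3) :
    (symXLap b ξ).re = b ^ 3 - 4 * Real.pi ^ 2 * b * (‖ξ‖ ^ 2 + 2 * ξ 0 ^ 2) := by
  have : symXLap b ξ = ((b ^ 3 - 4 * Real.pi ^ 2 * b * (‖ξ‖ ^ 2 + 2 * ξ 0 ^ 2) : ℝ) : ℂ) +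
      ((-(6 * Real.pi * b ^ 2 * ξ 0) + 8 * Real.pi ^ 3 * ξ 0 * ‖ξ‖ ^ 2 : ℝ) : ℂ) * I := by
    rw [symXLap, symX]
    push_cast
    ring_nf
    simp only [I_sq]
    ring
  rw [this, Complex.add_re, Complex.ofReal_re, Complex.re_ofReal_mul, I_re]
  simp

end Phase

/-! ### The ordinary differential equation at each frequency. -/

section ODE

variable {u : ℝ → Lp ℝ 2 (volume : Measure R3)} {ut : ℝ → 𝓢'(R3, ℂ)}

/-- Local-in-time boundedness of `e^{b x} u` in `L¹ ∩ L²`. -/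
def LocallyBoundedWeight (b : ℝ) (u : ℝ → Lp ℝ 2 (volume : Measure R3)) : Prop :=
  ∀ T : ℝ, ∃ K : ℝ, ∀ τ, |τ| ≤ T → Integrable (expWeight b (u τ)) ∧
    (∫ x, ‖expWeight b (u τ) x‖ ≤ K) ∧ MemLp (expWeight b (u τ)) 2 volume ∧
      ∫ x, ‖expWeight b (u τ) x‖ ^ 2 ≤ K

theorem continuous_integral_schwartz_mul_sq (hu : Continuous u) (ψ : 𝓢(R3, ℂ)) :
    Continuous fun τ => ∫ x, ψ x * ((u τ x ^ 2 : ℝ) : ℂ) := by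
  obtain ⟨M, hM⟩ : ∃ M, ∀ x, ‖ψ x‖ ≤ M := by
    obtain ⟨M, hM⟩ := ψ.decay 0 0
    exact ⟨M, fun x => by simpa using hM.2 x⟩
  have hM0 : 0 ≤ M := (norm_nonneg _).trans (hM 0)
  rw [continuous_iff_continuousAt]
  intro t
  rw [ContinuousAt, tendsto_iff_norm_sub_tendsto_zero]
  have hL : ∀ f : Lp ℝ 2 (volume : Measure R3), MemLp (fun x => ψ x * (f x : ℂ)) 2 volume ∧
      ∫ x, ‖ψ x * (f x : ℂ)‖ ^ 2 ≤ M ^ 2 * ‖f‖ ^ 2 := by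
    intro f
    have hfC : MemLp (fun x => (f x : ℂ)) 2 (volume : Measure R3) := (Lp.memLp f).ofReal
    have hm : MemLp (fun x => ψ x * (f x : ℂ)) 2 volume := by
      refine (hfC.const_mul (M : ℂ)).mono
        (ψ.continuous.aestronglyMeasurable.mul hfC.aestronglyMeasurable) (.of_forall fun x => ?_)
      rw [norm_mul, norm_mul, Complex.norm_real, Complex.norm_real, Real.norm_of_nonneg hM0]
      gcongr
      exact hM x
    refine ⟨hm, ?_⟩
    have hi : Integrable fun x => ‖f x‖ ^ 2 := (Lp.memLp f).integrable_norm_pow (by norm_num)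
    rw [Lp_norm_eq_sqrt_integral, Real.sq_sqrt (integral_nonneg fun x => by positivity),
      ← integral_const_mul]
    refine integral_mono (hm.integrable_norm_pow (by norm_num)) (hi.const_mul _) fun x => ?_
    simp only [norm_mul, mul_pow, Complex.norm_real]
    gcongr
    exact hM x
  have hlim : Tendsto (fun τ => 2 * √(M ^ 2 * (‖u t‖ + 1) ^ 2) * ‖u τ - u t‖) (𝓝 t) (𝓝 0) := by
    have h1 : Tendsto (fun τ => ‖u τ - u t‖) (𝓝 t) (𝓝 0) :=
      tendsto_iff_norm_sub_tendsto_zero.1 (hu.tendsto t)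
    simpa using h1.const_mul (2 * √(M ^ 2 * (‖u t‖ + 1) ^ 2))
  refine tendsto_of_tendsto_of_tendsto_of_le_of_le' tendsto_const_nhds hlim
    (.of_forall fun _ => norm_nonneg _) ?_
  have hev : ∀ᶠ τ in 𝓝 t, ‖u τ‖ < ‖u t‖ + 1 :=
    (hu.norm.tendsto t).eventually (gt_mem_nhds (by linarith))
  filter_upwards [hev] with τ hτ
  refine norm_integral_sq_sub_le (hL _).1 (hL _).1 ((hL _).2.trans ?_) ((hL _).2.trans ?_)
  · gcongr
  · gcongr; linarith

theorem continuous_fourier_expWeight_sq (hu : Continuous u) {b : ℝ}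
    (hb : LocallyBoundedWeight b u) (ξ : R3) :
    Continuous fun τ => 𝓕 (expWeight b (fun x => u τ x ^ 2)) ξ := by
  simp only [fourier_expWeight]
  rw [continuous_iff_continuousAt]
  intro t
  obtain ⟨K, hK⟩ := hb (|t| + 1)
  rw [ContinuousAt, tendsto_iff_norm_sub_tendsto_zero]
  have hlim : Tendsto (fun τ => 2 * √K * ‖u τ - u t‖) (𝓝 t) (𝓝 0) := by
    have h1 : Tendsto (fun τ => ‖u τ - u t‖) (𝓝 t) (𝓝 0) :=
      tendsto_iff_norm_sub_tendsto_zero.1 (hu.tendsto t)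
    simpa using h1.const_mul (2 * √K)
  refine tendsto_of_tendsto_of_tendsto_of_le_of_le' tendsto_const_nhds hlim
    (.of_forall fun _ => norm_nonneg _) ?_
  have hL : ∀ τ, |τ| ≤ |t| + 1 → MemLp (fun x => cexp (phase b ξ x) * (u τ x : ℂ)) 2 volume ∧
      ∫ x, ‖cexp (phase b ξ x) * (u τ x : ℂ)‖ ^ 2 ≤ K := by
    intro τ hτ
    obtain ⟨-, -, h3, h4⟩ := hK τ hτ
    simp only [norm_cexp_phase_mul]
    refine ⟨h3.congr_norm ?_ (.of_forall fun x => (norm_cexp_phase_mul b ξ _ x).symm), h4⟩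
    exact (Continuous.aestronglyMeasurable (by fun_prop)).mul
      (Complex.continuous_ofReal.comp_aestronglyMeasurable (Lp.aestronglyMeasurable _))
  have hev : ∀ᶠ τ in 𝓝 t, |τ| < |t| + 1 :=
    (continuous_abs.tendsto t).eventually (gt_mem_nhds (by linarith))
  filter_upwards [hev] with τ hτ
  exact norm_integral_sq_sub_le (hL τ hτ.le).1 (hL t (by linarith)).1 (hL τ hτ.le).2
    (hL t (by linarith)).2

theorem exp_phase_re_mul_norm (b : ℝ) (ξ : R3) (f : R3 → ℝ) (x : R3) :
    Real.exp (phase b ξ x).re * ‖(f x : ℂ)‖ = ‖expWeight b f x‖ := by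
  rw [← norm_cexp_phase_mul b ξ, norm_mul, Complex.norm_exp]

theorem tendsto_integral_mul_of_expWeight {b : ℝ} {ξ : R3} {g : ℕ → R3 → ℂ} {w : R3 → ℂ}
    {f : R3 → ℝ} {D : ℝ} (hfm : AEStronglyMeasurable f volume) (hf : Integrable (expWeight b f))
    (hgc : ∀ n, Continuous (g n)) (hgb : ∀ n x, ‖g n x‖ ≤ D * Real.exp (phase b ξ x).re)
    (hgl : ∀ x, Tendsto (fun n => g n x) atTop (𝓝 (w x))) :
    Tendsto (fun n => ∫ x, g n x * (f x : ℂ)) atTop (𝓝 (∫ x, w x * (f x : ℂ))) := by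
  refine tendsto_integral_of_dominated_convergence (fun x => D * ‖expWeight b f x‖)
    (fun n => (hgc n).aestronglyMeasurable.mul
      (Complex.continuous_ofReal.comp_aestronglyMeasurable hfm)) (hf.norm.const_mul D)
    (fun n => .of_forall fun x => ?_) (.of_forall fun x => (hgl x).mul_const _)
  rw [norm_mul, ← exp_phase_re_mul_norm b ξ, ← mul_assoc]
  gcongr
  exact hgb n x

theorem norm_integral_mul_le_of_expWeight {b : ℝ} {ξ : R3} {g : R3 → ℂ} {f : R3 → ℝ} {D M : ℝ}
    (hD : 0 ≤ D) (hf : Integrable (expWeight b f)) (hfM : ∫ x, ‖expWeight b f x‖ ≤ M)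
    (hg : ∀ x, ‖g x‖ ≤ D * Real.exp (phase b ξ x).re) : ‖∫ x, g x * (f x : ℂ)‖ ≤ D * M := by
  refine (norm_integral_le_of_norm_le (hf.norm.const_mul D) (.of_forall fun x => ?_)).trans ?_
  · rw [norm_mul, ← exp_phase_re_mul_norm b ξ, ← mul_assoc]
    gcongr
    exact hg x
  · rw [integral_const_mul]
    gcongr

theorem integrable_expWeight_sq {b K : ℝ} {f : Lp ℝ 2 (volume : Measure R3)}
    (h3 : MemLp (expWeight b f) 2 volume) (h4 : ∫ x, ‖expWeight b f x‖ ^ 2 ≤ K) :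
    Integrable (expWeight b fun x => f x ^ 2) ∧
      ∫ x, ‖expWeight b (fun x => f x ^ 2) x‖ ≤ √K * ‖f‖ := by
  have hfC : MemLp (fun x => (f x : ℂ)) 2 (volume : Measure R3) := (Lp.memLp f).ofReal
  have he : ∀ x, expWeight b (fun x => f x ^ 2) x = expWeight b f x * (f x : ℂ) := by
    intro x; simp only [expWeight]; push_cast; ring
  refine ⟨(h3.integrable_mul hfC).congr (.of_forall fun x => (he x).symm), ?_⟩
  simp only [he, norm_mul]
  refine (integral_norm_mul_norm_le h3 hfC).trans ?_
  rw [Lp_norm_eq_sqrt_integral]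
  simp only [Complex.norm_real]
  gcongr

theorem tendsto_pairing_dampedExp {b : ℝ} {ξ : R3} {f : Lp ℝ 2 (volume : Measure R3)}
    (hf : Integrable (expWeight b f)) (hf2 : Integrable (expWeight b fun x => f x ^ 2))
    {ε : ℕ → ℝ} (hε0 : ∀ n, 0 < ε n) (hε1 : ∀ n, ε n ≤ 1) (hεlim : Tendsto ε atTop (𝓝 0))
    {φ : ℕ → 𝓢(R3, ℂ)} (hφ : ∀ n x, φ n x = dampedExp (phase b ξ) (ε n) x) :
    Tendsto (fun n => ∫ x, φ n x * (f x : ℂ)) atTop (𝓝 (𝓕 (expWeight b f) ξ)) ∧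
    Tendsto (fun n => ∫ x, (Δ (∂_{ex} (φ n))) x * (f x : ℂ)) atTop
      (𝓝 (symXLap b ξ * 𝓕 (expWeight b f) ξ)) ∧
    Tendsto (fun n => ∫ x, (∂_{ex} (φ n)) x * ((f x ^ 2 : ℝ) : ℂ)) atTop
      (𝓝 (symX b ξ * 𝓕 (expWeight b fun x => f x ^ 2) ξ)) := by
  obtain ⟨C, hC0, hC⟩ := exists_dampedExp_bound (phase b ξ)
  rw [fourier_expWeight, fourier_expWeight, ← integral_const_mul, ← integral_const_mul]
  simp only [← mul_assoc]
  have hE : ∀ x, Tendsto (fun n => dampedExp (phase b ξ) (ε n) x) atTop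
      (𝓝 (cexp (phase b ξ x))) := fun x => (tendsto_dampedExp _ x).comp hεlim
  have hS : ∀ j x, Tendsto (fun n => dampedSymbol (phase b ξ) (ε n) j x) atTop
      (𝓝 (phase b ξ (EuclideanSpace.single j 1))) := fun j x =>
    (tendsto_dampedSymbol _ j x).comp hεlim
  refine ⟨?_, ?_, ?_⟩
  · refine tendsto_integral_mul_of_expWeight (ξ := ξ) (D := 1) (Lp.aestronglyMeasurable _) hf
      (fun n => (φ n).continuous) (fun n x => ?_) fun x => ?_
    · rw [hφ, norm_dampedExp, one_mul]
      apply mul_le_of_le_one_right (by positivity)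
      rw [Real.exp_le_one_iff]
      have := hε0 n
      nlinarith [sq_nonneg ‖x‖]
    · simp only [hφ]
      exact hE x
  · refine tendsto_integral_mul_of_expWeight (ξ := ξ) (D := C)
      (w := fun x => symXLap b ξ * cexp (phase b ξ x)) (Lp.aestronglyMeasurable _)
      hf (fun n => SchwartzMap.continuous _) (fun n x => ?_) fun x => ?_
    · rw [laplacian_lineDeriv_dampedExp (φ n) (hφ n)]
      exact (hC _ (hε0 n) (hε1 n) x).2
    · simp only [laplacian_lineDeriv_dampedExp _ (hφ _)]
      refine Tendsto.mul ?_ (hE x)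
      rw [← symXLap_eq]
      refine (hS 0 x).mul ?_
      have h10 : Tendsto (fun n => (10 * (ε n : ℂ))) atTop (𝓝 0) := by
        have := ((Complex.continuous_ofReal.tendsto 0).comp hεlim).const_mul (10 : ℂ)
        simpa using this
      have := (tendsto_finsetSum Finset.univ fun j _ => (hS j x).pow 2).sub h10
      simpa using this
  · refine tendsto_integral_mul_of_expWeight (ξ := ξ) (D := C) (f := fun x => f x ^ 2)
      (w := fun x => symX b ξ * cexp (phase b ξ x)) ((Lp.aestronglyMeasurable _).pow 2)
      hf2 (fun n => SchwartzMap.continuous _) (fun n x => ?_) fun x => ?_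
    · rw [lineDeriv_dampedExp (φ n) (hφ n)]
      exact (hC _ (hε0 n) (hε1 n) x).1
    · simp only [lineDeriv_dampedExp _ (hφ _)]
      refine Tendsto.mul ?_ (hE x)
      rw [← symX_eq]
      exact hS 0 x

/-- The weighted Fourier transform satisfies the integrated equation. -/
theorem IsClassBWith.fourier_expWeight_sub_eq_integral (h : IsClassBWith u ut) {b : ℝ}
    (hb : LocallyBoundedWeight b u) (ξ : R3) (s t : ℝ) :
    𝓕 (expWeight b (u t)) ξ - 𝓕 (expWeight b (u s)) ξ =
      ∫ τ in s..t, (symXLap b ξ * 𝓕 (expWeight b (u τ)) ξ +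
        symX b ξ * 𝓕 (expWeight b (fun x => u τ x ^ 2)) ξ) := by
  obtain ⟨C, hC0, hC⟩ := exists_dampedExp_bound (phase b ξ)
  obtain ⟨K, hK⟩ := hb (max |s| |t|)
  have habs : ∀ τ ∈ Set.uIcc s t, |τ| ≤ max |s| |t| := by
    intro τ hτ
    rcases le_total s t with hst | hst
    · rw [Set.uIcc_of_le hst] at hτ; exact abs_le_max_abs_abs hτ.1 hτ.2
    · rw [Set.uIcc_of_ge hst] at hτ; rw [max_comm]; exact abs_le_max_abs_abs hτ.1 hτ.2
  obtain ⟨ε, hε0, hε1, hεlim⟩ : ∃ ε : ℕ → ℝ, (∀ n, 0 < ε n) ∧ (∀ n, ε n ≤ 1) ∧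
      Tendsto ε atTop (𝓝 0) := by
    refine ⟨fun n => 1 / ((n : ℝ) + 1), fun n => Nat.one_div_pos_of_nat, fun n => ?_,
      tendsto_one_div_add_atTop_nhds_zero_nat⟩
    rw [div_le_one (by positivity)]
    linarith [(Nat.cast_nonneg n : (0:ℝ) ≤ n)]
  choose φ hφ using fun n => exists_schwartz_dampedExp (phase b ξ) (hε0 n)
  obtain ⟨M, hM⟩ : ∃ M, ∀ τ ∈ Set.uIcc s t, ‖u τ‖ ≤ M :=
    isCompact_uIcc.exists_bound_of_continuousOn h.continuous_L2.continuousOn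
  have hsq : ∀ τ ∈ Set.uIcc s t, Integrable (expWeight b fun x => u τ x ^ 2) ∧
      ∫ x, ‖expWeight b (fun x => u τ x ^ 2) x‖ ≤ √K * M := by
    intro τ hτ
    obtain ⟨-, -, h3, h4⟩ := hK τ (habs τ hτ)
    refine ⟨(integrable_expWeight_sq h3 h4).1, (integrable_expWeight_sq h3 h4).2.trans ?_⟩
    have := hM τ hτ
    gcongr
  have hlim := fun τ (hτ : τ ∈ Set.uIcc s t) => tendsto_pairing_dampedExp (ξ := ξ)
    (hK τ (habs τ hτ)).1 (hsq τ hτ).1 hε0 hε1 hεlim hφ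
  obtain ⟨G, hG⟩ : ∃ G : ℕ → ℝ → ℂ, ∀ n τ, G n τ =
      (∫ x, (Δ (∂_{ex} (φ n))) x * (u τ x : ℂ)) +
        ∫ x, (∂_{ex} (φ n)) x * ((u τ x ^ 2 : ℝ) : ℂ) := ⟨_, fun _ _ => rfl⟩
  have hcont : ∀ n, Continuous (G n) := by
    intro n
    have h1 : Continuous fun τ => ∫ x, (Δ (∂_{ex} (φ n))) x * (u τ x : ℂ) :=
      continuous_iff_continuousAt.2 fun τ => (h.hasDerivAt_pairing _ τ).continuousAt
    rw [funext (hG n)]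
    exact h1.add (continuous_integral_schwartz_mul_sq h.continuous_L2 _)
  have hbound : ∀ n, ∀ τ ∈ Set.uIcc s t, ‖G n τ‖ ≤ C * K + C * (√K * M) := by
    intro n τ hτ
    rw [hG]
    refine (norm_add_le _ _).trans (add_le_add ?_ ?_)
    · refine norm_integral_mul_le_of_expWeight (ξ := ξ) hC0 (hK τ (habs τ hτ)).1
        (hK τ (habs τ hτ)).2.1 fun x => ?_
      rw [laplacian_lineDeriv_dampedExp (φ n) (hφ n)]
      exact (hC _ (hε0 n) (hε1 n) x).2
    · refine norm_integral_mul_le_of_expWeight (ξ := ξ) (f := fun x => u τ x ^ 2) hC0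
        (hsq τ hτ).1 (hsq τ hτ).2 fun x => ?_
      rw [lineDeriv_dampedExp (φ n) (hφ n)]
      exact (hC _ (hε0 n) (hε1 n) x).1
  have hGlim : ∀ τ ∈ Set.uIcc s t, Tendsto (fun n => G n τ) atTop
      (𝓝 (symXLap b ξ * 𝓕 (expWeight b (u τ)) ξ +
        symX b ξ * 𝓕 (expWeight b (fun x => u τ x ^ 2)) ξ)) := by
    intro τ hτ
    simp only [hG]
    exact (hlim τ hτ).2.1.add (hlim τ hτ).2.2
  have hFT : ∀ n, ∫ τ in s..t, G n τ =
      (∫ x, φ n x * (u t x : ℂ)) - ∫ x, φ n x * (u s x : ℂ) := by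
    intro n
    refine intervalIntegral.integral_eq_sub_of_hasDerivAt
      (f := fun τ => ∫ x, φ n x * (u τ x : ℂ)) (fun τ _ => ?_) ((hcont n).intervalIntegrable _ _)
    rw [hG]
    exact h.hasDerivAt_pairing (φ n) τ
  -- The damping is removed in the time-integrated identity, by dominated convergence: continuity in
  -- time of the weighted transform is not yet available.
  have h_int : Tendsto (fun n => ∫ τ in s..t, G n τ) atTop (𝓝 (∫ τ in s..t,
      (symXLap b ξ * 𝓕 (expWeight b (u τ)) ξ +
        symX b ξ * 𝓕 (expWeight b (fun x => u τ x ^ 2)) ξ))) :=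
    intervalIntegral.tendsto_integral_filter_of_dominated_convergence
      (fun _ => C * K + C * (√K * M)) (.of_forall fun n => (hcont n).aestronglyMeasurable)
      (.of_forall fun n => .of_forall fun τ hτ => hbound n τ (Set.uIoc_subset_uIcc hτ))
      intervalIntegrable_const
      (.of_forall fun τ hτ => hGlim τ (Set.uIoc_subset_uIcc hτ))
  refine tendsto_nhds_unique ?_ h_int
  simp only [hFT]
  exact (hlim t Set.right_mem_uIcc).1.sub (hlim s Set.left_mem_uIcc).1

/-- The integrand of the integrated equation is locally bounded, which gives a local Lipschitz
estimate. The integrand is then continuous, and the integrated equation can be differentiated. -/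
theorem IsClassBWith.continuous_fourier_expWeight (h : IsClassBWith u ut) {b : ℝ}
    (hb : LocallyBoundedWeight b u) (ξ : R3) : Continuous fun τ => 𝓕 (expWeight b (u τ)) ξ := by
  rw [continuous_iff_continuousAt]
  intro t
  obtain ⟨K, hK⟩ := hb (|t| + 1)
  obtain ⟨M, hM⟩ := (isCompact_Icc (a := t - 1) (b := t + 1)).exists_bound_of_continuousOn
    (continuous_fourier_expWeight_sq h.continuous_L2 hb ξ).continuousOn
  rw [ContinuousAt, tendsto_iff_norm_sub_tendsto_zero]
  set D := ‖symXLap b ξ‖ * K + ‖symX b ξ‖ * M with hD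
  have hlim : Tendsto (fun τ => D * |τ - t|) (𝓝 t) (𝓝 0) := by
    have : Continuous fun τ => D * |τ - t| := by fun_prop
    simpa using this.tendsto t
  refine tendsto_of_tendsto_of_tendsto_of_le_of_le' tendsto_const_nhds hlim
    (.of_forall fun _ => norm_nonneg _) ?_
  filter_upwards [Icc_mem_nhds (by linarith : t - 1 < t) (by linarith : t < t + 1)] with τ hτ
  rw [h.fourier_expWeight_sub_eq_integral hb ξ t τ]
  refine intervalIntegral.norm_integral_le_of_norm_le_const fun σ hσ => ?_
  have hσ' : σ ∈ Set.Icc (t - 1) (t + 1) := by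
    have h1 : Set.uIcc t τ ⊆ Set.Icc (t - 1) (t + 1) :=
      Set.uIcc_subset_Icc ⟨by linarith, by linarith⟩ hτ
    exact h1 (Set.uIoc_subset_uIcc hσ)
  have hσa : |σ| ≤ |t| + 1 := by
    rw [abs_le]
    constructor <;> linarith [hσ'.1, hσ'.2, neg_abs_le t, le_abs_self t]
  refine (norm_add_le _ _).trans ?_
  rw [norm_mul, norm_mul, hD]
  gcongr
  · exact (norm_fourier_le_integral _ _).trans (hK σ hσa).2.1
  · exact hM σ hσ'

theorem IsClassBWith.hasDerivAt_fourier_expWeight (h : IsClassBWith u ut) {b : ℝ}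
    (hb : LocallyBoundedWeight b u) (ξ : R3) (t : ℝ) :
    HasDerivAt (fun τ => 𝓕 (expWeight b (u τ)) ξ)
      (symXLap b ξ * 𝓕 (expWeight b (u t)) ξ +
        symX b ξ * 𝓕 (expWeight b (fun x => u t x ^ 2)) ξ) t := by
  have hc : Continuous fun τ => symXLap b ξ * 𝓕 (expWeight b (u τ)) ξ +
      symX b ξ * 𝓕 (expWeight b (fun x => u τ x ^ 2)) ξ :=
    ((h.continuous_fourier_expWeight hb ξ).const_mul _).add
      ((continuous_fourier_expWeight_sq h.continuous_L2 hb ξ).const_mul _)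
  have h1 := (intervalIntegral.integral_hasDerivAt_right (hc.intervalIntegrable 0 t)
    (hc.stronglyMeasurableAtFilter _ _) hc.continuousAt).const_add (𝓕 (expWeight b (u 0)) ξ)
  refine h1.congr_of_eventuallyEq (.of_forall fun τ => ?_)
  simp only
  rw [← h.fourier_expWeight_sub_eq_integral hb ξ 0 τ]
  ring

end ODE

/-! ### The trilinear form behind conservation of mass. -/

section Trilinear

theorem integrable_and_integral_mul_comp_sub {A k : R3 → ℝ} (hA : Integrable A)
    (hk : Integrable k) :
    Integrable (fun p : R3 × R3 => A p.2 * k (p.1 - p.2)) (volume.prod volume) ∧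
      ∫ p : R3 × R3, A p.2 * k (p.1 - p.2) ∂(volume.prod volume) = (∫ x, A x) * ∫ x, k x := by
  have hi : Integrable (fun p : R3 × R3 => A p.2 * k (p.1 - p.2)) (volume.prod volume) :=
    hA.convolution_integrand (ContinuousLinearMap.mul ℝ ℝ) hk
  refine ⟨hi, ?_⟩
  rw [integral_prod_symm _ hi]
  simp only [integral_const_mul, integral_sub_right_eq_self k, integral_mul_const]

theorem integrable_and_integral_mul_comp_sub' {A k : R3 → ℝ} (hA : Integrable A)
    (hk : Integrable k) :
    Integrable (fun p : R3 × R3 => A p.1 * k (p.1 - p.2)) (volume.prod volume) ∧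
      ∫ p : R3 × R3, A p.1 * k (p.1 - p.2) ∂(volume.prod volume) = (∫ x, A x) * ∫ x, k x := by
  obtain ⟨h1, h2⟩ := integrable_and_integral_mul_comp_sub hA hk.comp_neg
  have he : (fun p : R3 × R3 => A p.1 * k (p.1 - p.2)) =
      (fun p : R3 × R3 => A p.2 * k (-(p.1 - p.2))) ∘ Prod.swap := by
    ext p; simp
  constructor
  · rw [he]; exact h1.swap
  · rw [he]
    refine (integral_prod_swap (μ := (volume : Measure R3)) (ν := (volume : Measure R3))
      (fun p : R3 × R3 => A p.2 * k (-(p.1 - p.2)))).trans ?_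
    rw [h2, integral_neg_eq_self k]

/-- The trilinear integrand `ξ₀ conj f(ξ) f(ξ-η) f(η)`. -/
def triInt (f : R3 → ℂ) (p : R3 × R3) : ℂ :=
  ((p.1 0 : ℝ) : ℂ) * (conj (f p.1) * f (p.1 - p.2) * f p.2)

theorem integrable_one_add_norm_neg_four :
    Integrable (fun x : R3 => (1 + ‖x‖) ^ (-(4 : ℝ))) :=
  integrable_one_add_norm (by simp; norm_num)

/-- Since P/Q + Q/P ≥ 2, one weight can be moved from one factor to the other, giving products of
type L²·L²·L¹. Each term on the right then depends on only two of ξ, η, ξ - η and integrates as a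
product. -/
theorem mul_mul_le_of_weights {x f₁ f₂ P Q k₁ k₂ : ℝ} (hx : 0 ≤ x) (hf₁ : 0 ≤ f₁) (hf₂ : 0 ≤ f₂)
    (hP : 0 < P) (hQ : 0 < Q) (h₁ : f₁ * P⁻¹ ≤ k₁ / 2) (h₂ : f₂ * Q⁻¹ ≤ k₂ / 2) :
    x * (f₁ * f₂) ≤ 1 / 4 * (x ^ 2 * k₂ + k₂ * (P * f₁) ^ 2 + x ^ 2 * k₁ + (Q * f₂) ^ 2 * k₁) := by
  have hk₁ : 0 ≤ k₁ := by have : 0 ≤ f₁ * P⁻¹ := by positivity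
                          linarith
  have hk₂ : 0 ≤ k₂ := by have : 0 ≤ f₂ * Q⁻¹ := by positivity
                          linarith
  set y := P * f₁ with hy
  set z := Q * f₂ with hz
  have hy0 : 0 ≤ y := by positivity
  have hz0 : 0 ≤ z := by positivity
  have h3 : 1 ≤ (1 / 2) * (P * Q⁻¹ + Q * P⁻¹) := by
    rw [← div_eq_mul_inv, ← div_eq_mul_inv, div_add_div _ _ hQ.ne' hP.ne', ← mul_div_assoc,
      le_div_iff₀ (by positivity)]
    nlinarith [sq_nonneg (P - Q)]
  have h4 : f₁ * f₂ ≤ (1 / 2) * (y * (f₂ * Q⁻¹) + z * (f₁ * P⁻¹)) := by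
    calc _ = 1 * (f₁ * f₂) := (one_mul _).symm
      _ ≤ ((1 / 2) * (P * Q⁻¹ + Q * P⁻¹)) * (f₁ * f₂) := by gcongr
      _ = _ := by rw [hy, hz]; ring
  have h5 : y * (f₂ * Q⁻¹) ≤ y * (k₂ / 2) := by gcongr
  have h6 : z * (f₁ * P⁻¹) ≤ z * (k₁ / 2) := by gcongr
  have h7 : x * (f₁ * f₂) ≤ x * ((1 / 2) * (y * (k₂ / 2) + z * (k₁ / 2))) :=
    mul_le_mul_of_nonneg_left (by linarith) hx
  have h9 : x * y ≤ (x ^ 2 + y ^ 2) / 2 := by nlinarith [sq_nonneg (x - y)]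
  have h10 : x * z ≤ (x ^ 2 + z ^ 2) / 2 := by nlinarith [sq_nonneg (x - z)]
  have h11 := mul_le_mul_of_nonneg_right h9 hk₂
  have h12 := mul_le_mul_of_nonneg_right h10 hk₁
  have p1 : 0 ≤ x ^ 2 * k₂ := by positivity
  have p2 : 0 ≤ y ^ 2 * k₂ := by positivity
  have p3 : 0 ≤ x ^ 2 * k₁ := by positivity
  have p4 : 0 ≤ z ^ 2 * k₁ := by positivity
  linarith

/-- Absolute convergence of the trilinear form on `H¹`. -/
theorem integrable_triInt {f : R3 → ℂ} (hf : Continuous f) {B : ℝ}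
    (hi : Integrable fun ξ => ((1 + ‖ξ‖) * ‖f ξ‖) ^ 2)
    (hB : ∫ ξ, ((1 + ‖ξ‖) * ‖f ξ‖) ^ 2 ≤ B) :
    Integrable (triInt f) (volume.prod volume) ∧
      ∫ p, ‖triInt f p‖ ∂(volume.prod volume) ≤ B * (B + ∫ x : R3, (1 + ‖x‖) ^ (-(4 : ℝ))) := by
  set A : R3 → ℝ := fun ξ => ((1 + ‖ξ‖) * ‖f ξ‖) ^ 2 with hA
  set k : R3 → ℝ := fun ξ => A ξ + (1 + ‖ξ‖) ^ (-(4 : ℝ)) with hk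
  have hki : Integrable k := hi.add integrable_one_add_norm_neg_four
  have hA0 : ∀ ξ, 0 ≤ A ξ := fun ξ => by positivity
  -- Thus f/(1 + |ξ|) is integrable: it is the product of (1 + |ξ|)|f| and (1 + |ξ|)^{-2}, both
  -- square integrable in dimension three.
  have hkk : ∀ ξ, ‖f ξ‖ * (1 + ‖ξ‖)⁻¹ ≤ k ξ / 2 := by
    intro ξ
    have h1 : (0 : ℝ) < 1 + ‖ξ‖ := by positivity
    have h2 : (1 + ‖ξ‖) ^ (-(4 : ℝ)) = ((1 + ‖ξ‖)⁻¹ ^ 2) ^ 2 := by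
      rw [Real.rpow_neg h1.le, ← pow_mul, inv_pow]; norm_cast
    have h3 : ‖f ξ‖ * (1 + ‖ξ‖)⁻¹ = ((1 + ‖ξ‖) * ‖f ξ‖) * (1 + ‖ξ‖)⁻¹ ^ 2 := by
      field_simp
    simp only [hk, hA]
    rw [h2, h3]
    nlinarith [sq_nonneg ((1 + ‖ξ‖) * ‖f ξ‖ - (1 + ‖ξ‖)⁻¹ ^ 2)]
  have hk0 : ∀ ξ, 0 ≤ k ξ := fun ξ => add_nonneg (hA0 ξ) (by positivity)
  have e1 := hi.mul_prod hki
  obtain ⟨e2, i2⟩ := integrable_and_integral_mul_comp_sub hki hi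
  obtain ⟨e3, i3⟩ := integrable_and_integral_mul_comp_sub' hi hki
  obtain ⟨e4, i4⟩ := integrable_and_integral_mul_comp_sub hi hki
  have i1 : ∫ p : R3 × R3, A p.1 * k p.2 ∂(volume.prod volume) = (∫ x, A x) * ∫ x, k x :=
    integral_prod_mul A k
  set G : R3 × R3 → ℝ := fun p => (1 / 4 : ℝ) * (A p.1 * k p.2 + k p.2 * A (p.1 - p.2) +
    A p.1 * k (p.1 - p.2) + A p.2 * k (p.1 - p.2)) with hG
  have hGi : Integrable G (volume.prod volume) := (((e1.add e2).add e3).add e4).const_mul _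
  have hle : ∀ p, ‖triInt f p‖ ≤ G p := by
    rintro ⟨ξ, η⟩
    have h0 : |ξ 0| ≤ 1 + ‖ξ‖ := by
      have := PiLp.norm_apply_le ξ 0
      rw [Real.norm_eq_abs] at this
      linarith
    have h1 : ‖triInt f (ξ, η)‖ ≤ ((1 + ‖ξ‖) * ‖f ξ‖) * (‖f (ξ - η)‖ * ‖f η‖) := by
      simp only [triInt, norm_mul, Complex.norm_real, Real.norm_eq_abs, RCLike.norm_conj]
      calc _ ≤ (1 + ‖ξ‖) * (‖f ξ‖ * ‖f (ξ - η)‖ * ‖f η‖) := by gcongr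
        _ = _ := by ring
    exact h1.trans (mul_mul_le_of_weights (by positivity) (norm_nonneg _) (norm_nonneg _)
      (by positivity) (by positivity) (hkk (ξ - η)) (hkk η))
  have hm : AEStronglyMeasurable (triInt f) (volume.prod volume) := by
    refine Continuous.aestronglyMeasurable ?_
    unfold triInt
    fun_prop
  have h_int := hGi.mono' hm (.of_forall hle)
  refine ⟨h_int, (integral_mono h_int.norm hGi hle).trans ?_⟩
  have hG' : ∫ p, G p ∂(volume.prod volume) = (∫ x, A x) * ∫ x, k x := by
    simp only [hG]
    have e12 : Integrable (fun p : R3 × R3 => A p.1 * k p.2 + k p.2 * A (p.1 - p.2))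
      (volume.prod volume) := e1.add e2
    have e123 : Integrable (fun p : R3 × R3 => A p.1 * k p.2 + k p.2 * A (p.1 - p.2) +
      A p.1 * k (p.1 - p.2)) (volume.prod volume) := e12.add e3
    rw [integral_const_mul, integral_add e123 e4, integral_add e12 e3,
      integral_add e1 e2, i1, i2, i3, i4]
    ring
  rw [hG', hk, integral_add hi integrable_one_add_norm_neg_four]
  have h0 : 0 ≤ ∫ x, A x := integral_nonneg hA0
  have h1 : 0 ≤ ∫ x : R3, (1 + ‖x‖) ^ (-(4 : ℝ)) := integral_nonneg fun x => by positivity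
  have h2 : 0 ≤ B := h0.trans hB
  gcongr

/-- Cancellation in the trilinear form for transforms of real functions. -/
theorem integral_integral_triInt_eq_zero {f : R3 → ℂ} (hf : Continuous f)
    (hi : Integrable fun ξ => ((1 + ‖ξ‖) * ‖f ξ‖) ^ 2) (hneg : ∀ ξ, f (-ξ) = conj (f ξ)) :
    ∫ ξ, ∫ η, triInt f (ξ, η) = 0 := by
  have hT := (integrable_triInt hf hi le_rfl).1
  have hf2 : MemLp f 2 volume := by
    rw [memLp_two_iff_integrable_sq_norm hf.aestronglyMeasurable]
    refine hi.mono' (by fun_prop) (.of_forall fun x => ?_)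
    rw [Real.norm_of_nonneg (by positivity)]
    gcongr
    exact le_mul_of_one_le_left (norm_nonneg _) (by linarith [norm_nonneg x])
  have hg2 : MemLp (fun η => ((η 0 : ℝ) : ℂ) * f η) 2 volume := by
    rw [memLp_two_iff_integrable_sq_norm (by fun_prop)]
    refine hi.mono' (by fun_prop) (.of_forall fun x => ?_)
    rw [Real.norm_of_nonneg (by positivity), norm_mul, Complex.norm_real]
    gcongr
    linarith [PiLp.norm_apply_le x 0]
  have hfs : ∀ ξ, MemLp (fun η => f (ξ - η)) 2 volume := fun ξ =>
    hf2.comp_measurePreserving (Measure.measurePreserving_sub_left volume ξ)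
  set Ψ : R3 → R3 → ℂ := fun ξ η => ((η 0 : ℝ) : ℂ) * (conj (f ξ) * f (ξ - η) * f η) with hΨ
  have hΨi : ∀ ξ, Integrable (Ψ ξ) := by
    intro ξ
    refine (((hfs ξ).integrable_mul hg2).const_mul (conj (f ξ))).congr (.of_forall fun η => ?_)
    simp only [hΨ, Pi.mul_apply]; ring
  have hTi : ∀ ξ, Integrable fun η => triInt f (ξ, η) := by
    intro ξ
    refine (((hfs ξ).integrable_mul hf2).const_mul (((ξ 0 : ℝ) : ℂ) * conj (f ξ))).congr
      (.of_forall fun η => ?_)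
    simp only [triInt, Pi.mul_apply]; ring
  -- The substitution η ↦ ξ - η exchanges the last two factors, so η₀ may be replaced by ξ₀/2.
  have h1 : ∀ ξ, ∫ η, triInt f (ξ, η) = 2 * ∫ η, Ψ ξ η := by
    intro ξ
    have e : ∫ η, Ψ ξ η = ∫ η, Ψ ξ (ξ - η) := (integral_sub_left_eq_self (Ψ ξ) volume ξ).symm
    have e2 : ∀ η, Ψ ξ (ξ - η) = triInt f (ξ, η) - Ψ ξ η := by
      intro η
      simp only [hΨ, triInt, sub_sub_cancel, PiLp.sub_apply]
      push_cast; ring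
    simp only [e2] at e
    rw [integral_sub (hTi ξ) (hΨi ξ)] at e
    linear_combination -e
  -- By the reality condition, (ξ, η) ↦ (-η, -ξ) gives a second relation. With I and J the integrals
  -- of `triInt f` and Ψ, I = 2J and I = -J, so both vanish.
  have hTneg : ∀ ξ η, triInt f (-ξ, -η) = -Ψ η ξ := by
    intro ξ η
    simp only [triInt, hΨ, PiLp.neg_apply, hneg, Complex.conj_conj]
    have : -ξ - -η = η - ξ := by abel
    rw [this]
    push_cast; ring
  have hΨp : Integrable (Function.uncurry Ψ) (volume.prod volume) := by
    have h2 : Integrable (fun p : R3 × R3 => triInt f (-p.1, -p.2)) (volume.prod volume) :=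
      ((Measure.measurePreserving_neg (volume : Measure R3)).prod
        (Measure.measurePreserving_neg (volume : Measure R3))).integrable_comp_of_integrable hT
    refine h2.swap.neg.congr (.of_forall fun p => ?_)
    simp [hTneg, Function.uncurry]
  have h3 : ∫ ξ, ∫ η, triInt f (ξ, η) = -∫ ξ, ∫ η, Ψ ξ η := by
    calc ∫ ξ, ∫ η, triInt f (ξ, η) = ∫ ξ, ∫ η, triInt f (-ξ, -η) := by
          rw [← integral_neg_eq_self (fun ξ => ∫ η, triInt f (ξ, η))]
          congr 1 with ξ
          exact (integral_neg_eq_self (fun η => triInt f (-ξ, η)) volume).symm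
      _ = -∫ ξ, ∫ η, Ψ η ξ := by
          simp only [hTneg, integral_neg]
      _ = _ := by rw [integral_integral_swap hΨp]
  have h4 : ∫ ξ, ∫ η, triInt f (ξ, η) = 2 * ∫ ξ, ∫ η, Ψ ξ η := by
    rw [← integral_const_mul]
    congr 1 with ξ
    exact h1 ξ
  rw [h4] at h3
  have h5 : ∫ ξ, ∫ η, Ψ ξ η = 0 := by linear_combination (1 / 3 : ℂ) * h3
  rw [h4, h5, mul_zero]

end Trilinear

/-! ### Conservation of the L² norm. -/

section Mass

variable {u : ℝ → Lp ℝ 2 (volume : Measure R3)} {ut : ℝ → 𝓢'(R3, ℂ)}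

theorem expWeight_zero (f : R3 → ℝ) : expWeight 0 f = fun x => (f x : ℂ) := by
  ext x; simp [expWeight]

theorem fourier_ofReal_neg (f : R3 → ℝ) (ξ : R3) :
    𝓕 (fun x => (f x : ℂ)) (-ξ) = conj (𝓕 (fun x => (f x : ℂ)) ξ) := by
  rw [Real.fourier_eq', Real.fourier_eq', ← integral_conj]
  congr 1 with x
  simp only [smul_eq_mul, map_mul, Complex.conj_ofReal, ← Complex.exp_conj, Complex.conj_I,
    inner_neg_right]
  congr 2
  push_cast; ring

theorem symXLap_zero_re (ξ : R3) : (symXLap 0 ξ).re = 0 := by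
  rw [symXLap_re]; ring

theorem integral_norm_fourier_sq {f : R3 → ℂ} (h1 : Integrable f) (h2 : MemLp f 2) :
    ∫ ξ, ‖𝓕 f ξ‖ ^ 2 = ∫ x, ‖f x‖ ^ 2 := by
  have h := congrArg (fun z => (z ^ 2).toReal) (eLpNorm_fourier h1 h2)
  simp only [eLpNorm_two_sq] at h
  have m1 : AEStronglyMeasurable (fun ξ => ‖𝓕 f ξ‖ ^ 2) volume :=
    (memLp_fourier h1 h2).aestronglyMeasurable.norm.pow 2
  have m2 : AEStronglyMeasurable (fun x => ‖f x‖ ^ 2) volume :=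
    h2.aestronglyMeasurable.norm.pow 2
  rw [integral_eq_lintegral_of_nonneg_ae (.of_forall fun x => by positivity) m1,
    integral_eq_lintegral_of_nonneg_ae (.of_forall fun x => by positivity) m2]
  simpa only [ENNReal.ofReal_pow (norm_nonneg _), ofReal_norm] using h

/-- Uniform bound in `H¹` on the Fourier side. -/
def HOneBound (u : ℝ → Lp ℝ 2 (volume : Measure R3)) (B : ℝ) : Prop :=
  ∀ t, Integrable (fun ξ => ((1 + ‖ξ‖) * ‖𝓕 (fun x => (u t x : ℂ)) ξ‖) ^ 2) ∧
    ∫ ξ, ((1 + ‖ξ‖) * ‖𝓕 (fun x => (u t x : ℂ)) ξ‖) ^ 2 ≤ B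

theorem IsClassBWith.exists_hOneBound (h : IsClassBWith u ut)
    (hi : ∀ t, Integrable (u t : R3 → ℝ)) : ∃ B, HOneBound u B := by
  obtain ⟨B, hB0, hB⟩ := h.exists_hsNorm_one_le
  refine ⟨2 * B ^ 2, fun t => ?_⟩
  set F := 𝓕 (fun x => (u t x : ℂ)) with hF
  have hFc : Continuous F := continuous_fourier (hi t).ofReal
  have h1 := (eLpNorm_bessel_fourier_le 1 (u t) (hi t)).trans (hB t)
  have h2 : ∫⁻ ξ : R3, ENNReal.ofReal ((1 + ‖ξ‖ ^ 2) * ‖F ξ‖ ^ 2) ≤ ENNReal.ofReal (B ^ 2) := by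
    have h3 : ∫⁻ ξ : R3, ENNReal.ofReal ((1 + ‖ξ‖ ^ 2) * ‖F ξ‖ ^ 2) =
        eLpNorm (fun ξ : R3 => (((1 + ‖ξ‖ ^ 2) ^ ((1 : ℝ) / 2) : ℝ) : ℂ) * F ξ) 2 volume ^ 2 := by
      rw [eLpNorm_two_sq]
      congr 1 with ξ
      rw [← ofReal_norm, ← ENNReal.ofReal_pow (norm_nonneg _), norm_mul, mul_pow,
        Complex.norm_real, Real.norm_of_nonneg (by positivity), ← Real.sqrt_eq_rpow,
        Real.sq_sqrt (by positivity)]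
    rw [h3, ENNReal.ofReal_pow hB0]
    gcongr
  have hm : AEStronglyMeasurable (fun ξ : R3 => (1 + ‖ξ‖ ^ 2) * ‖F ξ‖ ^ 2) volume :=
    Continuous.aestronglyMeasurable (by fun_prop)
  have hn : 0 ≤ᵐ[volume] fun ξ : R3 => (1 + ‖ξ‖ ^ 2) * ‖F ξ‖ ^ 2 :=
    .of_forall fun ξ => by positivity
  have h_int : Integrable fun ξ : R3 => (1 + ‖ξ‖ ^ 2) * ‖F ξ‖ ^ 2 :=
    (lintegral_ofReal_ne_top_iff_integrable hm hn).1
      (ne_top_of_le_ne_top ENNReal.ofReal_ne_top h2)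
  have hle : ∀ ξ, ((1 + ‖ξ‖) * ‖F ξ‖) ^ 2 ≤ 2 * ((1 + ‖ξ‖ ^ 2) * ‖F ξ‖ ^ 2) := by
    intro ξ
    rw [mul_pow, ← mul_assoc]
    gcongr
    nlinarith [sq_nonneg (1 - ‖ξ‖)]
  have h_int' : Integrable fun ξ : R3 => ((1 + ‖ξ‖) * ‖F ξ‖) ^ 2 :=
    (h_int.const_mul 2).mono' (Continuous.aestronglyMeasurable (by fun_prop))
      (.of_forall fun ξ => by rw [Real.norm_of_nonneg (by positivity)]; exact hle ξ)
  refine ⟨h_int', (integral_mono h_int' (h_int.const_mul 2) hle).trans ?_⟩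
  rw [integral_const_mul, integral_eq_lintegral_of_nonneg_ae hn hm]
  gcongr
  exact ENNReal.toReal_le_of_le_ofReal (by positivity) h2

theorem hasDerivAt_norm_sq {f : ℝ → ℂ} {f' : ℂ} {t : ℝ} (h : HasDerivAt f f' t) :
    HasDerivAt (fun τ => ‖f τ‖ ^ 2) (2 * (conj (f t) * f').re) t := by
  have := h.norm_sq
  refine this.congr_deriv ?_
  rw [Complex.inner, mul_comm (conj _)]

/-- At each frequency |û|² is differentiated in time; the linear term drops out because `symXLap 0`
is imaginary. Integrating in ξ leaves the trilinear form, which is zero. The H¹ bound gives the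
absolute convergence needed for Fubini, so u needs no regularization. -/
theorem IsClassBWith.norm_eq (h : IsClassBWith u ut) (hb : LocallyBoundedWeight 0 u) {B : ℝ}
    (hB : HOneBound u B) (s t : ℝ) : ‖u t‖ = ‖u s‖ := by
  set F : ℝ → R3 → ℂ := fun τ => 𝓕 (fun x => (u τ x : ℂ)) with hF
  have hLB : ∀ τ, Integrable (fun x => (u τ x : ℂ)) ∧ MemLp (fun x => (u τ x : ℂ)) 2 volume := by
    intro τ
    obtain ⟨K, hK⟩ := hb |τ|
    have := hK τ le_rfl
    rw [expWeight_zero] at this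
    exact ⟨this.1, this.2.2.1⟩
  have hFc : ∀ τ, Continuous (F τ) := fun τ => continuous_fourier (hLB τ).1
  set Q : ℝ → R3 → ℂ := fun τ => 𝓕 (fun x => ((u τ x ^ 2 : ℝ) : ℂ)) with hQ
  have hQeq : ∀ τ ξ, Q τ ξ = ∫ η, F τ (ξ - η) * F τ η := by
    intro τ ξ
    rw [← fourier_mul_eq_integral (hLB τ).1 (hLB τ).2 (hLB τ).1 (hLB τ).2]
    simp only [hQ, pow_two, Complex.ofReal_mul]
  set D : ℝ → R3 → ℝ := fun τ ξ => 2 * (conj (F τ ξ) * (symX 0 ξ * Q τ ξ)).re with hD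
  have hFd : ∀ ξ τ, HasDerivAt (fun τ => F τ ξ) (symXLap 0 ξ * F τ ξ + symX 0 ξ * Q τ ξ) τ := by
    intro ξ τ
    have := h.hasDerivAt_fourier_expWeight hb ξ τ
    simpa only [expWeight_zero] using this
  have hQc : ∀ ξ, Continuous fun τ => Q τ ξ := by
    intro ξ
    have := continuous_fourier_expWeight_sq h.continuous_L2 hb ξ
    simpa only [expWeight_zero] using this
  have hFct : ∀ ξ, Continuous fun τ => F τ ξ := fun ξ =>
    continuous_iff_continuousAt.2 fun τ => (hFd ξ τ).continuousAt
  have hQcx : ∀ τ, Continuous (Q τ) := by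
    intro τ
    exact continuous_fourier (Lp.memLp (u τ)).integrable_sq.ofReal
  have hder : ∀ ξ τ, HasDerivAt (fun τ => ‖F τ ξ‖ ^ 2) (D τ ξ) τ := by
    intro ξ τ
    refine (hasDerivAt_norm_sq (hFd ξ τ)).congr_deriv ?_
    simp only [hD]
    rw [mul_add, Complex.add_re]
    have : (conj (F τ ξ) * (symXLap 0 ξ * F τ ξ)).re = 0 := by
      rw [mul_left_comm, ← Complex.normSq_eq_conj_mul_self, Complex.re_mul_ofReal,
        symXLap_zero_re, zero_mul]
    rw [this, zero_add]
  have hDc : ∀ ξ, Continuous fun τ => D τ ξ := by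
    intro ξ
    have h1 := hFct ξ
    have h2 := hQc ξ
    simp only [hD]
    fun_prop
  have hsymc : Continuous fun ξ : R3 => symX 0 ξ := by unfold symX; fun_prop
  have hDcx : ∀ τ, Continuous (D τ) := by
    intro τ
    have h1 := hFc τ
    have h2 := hQcx τ
    simp only [hD]
    fun_prop
  have hDtri : ∀ τ ξ, D τ ξ = (-(4 * Real.pi * I) * ∫ η, triInt (F τ) (ξ, η)).re := by
    intro τ ξ
    simp only [hD]
    rw [hQeq, ← Complex.re_ofReal_mul]
    congr 1
    simp only [triInt, mul_assoc]
    rw [integral_const_mul, integral_const_mul, symX]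
    push_cast; ring
  have htri := fun τ => integrable_triInt (hFc τ) (hB τ).1 (hB τ).2
  set C := B * (B + ∫ x : R3, (1 + ‖x‖) ^ (-(4 : ℝ))) with hC
  have hDi : ∀ τ, Integrable (D τ) ∧ ∫ ξ, ‖D τ ξ‖ ≤ 4 * Real.pi * C := by
    intro τ
    have h1 : Integrable fun ξ => ∫ η, triInt (F τ) (ξ, η) := (htri τ).1.integral_prod_left
    have h2 : Integrable fun ξ => ∫ η, ‖triInt (F τ) (ξ, η)‖ := (htri τ).1.norm.integral_prod_left
    have hle : ∀ ξ, ‖D τ ξ‖ ≤ 4 * Real.pi * ∫ η, ‖triInt (F τ) (ξ, η)‖ := by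
      intro ξ
      rw [hDtri, Real.norm_eq_abs]
      refine (Complex.abs_re_le_norm _).trans ?_
      rw [norm_mul]
      have : ‖-(4 * Real.pi * I : ℂ)‖ = 4 * Real.pi := by
        simp [abs_of_pos Real.pi_pos]
      rw [this]
      gcongr
      exact norm_integral_le_integral_norm _
    have hi : Integrable (D τ) := (h2.const_mul _).mono' (hDcx τ).aestronglyMeasurable
      (.of_forall hle)
    refine ⟨hi, (integral_mono hi.norm (h2.const_mul _) hle).trans ?_⟩
    rw [integral_const_mul]
    gcongr
    rw [← integral_prod (fun p => ‖triInt (F τ) p‖) (htri τ).1.norm]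
    exact (htri τ).2
  have hDzero : ∀ τ, ∫ ξ, D τ ξ = 0 := by
    intro τ
    have h1 : Integrable fun ξ => ∫ η, triInt (F τ) (ξ, η) := (htri τ).1.integral_prod_left
    simp only [hDtri]
    have h2 := integral_re (h1.const_mul (-(4 * Real.pi * I) : ℂ))
    simp only [RCLike.re_eq_complex_re] at h2
    rw [h2, integral_const_mul,
      integral_integral_triInt_eq_zero (hFc τ) (hB τ).1 (fun ξ => fourier_ofReal_neg _ ξ)]
    simp
  have hsm : StronglyMeasurable (Function.uncurry D) :=
    stronglyMeasurable_uncurry_of_continuous_of_stronglyMeasurable hDc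
      fun τ => (hDcx τ).stronglyMeasurable
  have hprod : Integrable (Function.uncurry D) ((volume.restrict (Set.uIoc s t)).prod volume) := by
    have : IsFiniteMeasure (volume.restrict (Set.uIoc s t)) := ⟨by simp [Set.uIoc]⟩
    rw [integrable_prod_iff hsm.aestronglyMeasurable]
    refine ⟨.of_forall fun τ => (hDi τ).1, ?_⟩
    refine Integrable.mono' (g := fun _ => 4 * Real.pi * C) (integrable_const _)
      (hsm.aestronglyMeasurable.norm.integral_prod_right') (.of_forall fun τ => ?_)
    rw [Real.norm_of_nonneg (integral_nonneg fun _ => norm_nonneg _)]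
    exact (hDi τ).2
  have hswap : ∫ τ in s..t, ∫ ξ, D τ ξ = ∫ ξ, ∫ τ in s..t, D τ ξ :=
    intervalIntegral_integral_swap hprod
  have hFTC : ∀ ξ, ∫ τ in s..t, D τ ξ = ‖F t ξ‖ ^ 2 - ‖F s ξ‖ ^ 2 := fun ξ =>
    intervalIntegral.integral_eq_sub_of_hasDerivAt (f := fun τ => ‖F τ ξ‖ ^ 2)
      (fun τ _ => hder ξ τ) ((hDc ξ).intervalIntegrable _ _)
  simp only [hDzero, hFTC, intervalIntegral.integral_zero] at hswap
  have hsqi : ∀ τ, Integrable fun ξ => ‖F τ ξ‖ ^ 2 := fun τ =>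
    (memLp_fourier (hLB τ).1 (hLB τ).2).integrable_norm_pow (by norm_num)
  rw [integral_sub (hsqi t) (hsqi s), integral_norm_fourier_sq (hLB t).1 (hLB t).2,
    integral_norm_fourier_sq (hLB s).1 (hLB s).2] at hswap
  rw [Lp_norm_eq_sqrt_integral, Lp_norm_eq_sqrt_integral]
  congr 1
  simp only [Complex.norm_real] at hswap
  linarith

end Mass

/-! ### Uniform continuity in L² and the motion of the centre. -/

section Centre

variable {u : ℝ → Lp ℝ 2 (volume : Measure R3)} {ut : ℝ → 𝓢'(R3, ℂ)}

/-- Bounds for `e^{b x} f` in `L¹ ∩ L²`. -/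
def WeightMem (b : ℝ) (f : R3 → ℝ) (K : ℝ) : Prop :=
  Integrable (expWeight b f) ∧ (∫ x, ‖expWeight b f x‖ ≤ K) ∧ MemLp (expWeight b f) 2 volume ∧
    ∫ x, ‖expWeight b f x‖ ^ 2 ≤ K

theorem exists_weightMem_zero {c : ℝ → R3} {κ K : ℝ} (hκ : 0 < κ)
    (h : ∀ t, WeightedBound (u t) (c t) κ K) : ∃ M, ∀ t, WeightMem 0 (u t) M := by
  refine ⟨max K (K + ∫ x : R3, Real.exp (-(κ / 2) * ‖x‖)), fun t => ?_⟩
  have hm := Lp.aestronglyMeasurable (u t)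
  have h1 := (h t).expWeight_L1 (b := 0) hκ hm (by simpa using hκ.le)
  have h2 := (h t).expWeight_L2 (b := 0) hm (by simpa using hκ.le)
  simp only [zero_mul, Real.exp_zero, one_mul, one_pow] at h1 h2
  exact ⟨h1.1, h1.2.trans (le_max_right _ _), h2.1, h2.2.trans (le_max_left _ _)⟩

theorem fourier_sub_apply {f g : R3 → ℂ} (hf : Integrable f) (hg : Integrable g) (ξ : R3) :
    𝓕 (fun x => f x - g x) ξ = 𝓕 f ξ - 𝓕 g ξ := by
  simp only [Real.fourier_eq, smul_sub]
  exact integral_sub ((Real.fourierIntegral_convergent_iff ξ).2 hf)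
    ((Real.fourierIntegral_convergent_iff ξ).2 hg)

theorem norm_sub_sq_eq_integral_fourier {f g : Lp ℝ 2 (volume : Measure R3)}
    (hf : Integrable (fun x => (f x : ℂ))) (hg : Integrable (fun x => (g x : ℂ))) :
    ‖f - g‖ ^ 2 = ∫ ξ, ‖𝓕 (fun x => (f x : ℂ)) ξ - 𝓕 (fun x => (g x : ℂ)) ξ‖ ^ 2 := by
  have hi : Integrable fun x => (f x : ℂ) - (g x : ℂ) := hf.sub hg
  have h2 : MemLp (fun x => (f x : ℂ) - (g x : ℂ)) 2 volume :=
    (Lp.memLp f).ofReal.sub (Lp.memLp g).ofReal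
  simp only [← fourier_sub_apply hf hg]
  rw [integral_norm_fourier_sq hi h2, Lp_norm_eq_sqrt_integral,
    Real.sq_sqrt (integral_nonneg fun x => by positivity)]
  apply integral_congr_ae
  filter_upwards [Lp.coeFn_sub f g] with x hx
  rw [hx, Pi.sub_apply, ← Complex.ofReal_sub, Complex.norm_real]

theorem WeightMem.norm_fourier_le {b K : ℝ} {f : R3 → ℝ} (h : WeightMem b f K) (ξ : R3) :
    ‖𝓕 (expWeight b f) ξ‖ ≤ K :=
  (norm_fourier_le_integral _ ξ).trans h.2.1

theorem WeightMem.norm_le {K : ℝ} {f : Lp ℝ 2 (volume : Measure R3)} (h : WeightMem 0 f K) :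
    ‖f‖ ≤ √K := by
  rw [Lp_norm_eq_sqrt_integral]
  refine Real.sqrt_le_sqrt ?_
  have := h.2.2.2
  simpa only [expWeight_zero, Complex.norm_real] using this

theorem WeightMem.norm_fourier_sq_le {K : ℝ} {f : Lp ℝ 2 (volume : Measure R3)}
    (h : WeightMem 0 f K) (ξ : R3) : ‖𝓕 (expWeight 0 fun x => f x ^ 2) ξ‖ ≤ K := by
  have hK : 0 ≤ K := (integral_nonneg fun x => norm_nonneg _).trans h.2.1
  refine (norm_fourier_le_integral _ ξ).trans ((integrable_expWeight_sq h.2.2.1 h.2.2.2).2.trans ?_)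
  calc √K * ‖f‖ ≤ √K * √K := by gcongr; exact h.norm_le
    _ = K := Real.mul_self_sqrt hK

theorem continuous_symX (b : ℝ) : Continuous fun ξ : R3 => symX b ξ := by unfold symX; fun_prop

theorem continuous_symXLap (b : ℝ) : Continuous fun ξ : R3 => symXLap b ξ := by
  have := continuous_symX b
  unfold symXLap; fun_prop

theorem IsClassBWith.exists_norm_fourier_sub_le (h : IsClassBWith u ut) {M : ℝ}
    (hM : ∀ t, WeightMem 0 (u t) M) (N : ℝ) : ∃ C, 0 ≤ C ∧ ∀ s t, ∀ ξ : R3, ‖ξ‖ ≤ N →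
      ‖𝓕 (fun x => (u t x : ℂ)) ξ - 𝓕 (fun x => (u s x : ℂ)) ξ‖ ≤ C * |t - s| := by
  have hM0 : 0 ≤ M := (norm_nonneg _).trans ((hM 0).norm_fourier_le 0)
  obtain ⟨A, hA⟩ := (isCompact_closedBall (0 : R3) N).exists_bound_of_continuousOn
    (continuous_symXLap 0).continuousOn
  obtain ⟨A', hA'⟩ := (isCompact_closedBall (0 : R3) N).exists_bound_of_continuousOn
    (continuous_symX 0).continuousOn
  refine ⟨max (A * M + A' * M) 0, le_max_right _ _, fun s t ξ hξ => ?_⟩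
  have hξ' : ξ ∈ Metric.closedBall (0 : R3) N := by simpa using hξ
  have hlb : LocallyBoundedWeight 0 u := fun T => ⟨M, fun τ _ => hM τ⟩
  have key := convex_univ.norm_image_sub_le_of_norm_hasDerivWithin_le
    (f := fun τ => 𝓕 (expWeight 0 (u τ)) ξ) (C := max (A * M + A' * M) 0)
    (fun τ _ => (h.hasDerivAt_fourier_expWeight hlb ξ τ).hasDerivWithinAt) (fun τ _ => ?_)
    (Set.mem_univ s) (Set.mem_univ t)
  · simpa only [expWeight_zero, Real.norm_eq_abs] using key
  · refine (norm_add_le _ _).trans (le_trans ?_ (le_max_left _ _))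
    rw [norm_mul, norm_mul]
    have a0 : 0 ≤ A := (norm_nonneg _).trans (hA ξ hξ')
    have a0' : 0 ≤ A' := (norm_nonneg _).trans (hA' ξ hξ')
    gcongr
    · exact hA ξ hξ'
    · exact (hM τ).norm_fourier_le ξ
    · exact hA' ξ hξ'
    · exact (hM τ).norm_fourier_sq_le ξ

/-- Frequencies below N are Lipschitz in time by the differential equation; those above N are small
by the H¹ bound, at the two times separately. -/
theorem IsClassBWith.exists_norm_sub_sq_le (h : IsClassBWith u ut) {M B : ℝ}
    (hM : ∀ t, WeightMem 0 (u t) M) (hB : HOneBound u B) {N : ℝ} (hN : 0 ≤ N) :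
    ∃ C, 0 ≤ C ∧ ∀ s t, ‖u t - u s‖ ^ 2 ≤ C * |t - s| ^ 2 + 4 * B / (1 + N) ^ 2 := by
  obtain ⟨C, hC0, hC⟩ := h.exists_norm_fourier_sub_le hM N
  refine ⟨volume.real (Metric.closedBall (0 : R3) N) * C ^ 2, by positivity, fun s t => ?_⟩
  have hi : ∀ τ, Integrable fun x => (u τ x : ℂ) := fun τ => by
    simpa only [expWeight_zero] using (hM τ).1
  have h2 : ∀ τ, MemLp (fun x => (u τ x : ℂ)) 2 volume := fun τ => (Lp.memLp (u τ)).ofReal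
  rw [norm_sub_sq_eq_integral_fourier (hi t) (hi s)]
  set F : ℝ → R3 → ℂ := fun τ => 𝓕 (fun x => (u τ x : ℂ)) with hF
  have hFi : Integrable fun ξ => ‖F t ξ - F s ξ‖ ^ 2 :=
    ((memLp_fourier (hi t) (h2 t)).sub (memLp_fourier (hi s) (h2 s))).integrable_norm_pow
      (by norm_num)
  have g1 : Integrable (Set.indicator (Metric.closedBall (0 : R3) N)
      fun _ => (C * |t - s|) ^ 2) := by
    rw [integrable_indicator_iff Metric.isClosed_closedBall.measurableSet]
    exact integrableOn_const (isCompact_closedBall _ _).measure_lt_top.ne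
  have g2 : ∀ τ, Integrable fun ξ => 2 / (1 + N) ^ 2 * ((1 + ‖ξ‖) * ‖F τ ξ‖) ^ 2 := fun τ =>
    (hB τ).1.const_mul _
  have g3 : Integrable fun ξ => 2 / (1 + N) ^ 2 * ((1 + ‖ξ‖) * ‖F t ξ‖) ^ 2 +
      2 / (1 + N) ^ 2 * ((1 + ‖ξ‖) * ‖F s ξ‖) ^ 2 := (g2 t).add (g2 s)
  have hle : ∀ ξ, ‖F t ξ - F s ξ‖ ^ 2 ≤ Set.indicator (Metric.closedBall (0 : R3) N)
      (fun _ => (C * |t - s|) ^ 2) ξ + (2 / (1 + N) ^ 2 * ((1 + ‖ξ‖) * ‖F t ξ‖) ^ 2 +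
      2 / (1 + N) ^ 2 * ((1 + ‖ξ‖) * ‖F s ξ‖) ^ 2) := by
    intro ξ
    by_cases hξ : ‖ξ‖ ≤ N
    · rw [Set.indicator_of_mem (by simpa using hξ)]
      have := hC s t ξ hξ
      have h3 : ‖F t ξ - F s ξ‖ ^ 2 ≤ (C * |t - s|) ^ 2 := by gcongr
      have h4 : 0 ≤ 2 / (1 + N) ^ 2 * ((1 + ‖ξ‖) * ‖F t ξ‖) ^ 2 +
        2 / (1 + N) ^ 2 * ((1 + ‖ξ‖) * ‖F s ξ‖) ^ 2 := by positivity
      linarith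
    · rw [Set.indicator_of_notMem (by simpa using hξ), zero_add]
      push Not at hξ
      have h3 : ‖F t ξ - F s ξ‖ ^ 2 ≤ 2 * ‖F t ξ‖ ^ 2 + 2 * ‖F s ξ‖ ^ 2 := by
        have := norm_sub_le (F t ξ) (F s ξ)
        nlinarith [sq_nonneg (‖F t ξ‖ - ‖F s ξ‖), norm_nonneg (F t ξ - F s ξ)]
      refine h3.trans ?_
      have h5 : ∀ y : ℝ, 2 * y ^ 2 ≤ 2 / (1 + N) ^ 2 * ((1 + ‖ξ‖) * y) ^ 2 := by
        intro y
        rw [mul_pow, div_mul_eq_mul_div, le_div_iff₀ (by positivity)]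
        have : (1 + N) ^ 2 ≤ (1 + ‖ξ‖) ^ 2 := by gcongr
        nlinarith [sq_nonneg y]
      exact add_le_add (h5 _) (h5 _)
  refine (integral_mono hFi (g1.add g3) hle).trans ?_
  rw [integral_add' g1 g3, integral_add (g2 t) (g2 s), integral_const_mul, integral_const_mul,
    integral_indicator Metric.isClosed_closedBall.measurableSet, setIntegral_const, smul_eq_mul]
  have e1 := mul_le_mul_of_nonneg_left (hB t).2 (show 0 ≤ 2 / (1 + N) ^ 2 by positivity)
  have e2 := mul_le_mul_of_nonneg_left (hB s).2 (show 0 ≤ 2 / (1 + N) ^ 2 by positivity)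
  have e3 : 4 * B / (1 + N) ^ 2 = 2 / (1 + N) ^ 2 * B + 2 / (1 + N) ^ 2 * B := by ring
  have e4 : volume.real (Metric.closedBall (0 : R3) N) * (C * |t - s|) ^ 2 =
    volume.real (Metric.closedBall (0 : R3) N) * C ^ 2 * |t - s| ^ 2 := by ring
  simp only [hF] at e1 e2 ⊢
  linarith

theorem IsClassBWith.exists_norm_sub_le (h : IsClassBWith u ut) {M B : ℝ}
    (hM : ∀ t, WeightMem 0 (u t) M) (hB : HOneBound u B) {ε : ℝ} (hε : 0 < ε) :
    ∃ δ > 0, ∀ s t, |t - s| ≤ δ → ‖u t - u s‖ ≤ ε := by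
  have hB0 : 0 ≤ B := (integral_nonneg fun ξ => by positivity).trans (hB 0).2
  -- Since 8B = Nε² ≤ (1 + N)²ε², the high-frequency term is at most ε²/2.
  set N := 8 * B / ε ^ 2 with hN
  have hN0 : 0 ≤ N := by positivity
  obtain ⟨C, hC0, hC⟩ := h.exists_norm_sub_sq_le hM hB hN0
  refine ⟨min 1 (ε ^ 2 / (2 * (C + 1))), by positivity, fun s t hst => ?_⟩
  have h1 : |t - s| ≤ 1 := hst.trans (min_le_left _ _)
  have h2 : |t - s| ≤ ε ^ 2 / (2 * (C + 1)) := hst.trans (min_le_right _ _)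
  rw [le_div_iff₀ (by positivity)] at h2
  have h3 : |t - s| ^ 2 ≤ |t - s| := by nlinarith [abs_nonneg (t - s)]
  have h4 : 4 * B / (1 + N) ^ 2 ≤ ε ^ 2 / 2 := by
    rw [div_le_iff₀ (by positivity)]
    have : 8 * B = N * ε ^ 2 := by rw [hN]; field_simp
    nlinarith [mul_nonneg (sq_nonneg ε) hN0, mul_nonneg (sq_nonneg ε) (sq_nonneg N), sq_nonneg ε]
  have h5 := hC s t
  refine abs_le_of_sq_le_sq' ?_ hε.le |>.2
  nlinarith [abs_nonneg (t - s), mul_le_mul_of_nonneg_left h3 hC0]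

theorem norm_sub_le_of_chain {E : Type*} [NormedAddCommGroup E] {c : ℝ → E} {δ D : ℝ}
    (hδ : 0 < δ) (h : ∀ s t, |t - s| ≤ δ → ‖c t - c s‖ ≤ D) {s t : ℝ} (hst : |t - s| ≤ 1) :
    ‖c t - c s‖ ≤ (⌈1 / δ⌉₊ : ℝ) * D := by
  set n := ⌈1 / δ⌉₊ with hn
  have hnpos : 0 < n := Nat.ceil_pos.2 (by positivity)
  have hn0 : (0 : ℝ) < n := by exact_mod_cast hnpos
  have hstep : |(t - s) / n| ≤ δ := by
    rw [abs_div, abs_of_pos hn0, div_le_iff₀ hn0]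
    have : 1 / δ ≤ n := Nat.le_ceil _
    rw [div_le_iff₀ hδ] at this
    linarith
  have key : ∀ k : ℕ, ‖c (s + k * ((t - s) / n)) - c s‖ ≤ k * D := by
    intro k
    induction k with
    | zero => simp
    | succ k ih =>
      have h1 := h (s + k * ((t - s) / n)) (s + (k + 1 : ℕ) * ((t - s) / n)) (by
        convert hstep using 2; push_cast; ring)
      calc _ ≤ _ + _ := norm_sub_le_norm_sub_add_norm_sub _ (c (s + k * ((t - s) / n))) _
        _ ≤ D + k * D := add_le_add h1 ih
        _ = _ := by push_cast; ring
  have := key n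
  rwa [mul_div_cancel₀ _ hn0.ne', add_sub_cancel] at this

/-- Exponential localization around centres that move by a bounded amount in unit time. -/
def UniformlyLocalized (u : ℝ → Lp ℝ 2 (volume : Measure R3)) (c : ℝ → R3) (κ K D : ℝ) :
    Prop :=
  ∀ t τ, |τ - t| ≤ 1 → ‖c τ - c t‖ ≤ D ∧ WeightedBound (u τ) (c t) κ K

/-- Conserved mass is a lower bound for ‖u t‖ valid at all times. Together with uniform continuity
it makes balls of concentration at times closer than δ overlap, with δ and R independent of time;
about 1/δ such steps cover unit time. -/
theorem IsClassBWith.exists_uniformlyLocalized (h : IsClassBWith u ut) {a : ℝ → R3} {κ C : ℝ}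
    (hκ : 0 < κ) (hdecay : HasExpDecay u a κ C) :
    ∃ (c : ℝ → R3) (K D : ℝ), UniformlyLocalized u c κ K D := by
  obtain ⟨B₀, hB₀⟩ := h.exists_norm_le
  obtain ⟨c, D, hD0, hc⟩ := exists_decaysAround h.continuous_L2 hB₀ hκ hdecay
  obtain ⟨K, hK0, hK⟩ := DecaysAround.exists_weighted_bound (κ := κ) (C := D) (B := B₀) hκ
  have hW : ∀ t, WeightedBound (u t) (c t) κ K := fun t => hK (u t) (c t) (hB₀ t) (hc t)
  obtain ⟨M, hM⟩ := exists_weightMem_zero hκ hW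
  have hi : ∀ t, Integrable (u t : R3 → ℝ) := fun t => by
    have := (hM t).1
    simp only [expWeight_zero] at this
    simpa using this.re
  obtain ⟨B, hB⟩ := h.exists_hOneBound hi
  have hmass : ∀ s t, ‖u t‖ = ‖u s‖ := h.norm_eq (fun T => ⟨M, fun τ _ => hM τ⟩) hB
  -- Without mass the centre is undetermined. In that case u vanishes identically and the origin
  -- serves as centre.
  rcases (norm_nonneg (u 0)).eq_or_lt with h0 | hpos
  · refine ⟨fun _ => 0, 0, 0, fun t τ _ => ⟨by simp, ?_⟩⟩
    have hz : u τ = 0 := by rw [← norm_eq_zero, hmass 0 τ, ← h0]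
    have hae : (fun x => Real.exp (κ * ‖x - 0‖) * u τ x ^ 2) =ᵐ[volume] fun _ => (0 : ℝ) := by
      rw [hz]
      filter_upwards [Lp.coeFn_zero ℝ 2 (volume : Measure R3)] with x hx
      rw [hx]; simp
    refine ⟨(integrable_zero _ _ _).congr hae.symm, ?_⟩
    rw [integral_congr_ae hae]; simp
  · set m := ‖u 0‖ with hm
    obtain ⟨δ, hδ, heq⟩ := h.exists_norm_sub_le hM hB (show 0 < m / 4 by positivity)
    -- Two tails below m/4 and a difference of at most m/4 stay below the mass m, as the overlap
    -- criterion requires.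
    obtain ⟨R, hR0, hR⟩ : ∃ R : ℝ, 0 < R ∧ D * Real.exp (-κ * R) < m / 4 := by
      have : Tendsto (fun R : ℝ => D * Real.exp (-κ * R)) atTop (𝓝 (D * 0)) := by
        refine Tendsto.const_mul _ (Real.tendsto_exp_atBot.comp ?_)
        exact tendsto_id.const_mul_atTop_of_neg (by linarith)
      rw [mul_zero] at this
      obtain ⟨R, h1, h2⟩ := ((this.eventually_lt_const (show 0 < m / 4 by positivity)).and
        (eventually_gt_atTop 0)).exists
      exact ⟨R, h2, h1⟩
    have hstep : ∀ s t, |t - s| ≤ δ → ‖c t - c s‖ ≤ 2 * R := by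
      intro s t hst
      refine (hc t).norm_sub_le (hc s) hR0 hD0 ?_
      have h1 := heq s t hst
      have h2 := hmass 0 t
      linarith
    refine ⟨c, Real.exp (κ * ((⌈1 / δ⌉₊ : ℝ) * (2 * R))) * K, _,
      fun t τ hτ => ⟨norm_sub_le_of_chain hδ hstep hτ, ?_⟩⟩
    exact (hW τ).recenter hκ (Lp.aestronglyMeasurable _) (norm_sub_le_of_chain hδ hstep hτ)

theorem UniformlyLocalized.exists_weightMem {c : ℝ → R3} {κ K D : ℝ} (hκ : 0 < κ)
    (h : UniformlyLocalized u c κ K D) : ∃ M, 0 ≤ M ∧ ∀ b, 4 * |b| ≤ κ → ∀ t τ, |τ - t| ≤ 1 →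
      Integrable (expWeight b (u τ)) ∧ ∫ x, ‖expWeight b (u τ) x‖ ≤ Real.exp (b * c t 0) * M ∧
      MemLp (expWeight b (u τ)) 2 volume ∧
      ∫ x, ‖expWeight b (u τ) x‖ ^ 2 ≤ (Real.exp (b * c t 0) * M) ^ 2 := by
  have hI : 0 ≤ ∫ x : R3, Real.exp (-(κ / 2) * ‖x‖) := integral_nonneg fun x => by positivity
  have hK : 0 ≤ K := (integral_nonneg fun x => by positivity).trans (h 0 0 (by simp)).2.2
  refine ⟨max (√K) (K + ∫ x : R3, Real.exp (-(κ / 2) * ‖x‖)), by positivity,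
    fun b hb t τ hτ => ?_⟩
  have hm := Lp.aestronglyMeasurable (u τ)
  have h1 := (h t τ hτ).2.expWeight_L1 hκ hm hb
  have h2 := (h t τ hτ).2.expWeight_L2 (b := b) hm (by linarith [abs_nonneg b])
  refine ⟨h1.1, h1.2.trans ?_, h2.1, h2.2.trans ?_⟩
  · gcongr; exact le_max_right _ _
  · rw [mul_pow]
    gcongr
    rw [← Real.sq_sqrt hK]
    gcongr
    rw [Real.sqrt_sq (by positivity)]
    exact le_max_left _ _

/-- Every time is within 1 of an integer, so a bounded time interval involves only finitely many
centres. No continuity of c is needed. -/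
theorem UniformlyLocalized.locallyBoundedWeight {c : ℝ → R3} {κ K D : ℝ} (hκ : 0 < κ)
    (h : UniformlyLocalized u c κ K D) {b : ℝ} (hb : 4 * |b| ≤ κ) : LocallyBoundedWeight b u := by
  obtain ⟨M, hM0, hM⟩ := h.exists_weightMem hκ
  intro T
  set L : ℤ → ℝ := fun n => Real.exp (b * c n 0) * M + (Real.exp (b * c n 0) * M) ^ 2 with hL
  refine ⟨∑ n ∈ Finset.Icc ⌊-T⌋ ⌊T⌋, L n, fun τ hτ => ?_⟩
  have hmem : ⌊τ⌋ ∈ Finset.Icc ⌊-T⌋ ⌊T⌋ :=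
    Finset.mem_Icc.2 ⟨Int.floor_mono (abs_le.1 hτ).1, Int.floor_mono (abs_le.1 hτ).2⟩
  have hle : L ⌊τ⌋ ≤ ∑ n ∈ Finset.Icc ⌊-T⌋ ⌊T⌋, L n :=
    Finset.single_le_sum (fun n _ => by simp only [hL]; positivity) hmem
  have h1 : |τ - (⌊τ⌋ : ℝ)| ≤ 1 := by
    rw [abs_of_nonneg (sub_nonneg.2 (Int.floor_le τ))]
    linarith [Int.lt_floor_add_one τ]
  obtain ⟨m1, m2, m3, m4⟩ := hM b hb ⌊τ⌋ τ h1
  have p1 : 0 ≤ Real.exp (b * c ⌊τ⌋ 0) * M := by positivity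
  have p2 : 0 ≤ (Real.exp (b * c ⌊τ⌋ 0) * M) ^ 2 := by positivity
  have hLd : L ⌊τ⌋ = Real.exp (b * c ⌊τ⌋ 0) * M + (Real.exp (b * c ⌊τ⌋ 0) * M) ^ 2 := rfl
  exact ⟨m1, by linarith, m3, by linarith⟩

end Centre

/-! ### Duhamel estimates over a unit time interval. -/

section Dissipation

/-- The integrating factor e^{-l(τ-t)} removes the linear term. The norm is then compared with the
primitive of Ge^{μ(τ-t)} starting at e^{-μ}‖f(t-1)‖. -/
theorem norm_le_of_dissipative {f g : ℝ → ℂ} {l : ℂ} {μ G t : ℝ} (hμ : 0 < μ) (hl : l.re ≤ -μ)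
    (hf : ∀ τ, HasDerivAt f (l * f τ + g τ) τ) (hg : ∀ τ ∈ Set.Icc (t - 1) t, ‖g τ‖ ≤ G) :
    ‖f t‖ ≤ Real.exp (-μ) * ‖f (t - 1)‖ + G / μ := by
  have hG : 0 ≤ G := (norm_nonneg _).trans (hg t ⟨by linarith, le_rfl⟩)
  set w : ℝ → ℂ := fun τ => cexp (-l * ((τ : ℂ) - t)) * f τ with hw
  have hne : ∀ τ : ℝ, ‖cexp (-l * ((τ : ℂ) - t))‖ = Real.exp (-l.re * (τ - t)) := by
    intro τ
    rw [Complex.norm_exp, ← Complex.ofReal_sub, Complex.re_mul_ofReal, Complex.neg_re]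
  have hwd : ∀ τ : ℝ, HasDerivAt w (cexp (-l * ((τ : ℂ) - t)) * g τ) τ := by
    intro τ
    have h1 : HasDerivAt (fun τ : ℝ => -l * ((τ : ℂ) - t)) (-l) τ := by
      have := ((Complex.ofRealCLM.hasDerivAt (x := τ)).sub_const (t : ℂ)).const_mul (-l)
      simpa using this
    refine (h1.cexp.mul (hf τ)).congr_deriv ?_
    ring
  have hBd : ∀ τ : ℝ, HasDerivAt (fun τ => Real.exp (-μ) * ‖f (t - 1)‖ +
      G / μ * (Real.exp (μ * (τ - t)) - Real.exp (-μ))) (G * Real.exp (μ * (τ - t))) τ := by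
    intro τ
    have h1 : HasDerivAt (fun τ : ℝ => μ * (τ - t)) μ τ := by
      have := ((hasDerivAt_id τ).sub_const t).const_mul μ
      simpa using this
    refine (((h1.exp.sub_const (Real.exp (-μ))).const_mul (G / μ)).const_add _).congr_deriv ?_
    field_simp
  have key := image_norm_le_of_norm_deriv_right_le_deriv_boundary (f := w) (a := t - 1) (b := t)
    (fun τ _ => (hwd τ).continuousAt.continuousWithinAt)
    (fun τ _ => (hwd τ).hasDerivWithinAt) (B := fun τ => Real.exp (-μ) * ‖f (t - 1)‖ +
      G / μ * (Real.exp (μ * (τ - t)) - Real.exp (-μ))) (B' := fun τ => G * Real.exp (μ * (τ - t)))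
    ?_ hBd ?_ (x := t) ⟨by linarith, le_rfl⟩
  · have h1 : w t = f t := by simp [hw]
    rw [h1] at key
    refine key.trans ?_
    have h2 : G / μ * (Real.exp (μ * (t - t)) - Real.exp (-μ)) ≤ G / μ * 1 := by
      gcongr
      rw [sub_self, mul_zero, Real.exp_zero]
      linarith [Real.exp_pos (-μ)]
    linarith
  · simp only [hw, norm_mul, hne]
    have : μ * (t - 1 - t) = -μ := by ring
    rw [this, sub_self, mul_zero, add_zero]
    gcongr
    linarith
  · intro τ hτ
    rw [norm_mul, hne, mul_comm]
    have h1 := hg τ ⟨hτ.1, hτ.2.le⟩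
    gcongr ?_ * Real.exp ?_
    · nlinarith [hτ.2]

/-- For Re l > 0 time is reversed and the data are taken at t + 1. This is how both signs of the
exponential weight become usable. -/
theorem exists_norm_le_of_dissipative {f g : ℝ → ℂ} {l : ℂ} {μ G t : ℝ} (hμ : 0 < μ)
    (hl : μ ≤ |l.re|) (hf : ∀ τ, HasDerivAt f (l * f τ + g τ) τ)
    (hg : ∀ τ, |τ - t| ≤ 1 → ‖g τ‖ ≤ G) :
    ∃ s, |s - t| ≤ 1 ∧ ‖f t‖ ≤ Real.exp (-μ) * ‖f s‖ + G / μ := by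
  rcases le_abs.1 hl with h | h
  · refine ⟨t + 1, by simp, ?_⟩
    have h1 : ∀ τ, HasDerivAt (fun τ => f (-τ)) (-l * f (-τ) + -g (-τ)) τ := by
      intro τ
      have := (hf (-τ)).scomp τ (hasDerivAt_neg τ)
      refine this.congr_deriv ?_
      simp only [neg_smul, one_smul]; ring
    have h2 := norm_le_of_dissipative (t := -t) (G := G) hμ (l := -l) (by simpa using h) h1
      (fun τ hτ => by
        rw [norm_neg]
        refine hg _ (abs_le.2 ⟨?_, ?_⟩) <;> linarith [hτ.1, hτ.2])
    have h3 : -(-t - 1) = t + 1 := by ring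
    simpa only [neg_neg, h3] using h2
  · refine ⟨t - 1, by simp, norm_le_of_dissipative hμ (by linarith) hf fun τ hτ => ?_⟩
    refine hg _ (abs_le.2 ⟨?_, ?_⟩) <;> linarith [hτ.1, hτ.2]

theorem exists_exp_neg_mul_le {b p : ℝ} (hb : 0 < b) (hp : 0 < p) :
    ∃ A, 0 ≤ A ∧ ∀ X : ℝ, 1 ≤ X → Real.exp (-(b * X)) ≤ A * X ^ (-p) := by
  refine ⟨(p / b) ^ p, by positivity, fun X hX => ?_⟩
  have hX0 : 0 < X := by linarith
  rw [Real.exp_neg, Real.rpow_neg hX0.le, inv_le_iff_one_le_mul₀ (Real.exp_pos _), mul_assoc,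
    mul_comm, mul_assoc, inv_mul_eq_div, le_div_iff₀ (by positivity), one_mul]
  have h1 : X ^ p = (b * X / p) ^ p * (p / b) ^ p := by
    rw [← Real.mul_rpow (by positivity) (by positivity)]
    congr 1; field_simp
  rw [h1, mul_comm (Real.exp _)]
  rw [mul_comm]
  gcongr
  calc (b * X / p) ^ p ≤ Real.exp (b * X / p) ^ p := by
        gcongr
        linarith [Real.add_one_le_exp (b * X / p)]
    _ = Real.exp (b * X) := by rw [← Real.exp_mul]; congr 1; field_simp

end Dissipation

/-! ### The gain of one order of decay. -/

section Decay

variable {u : ℝ → Lp ℝ 2 (volume : Measure R3)} {ut : ℝ → 𝓢'(R3, ℂ)}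

/-- The Fourier transform of `e^{β x} u`. -/
def fV (u : ℝ → Lp ℝ 2 (volume : Measure R3)) (β t : ℝ) : R3 → ℂ := 𝓕 (expWeight β (u t))

/-- The Fourier transform of `e^{β x} u²`. -/
def fQ (u : ℝ → Lp ℝ 2 (volume : Measure R3)) (β t : ℝ) : R3 → ℂ :=
  𝓕 (expWeight β fun x => u t x ^ 2)

/-- Polynomial decay of order `p`, uniform in time, for the two exponential weights `e^{±b x}`. -/
def HasWeightedDecay (b : ℝ) (c : ℝ → R3) (W : ℝ → ℝ → R3 → ℂ) (p : ℝ) : Prop :=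
  ∃ C, 0 ≤ C ∧ ∀ β, |β| = b → ∀ t ξ,
    ‖W β t ξ‖ ≤ C * Real.exp (β * c t 0) * (1 + ‖ξ‖) ^ (-p)

theorem norm_symX_le (β : ℝ) (ξ : R3) : ‖symX β ξ‖ ≤ (|β| + 2 * Real.pi) * (1 + ‖ξ‖) := by
  have h1 : ‖symX β ξ‖ ≤ |β| + 2 * Real.pi * ‖ξ‖ := by
    unfold symX
    refine (norm_sub_le _ _).trans ?_
    have h2 : |ξ 0| ≤ ‖ξ‖ := PiLp.norm_apply_le ξ 0
    have h3 : ‖(2 * Real.pi * I * (ξ 0 : ℝ) : ℂ)‖ = 2 * Real.pi * |ξ 0| := by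
      simp [abs_of_pos Real.pi_pos]
    rw [h3, Complex.norm_real, Real.norm_eq_abs]
    have := Real.pi_pos
    gcongr
  have := Real.pi_pos
  nlinarith [norm_nonneg ξ, abs_nonneg β, mul_nonneg (abs_nonneg β) (norm_nonneg ξ)]

/-- Here 4π² > 36, b² ≤ |ξ|² and |ξ| ≥ 1, so what remains after subtracting b² is at least 2 + 2|ξ|²
≥ (1 + |ξ|)². -/
theorem le_abs_symXLap_re {b β : ℝ} (hβ : |β| = b) (ξ : R3) (hξ : 1 + b ≤ ‖ξ‖) :
    b * (1 + ‖ξ‖) ^ 2 ≤ |(symXLap β ξ).re| := by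
  have hb : 0 ≤ b := hβ ▸ abs_nonneg β
  have hpi : 9 < Real.pi ^ 2 := by nlinarith [Real.pi_gt_three]
  have hfac : (symXLap β ξ).re = -(β * (4 * Real.pi ^ 2 * (‖ξ‖ ^ 2 + 2 * ξ 0 ^ 2) - b ^ 2)) := by
    rw [symXLap_re, ← hβ, sq_abs]; ring
  rw [hfac, abs_neg, abs_mul, hβ]
  refine mul_le_mul_of_nonneg_left (le_trans ?_ (le_abs_self _)) hb
  have h0 : 36 * (‖ξ‖ ^ 2 + 2 * ξ 0 ^ 2) ≤ 4 * Real.pi ^ 2 * (‖ξ‖ ^ 2 + 2 * ξ 0 ^ 2) := by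
    apply mul_le_mul_of_nonneg_right (by linarith) (by positivity)
  nlinarith [sq_nonneg (ξ 0), sq_nonneg (1 - ‖ξ‖)]

theorem exp_centre_le {b β D : ℝ} {c d : R3} (hβ : |β| = b) (h : ‖c - d‖ ≤ D) :
    Real.exp (β * c 0) ≤ Real.exp (b * D) * Real.exp (β * d 0) := by
  refine (exp_coord_le β c d).trans ?_
  rw [mul_comm, hβ]
  have hb : 0 ≤ b := hβ ▸ abs_nonneg β
  gcongr

/-- With X = 1 + |ξ|, the forcing is of size X·X^{-q} and the damping rate is bX², so their quotient
decays like X^{-(q+1)}. The data contribute e^{-bX²}, which is smaller than any power. -/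
theorem IsClassBWith.hasWeightedDecay_add_one (h : IsClassBWith u ut) {c : ℝ → R3}
    {κ K D b q : ℝ} (hκ : 0 < κ) (hloc : UniformlyLocalized u c κ K D) (hb : 0 < b)
    (hbκ : 4 * b ≤ κ) (hq : 0 ≤ q) (hQ : HasWeightedDecay b c (fQ u) q) :
    HasWeightedDecay b c (fV u) (q + 1) := by
  obtain ⟨C, hC0, hC⟩ := hQ
  obtain ⟨M, hM0, hM⟩ := hloc.exists_weightMem hκ
  obtain ⟨A, hA0, hA⟩ := exists_exp_neg_mul_le (p := q + 1) hb (by linarith)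
  have hD0 : 0 ≤ D := (norm_nonneg _).trans (hloc 0 0 (by simp)).1
  have hpi := Real.pi_pos
  -- The three terms account for low frequencies |ξ| < 1 + b, the damped data, and the forcing;
  -- e^{bD} pays for the motion of the centre.
  refine ⟨M * (2 + b) ^ (q + 1) + A * M + (b + 2 * Real.pi) * (C * Real.exp (b * D)) / b,
    by positivity, fun β hβ t ξ => ?_⟩
  have hβκ : 4 * |β| ≤ κ := by rw [hβ]; exact hbκ
  set E := Real.exp (β * c t 0) with hE
  have hE0 : 0 < E := Real.exp_pos _
  set X := 1 + ‖ξ‖ with hX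
  have hX1 : 1 ≤ X := by rw [hX]; linarith [norm_nonneg ξ]
  have hX0 : 0 < X := by linarith
  have hV : ∀ τ, |τ - t| ≤ 1 → ‖fV u β τ ξ‖ ≤ E * M := fun τ hτ =>
    (norm_fourier_le_integral _ ξ).trans (hM β hβκ t τ hτ).2.1
  have hxp : 0 < X ^ (-(q + 1)) := by positivity
  rcases le_or_gt (1 + b) ‖ξ‖ with hξ | hξ
  · have hμ : 0 < b * X ^ 2 := by positivity
    have hQt : ∀ τ, |τ - t| ≤ 1 → ‖symX β ξ * fQ u β τ ξ‖ ≤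
        (b + 2 * Real.pi) * X * (C * (Real.exp (b * D) * E) * X ^ (-q)) := by
      intro τ hτ
      rw [norm_mul]
      have h1 := norm_symX_le β ξ
      rw [hβ] at h1
      have h2 := exp_centre_le hβ (hloc t τ hτ).1
      refine mul_le_mul h1 ((hC β hβ τ ξ).trans ?_) (norm_nonneg _) (by positivity)
      gcongr
    obtain ⟨s, hs, hfs⟩ := exists_norm_le_of_dissipative (f := fun τ => fV u β τ ξ)
      (g := fun τ => symX β ξ * fQ u β τ ξ) (t := t) hμ (le_abs_symXLap_re hβ ξ hξ)
      (fun τ => h.hasDerivAt_fourier_expWeight (hloc.locallyBoundedWeight hκ hβκ) ξ τ) hQt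
    refine hfs.trans ?_
    have e1 : Real.exp (-(b * X ^ 2)) ≤ A * X ^ (-(q + 1)) := by
      refine le_trans (Real.exp_le_exp.2 ?_) (hA X hX1)
      have : X ≤ X ^ 2 := by nlinarith
      nlinarith
    have e2 : (b + 2 * Real.pi) * X * (C * (Real.exp (b * D) * E) * X ^ (-q)) / (b * X ^ 2) =
        (b + 2 * Real.pi) * (C * Real.exp (b * D)) / b * E * X ^ (-(q + 1)) := by
      have : X ^ (-(q + 1)) = X ^ (-q) / X := by
        rw [neg_add, ← sub_eq_add_neg, Real.rpow_sub_one hX0.ne']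
      rw [this]; field_simp
    have e3 : Real.exp (-(b * X ^ 2)) * ‖fV u β s ξ‖ ≤ A * X ^ (-(q + 1)) * (E * M) :=
      mul_le_mul e1 (hV s hs) (norm_nonneg _) (by positivity)
    have e4 : 0 ≤ M * (2 + b) ^ (q + 1) * E * X ^ (-(q + 1)) := by positivity
    rw [e2]
    calc _ ≤ A * X ^ (-(q + 1)) * (E * M) +
          (b + 2 * Real.pi) * (C * Real.exp (b * D)) / b * E * X ^ (-(q + 1)) := by gcongr
      _ ≤ _ := by linarith
  · refine (hV t (by simp)).trans ?_
    have h1 : 1 ≤ (2 + b) ^ (q + 1) * X ^ (-(q + 1)) := by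
      rw [Real.rpow_neg hX0.le, ← div_eq_mul_inv, le_div_iff₀ (by positivity), one_mul]
      refine Real.rpow_le_rpow hX0.le ?_ (by linarith)
      rw [hX]; linarith
    have h2 : 0 ≤ (A * M + (b + 2 * Real.pi) * (C * Real.exp (b * D)) / b) * E * X ^ (-(q + 1)) :=
      by positivity
    have h3 : E * M * 1 ≤ E * M * ((2 + b) ^ (q + 1) * X ^ (-(q + 1))) := by gcongr
    linarith

end Decay

/-! ### Decay of convolutions. -/

section ConvolutionBounds

theorem rpow_mul_rpow_le_add {a b s : ℝ} (ha : 0 ≤ a) (hb : 0 ≤ b) (hs : 0 ≤ s) (hs1 : s ≤ 1) :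
    a ^ s * b ^ (1 - s) ≤ a + b := by
  have := Real.geom_mean_le_arith_mean2_weighted hs (sub_nonneg.2 hs1) ha hb (by ring)
  refine this.trans ?_
  nlinarith

/-- One of |ξ - η|, |η| is comparable with |ξ|. Separating the two variables in the majorant makes
its integral over η independent of ξ by translation invariance. -/
theorem integral_mul_comp_sub_le {f v a d : R3 → ℝ} {q : ℝ} (hq : 0 ≤ q) (hf : ∀ x, 0 ≤ f x)
    (hv : ∀ x, 0 ≤ v x) (ha : Integrable a) (hd : Integrable d)
    (h : ∀ x y, ((1 + ‖x‖) ^ q + (1 + ‖y‖) ^ q) * (f x * v y) ≤ a x + d y) (ξ : R3) :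
    ∫ η, f (ξ - η) * v η ≤ 2 ^ q * ((∫ x, a x) + ∫ x, d x) * (1 + ‖ξ‖) ^ (-q) := by
  have ha' : Integrable fun η => a (ξ - η) := ha.comp_sub_left ξ
  have hle : ∀ η, f (ξ - η) * v η ≤ 2 ^ q * (1 + ‖ξ‖) ^ (-q) * (a (ξ - η) + d η) := by
    intro η
    have hX : 0 < 1 + ‖ξ‖ := by positivity
    have hfv : 0 ≤ f (ξ - η) * v η := mul_nonneg (hf _) (hv _)
    have h1 : (1 + ‖ξ‖) ^ q ≤ 2 ^ q * ((1 + ‖ξ - η‖) ^ q + (1 + ‖η‖) ^ q) := by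
      have h2 : 1 + ‖ξ‖ ≤ 2 * max (1 + ‖ξ - η‖) (1 + ‖η‖) := by
        have h3 : ‖ξ‖ ≤ ‖ξ - η‖ + ‖η‖ := by simpa using norm_add_le (ξ - η) η
        have := le_max_left (1 + ‖ξ - η‖) (1 + ‖η‖)
        have := le_max_right (1 + ‖ξ - η‖) (1 + ‖η‖)
        linarith
      refine (Real.rpow_le_rpow hX.le h2 hq).trans ?_
      rw [Real.mul_rpow (by norm_num) (by positivity)]
      gcongr
      rcases max_choice (1 + ‖ξ - η‖) (1 + ‖η‖) with h | h <;> rw [h]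
      · exact le_add_of_nonneg_right (by positivity)
      · exact le_add_of_nonneg_left (by positivity)
    rw [Real.rpow_neg hX.le, mul_right_comm, ← div_eq_mul_inv, le_div_iff₀ (by positivity)]
    calc f (ξ - η) * v η * (1 + ‖ξ‖) ^ q
        ≤ f (ξ - η) * v η * (2 ^ q * ((1 + ‖ξ - η‖) ^ q + (1 + ‖η‖) ^ q)) := by gcongr
      _ = 2 ^ q * (((1 + ‖ξ - η‖) ^ q + (1 + ‖η‖) ^ q) * (f (ξ - η) * v η)) := by ring
      _ ≤ _ := by gcongr; exact h _ _
  refine (integral_mono_of_nonneg (.of_forall fun η => mul_nonneg (hf _) (hv _))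
    ((ha'.add hd).const_mul _) (.of_forall hle)).trans (le_of_eq ?_)
  rw [integral_const_mul, integral_add' ha' hd, integral_sub_left_eq_self]
  ring

theorem integrable_one_add_norm_rpow {r : ℝ} (hr : 3 < r) :
    Integrable fun x : R3 => (1 + ‖x‖) ^ (-r) :=
  integrable_one_add_norm (by simpa using hr)

theorem neg_rpow_mul_neg_rpow_le {X Y s t : ℝ} (hX : 0 < X) (hY : 0 < Y) (hs : 0 ≤ s)
    (ht : 0 ≤ t) : X ^ (-s) * Y ^ (-t) ≤ X ^ (-(s + t)) + Y ^ (-(s + t)) := by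
  rcases le_total X Y with h | h
  · have : Y ^ (-t) ≤ X ^ (-t) := Real.rpow_le_rpow_of_nonpos hX h (by linarith)
    calc _ ≤ X ^ (-s) * X ^ (-t) := by gcongr
      _ = X ^ (-(s + t)) := by rw [← Real.rpow_add hX]; congr 1; ring
      _ ≤ _ := le_add_of_nonneg_right (by positivity)
  · have : X ^ (-s) ≤ Y ^ (-s) := Real.rpow_le_rpow_of_nonpos hY h (by linarith)
    calc _ ≤ Y ^ (-s) * Y ^ (-t) := by gcongr
      _ = Y ^ (-(s + t)) := by rw [← Real.rpow_add hY]; congr 1; ring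
      _ ≤ _ := le_add_of_nonneg_left (by positivity)

/-- Convolution of two functions with fast pointwise decay. -/
theorem exists_convolution_bound_of_decay {C p q : ℝ} (hq : 0 ≤ q) (hqp : q ≤ p)
    (hr : 3 < 2 * p - q) :
    ∃ A, 0 ≤ A ∧ ∀ f v : R3 → ℝ, (∀ x, 0 ≤ f x) → (∀ x, 0 ≤ v x) →
      (∀ x, f x ≤ C * (1 + ‖x‖) ^ (-p)) → (∀ x, v x ≤ C * (1 + ‖x‖) ^ (-p)) →
      ∀ ξ, ∫ η, f (ξ - η) * v η ≤ A * (1 + ‖ξ‖) ^ (-q) := by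
  set d : R3 → ℝ := fun x => 2 * C ^ 2 * (1 + ‖x‖) ^ (-(2 * p - q)) with hd
  have hdi : Integrable d := (integrable_one_add_norm_rpow hr).const_mul _
  have hd0 : 0 ≤ ∫ x, d x := integral_nonneg fun x => by simp only [hd]; positivity
  refine ⟨2 ^ q * ((∫ x, d x) + ∫ x, d x), by positivity, fun f v hf hv hfC hvC ξ => ?_⟩
  refine integral_mul_comp_sub_le hq hf hv hdi hdi (fun x y => ?_) ξ
  simp only [hd]
  set X := 1 + ‖x‖
  set Y := 1 + ‖y‖
  have hX : 0 < X := by positivity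
  have hY : 0 < Y := by positivity
  have h1 : f x * v y ≤ C * X ^ (-p) * (C * Y ^ (-p)) :=
    mul_le_mul (hfC x) (hvC y) (hv y) ((hf x).trans (hfC x))
  have h2 := neg_rpow_mul_neg_rpow_le hX hY (s := p - q) (t := p) (by linarith) (by linarith)
  have h3 := neg_rpow_mul_neg_rpow_le hX hY (s := p) (t := p - q) (by linarith) (by linarith)
  have e1 : X ^ q * X ^ (-p) = X ^ (-(p - q)) := by rw [← Real.rpow_add hX]; congr 1; ring
  have e2 : Y ^ q * Y ^ (-p) = Y ^ (-(p - q)) := by rw [← Real.rpow_add hY]; congr 1; ring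
  have e3 : p - q + p = 2 * p - q := by ring
  have e4 : p + (p - q) = 2 * p - q := by ring
  rw [e3] at h2
  rw [e4] at h3
  calc _ ≤ (X ^ q + Y ^ q) * (C * X ^ (-p) * (C * Y ^ (-p))) := by gcongr
    _ = C ^ 2 * ((X ^ q * X ^ (-p)) * Y ^ (-p) + X ^ (-p) * (Y ^ q * Y ^ (-p))) := by ring
    _ = C ^ 2 * (X ^ (-(p - q)) * Y ^ (-p) + X ^ (-p) * Y ^ (-(p - q))) := by rw [e1, e2]
    _ ≤ C ^ 2 * ((X ^ (-(2 * p - q)) + Y ^ (-(2 * p - q))) +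
        (X ^ (-(2 * p - q)) + Y ^ (-(2 * p - q)))) := by gcongr
    _ = _ := by ring

/-- Convolution of the Fourier transform of an `H¹` function with a decaying `L²` function. -/
theorem exists_convolution_bound_of_sobolev {B M C p q : ℝ} (hB : 0 ≤ B) (hM : 0 ≤ M)
    (hC : 0 ≤ C) (hq : 0 ≤ q) (hq1 : q ≤ 1) (hqp : 5 * q ≤ 3 * p) :
    ∃ A, 0 ≤ A ∧ ∀ f v : R3 → ℝ, (∀ x, 0 ≤ f x) → (∀ x, 0 ≤ v x) →
      Integrable (fun x => ((1 + ‖x‖) * f x) ^ 2) → ∫ x, ((1 + ‖x‖) * f x) ^ 2 ≤ B →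
      Integrable (fun x => v x ^ 2) → ∫ x, v x ^ 2 ≤ M →
      (∀ x, v x ≤ C * (1 + ‖x‖) ^ (-p)) →
      ∀ ξ, ∫ η, f (ξ - η) * v η ≤ A * (1 + ‖ξ‖) ^ (-q) := by
  set C' := C ^ ((3 : ℝ) / 5) with hC'
  have hC'0 : 0 ≤ C' := by positivity
  have hki : Integrable fun x : R3 => (1 + ‖x‖) ^ (-(10 / 3 : ℝ)) :=
    integrable_one_add_norm_rpow (by norm_num)
  set k := ∫ x : R3, (1 + ‖x‖) ^ (-(10 / 3 : ℝ)) with hk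
  have hk0 : 0 ≤ k := integral_nonneg fun x => by positivity
  refine ⟨2 ^ q * (((1 + C') * B + C' * k) + (1 + C') * M), by positivity,
    fun f v hf hv hfi hfB hvi hvM hvC ξ => ?_⟩
  have i1 : Integrable fun x => (1 + C') * ((1 + ‖x‖) * f x) ^ 2 := hfi.const_mul _
  have i2 : Integrable fun x : R3 => C' * (1 + ‖x‖) ^ (-(10 / 3 : ℝ)) := hki.const_mul _
  have i3 : Integrable fun x => (1 + C') * ((1 + ‖x‖) * f x) ^ 2 +
      C' * (1 + ‖x‖) ^ (-(10 / 3 : ℝ)) := i1.add i2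
  refine (integral_mul_comp_sub_le hq hf hv i3 (hvi.const_mul (1 + C')) (fun x y => ?_) ξ).trans ?_
  · set X := 1 + ‖x‖ with hXd
    set Y := 1 + ‖y‖ with hYd
    have hX1 : 1 ≤ X := by rw [hXd]; linarith [norm_nonneg x]
    have hY1 : 1 ≤ Y := by rw [hYd]; linarith [norm_nonneg y]
    have hX : 0 < X := by linarith
    have hY : 0 < Y := by linarith
    have hfx := hf x
    have hvy := hv y
    set F := X * f x with hF
    have hF0 : 0 ≤ F := by positivity
    have t1 : X ^ q * (f x * v y) ≤ F ^ 2 + v y ^ 2 := by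
      have : X ^ q ≤ X := by
        simpa using Real.rpow_le_rpow_of_exponent_le hX1 hq1
      calc X ^ q * (f x * v y) ≤ X * (f x * v y) := by gcongr
        _ = F * v y := by rw [hF]; ring
        _ ≤ _ := by nlinarith [sq_nonneg (F - v y), sq_nonneg F, sq_nonneg (v y)]
    -- A power 3/5 of v is spent on pointwise decay, which needs 5q/3 ≤ p. The remaining v^{2/5}
    -- leads, through Young with exponents 3/5 and 2/5, to v² and X^{-10/3}, integrable because 10/3
    -- > 3.
    have t2 : Y ^ q * v y ≤ C' * v y ^ ((2 : ℝ) / 5) := by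
      have h1 : Y ^ (5 * q / 3) * v y ≤ C := by
        calc Y ^ (5 * q / 3) * v y ≤ Y ^ (5 * q / 3) * (C * Y ^ (-p)) := by
              gcongr; exact hvC y
          _ = C * Y ^ (5 * q / 3 - p) := by
              rw [mul_left_comm, ← Real.rpow_add hY]; rfl
          _ ≤ C * 1 := by
              gcongr
              exact Real.rpow_le_one_of_one_le_of_nonpos hY1 (by linarith)
          _ = C := mul_one C
      have h2 : v y = v y ^ ((3 : ℝ) / 5) * v y ^ ((2 : ℝ) / 5) := by
        rw [← Real.rpow_add' hvy (by norm_num)]; norm_num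
      have h3 : Y ^ q = (Y ^ (5 * q / 3)) ^ ((3 : ℝ) / 5) := by
        rw [← Real.rpow_mul hY.le]; congr 1; ring
      calc Y ^ q * v y = (Y ^ (5 * q / 3)) ^ ((3 : ℝ) / 5) * (v y ^ ((3 : ℝ) / 5) *
            v y ^ ((2 : ℝ) / 5)) := by rw [← h2, ← h3]
        _ = (Y ^ (5 * q / 3) * v y) ^ ((3 : ℝ) / 5) * v y ^ ((2 : ℝ) / 5) := by
            rw [Real.mul_rpow (by positivity) hvy]; ring
        _ ≤ _ := by rw [hC']; gcongr
    have t3 : (X ^ (-1 : ℝ) * v y ^ ((2 : ℝ) / 5)) ^ 2 ≤ X ^ (-(10 / 3 : ℝ)) + v y ^ 2 := by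
      have := rpow_mul_rpow_le_add (a := X ^ (-(10 / 3 : ℝ))) (b := v y ^ (2 : ℝ)) (s := 3 / 5)
        (by positivity) (by positivity) (by norm_num) (by norm_num)
      rw [← Real.rpow_mul hX.le, ← Real.rpow_mul hvy, Real.rpow_two] at this
      refine le_trans (le_of_eq ?_) this
      rw [← Real.rpow_two, Real.mul_rpow (by positivity) (by positivity), ← Real.rpow_mul hX.le,
        ← Real.rpow_mul hvy]
      norm_num
    have t4 : Y ^ q * (f x * v y) ≤ C' * (F ^ 2 + (X ^ (-(10 / 3 : ℝ)) + v y ^ 2)) := by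
      have hfX : f x = F * X ^ (-1 : ℝ) := by
        rw [Real.rpow_neg_one, hF]; field_simp
      have hw : 0 ≤ X ^ (-1 : ℝ) * v y ^ ((2 : ℝ) / 5) := by positivity
      calc Y ^ q * (f x * v y) = f x * (Y ^ q * v y) := by ring
        _ ≤ f x * (C' * v y ^ ((2 : ℝ) / 5)) := by gcongr
        _ = C' * (F * (X ^ (-1 : ℝ) * v y ^ ((2 : ℝ) / 5))) := by rw [hfX]; ring
        _ ≤ C' * (F ^ 2 + (X ^ (-1 : ℝ) * v y ^ ((2 : ℝ) / 5)) ^ 2) := by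
            gcongr
            nlinarith [sq_nonneg (F - X ^ (-1 : ℝ) * v y ^ ((2 : ℝ) / 5))]
        _ ≤ _ := by gcongr
    rw [add_mul]
    linarith
  · rw [integral_add i1 i2, integral_const_mul, integral_const_mul, integral_const_mul]
    gcongr

/-- The critical step: quadratic decay improves the convolution bound to order `5/4`. -/
theorem exists_convolution_bound_of_sobolev_of_decay {B C : ℝ} (hB : 0 ≤ B) (hC : 0 ≤ C) :
    ∃ A, 0 ≤ A ∧ ∀ f v : R3 → ℝ, (∀ x, 0 ≤ f x) → (∀ x, 0 ≤ v x) →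
      Integrable (fun x => ((1 + ‖x‖) * f x) ^ 2) → ∫ x, ((1 + ‖x‖) * f x) ^ 2 ≤ B →
      (∀ x, f x ≤ C * (1 + ‖x‖) ^ (-(2 : ℝ))) → (∀ x, v x ≤ C * (1 + ‖x‖) ^ (-(2 : ℝ))) →
      ∀ ξ, ∫ η, f (ξ - η) * v η ≤ A * (1 + ‖ξ‖) ^ (-(5 / 4 : ℝ)) := by
  set C' := C ^ ((1 : ℝ) / 4) * C with hC'
  have hC'0 : 0 ≤ C' := by positivity
  have j1 : Integrable fun x : R3 => C' * (1 + ‖x‖) ^ (-(16 / 5 : ℝ)) :=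
    (integrable_one_add_norm_rpow (by norm_num)).const_mul _
  have j2 : Integrable fun x : R3 => C * (1 + ‖x‖) ^ (-(7 / 2 : ℝ)) :=
    (integrable_one_add_norm_rpow (by norm_num)).const_mul _
  have j12 : Integrable fun x : R3 => C' * (1 + ‖x‖) ^ (-(16 / 5 : ℝ)) +
      C * (1 + ‖x‖) ^ (-(7 / 2 : ℝ)) := j1.add j2
  have j1n : 0 ≤ ∫ x : R3, C' * (1 + ‖x‖) ^ (-(16 / 5 : ℝ)) :=
    integral_nonneg fun x => by positivity
  have j2n : 0 ≤ ∫ x : R3, C * (1 + ‖x‖) ^ (-(7 / 2 : ℝ)) :=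
    integral_nonneg fun x => by positivity
  refine ⟨2 ^ (5 / 4 : ℝ) * (((C' + C) * B + ∫ x : R3, C * (1 + ‖x‖) ^ (-(7 / 2 : ℝ))) +
    ((∫ x : R3, C' * (1 + ‖x‖) ^ (-(16 / 5 : ℝ))) + ∫ x : R3, C * (1 + ‖x‖) ^ (-(7 / 2 : ℝ)))),
    by positivity, fun f v hf hv hfi hfB hfC hvC ξ => ?_⟩
  have i1 : Integrable fun x => (C' + C) * ((1 + ‖x‖) * f x) ^ 2 := hfi.const_mul _
  have i3 : Integrable fun x => (C' + C) * ((1 + ‖x‖) * f x) ^ 2 +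
      C * (1 + ‖x‖) ^ (-(7 / 2 : ℝ)) := i1.add j2
  refine (integral_mul_comp_sub_le (q := 5 / 4) (by norm_num) hf hv i3 j12
    (fun x y => ?_) ξ).trans ?_
  · set X := 1 + ‖x‖ with hXd
    set Y := 1 + ‖y‖ with hYd
    have hX : 0 < X := by positivity
    have hY : 0 < Y := by positivity
    have hfx := hf x
    have hvy := hv y
    set F := X * f x with hF
    have hF0 : 0 ≤ F := by positivity
    -- Interpolation between order-2 decay and the Sobolev weight: 5/4 = 2·(1/4) + 1·(3/4). Young
    -- with exponents 3/8 and 5/8 then produces F² and Y^{-16/5}, again with exponent above 3.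
    have t1 : X ^ (5 / 4 : ℝ) * f x ≤ C ^ ((1 : ℝ) / 4) * F ^ ((3 : ℝ) / 4) := by
      have h1 : X ^ (2 : ℝ) * f x ≤ C := by
        have := hfC x
        rw [Real.rpow_neg hX.le, ← div_eq_mul_inv, le_div_iff₀ (by positivity)] at this
        linarith
      have h2 : f x = f x ^ ((1 : ℝ) / 4) * f x ^ ((3 : ℝ) / 4) := by
        rw [← Real.rpow_add' hfx (by norm_num)]; norm_num
      have h3 : X ^ (5 / 4 : ℝ) = (X ^ (2 : ℝ)) ^ ((1 : ℝ) / 4) * X ^ ((3 : ℝ) / 4) := by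
        rw [← Real.rpow_mul hX.le, ← Real.rpow_add hX]; norm_num
      calc X ^ (5 / 4 : ℝ) * f x = ((X ^ (2 : ℝ)) ^ ((1 : ℝ) / 4) * X ^ ((3 : ℝ) / 4)) *
            (f x ^ ((1 : ℝ) / 4) * f x ^ ((3 : ℝ) / 4)) := by rw [← h2, ← h3]
        _ = (X ^ (2 : ℝ) * f x) ^ ((1 : ℝ) / 4) * F ^ ((3 : ℝ) / 4) := by
            rw [Real.mul_rpow (by positivity) hfx, hF, Real.mul_rpow hX.le hfx]; ring
        _ ≤ _ := by gcongr
    have t2 : F ^ ((3 : ℝ) / 4) * Y ^ (-(2 : ℝ)) ≤ F ^ 2 + Y ^ (-(16 / 5 : ℝ)) := by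
      have := rpow_mul_rpow_le_add (a := F ^ (2 : ℝ)) (b := Y ^ (-(16 / 5 : ℝ))) (s := 3 / 8)
        (by positivity) (by positivity) (by norm_num) (by norm_num)
      rw [← Real.rpow_mul hY.le, ← Real.rpow_mul hF0, Real.rpow_two] at this
      refine le_trans (le_of_eq ?_) this
      norm_num
    have t3 : X ^ (5 / 4 : ℝ) * (f x * v y) ≤ C' * (F ^ 2 + Y ^ (-(16 / 5 : ℝ))) := by
      calc X ^ (5 / 4 : ℝ) * (f x * v y) = X ^ (5 / 4 : ℝ) * f x * v y := by ring
        _ ≤ C ^ ((1 : ℝ) / 4) * F ^ ((3 : ℝ) / 4) * (C * Y ^ (-(2 : ℝ))) :=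
            mul_le_mul t1 (hvC y) hvy (by positivity)
        _ = C' * (F ^ ((3 : ℝ) / 4) * Y ^ (-(2 : ℝ))) := by rw [hC']; ring
        _ ≤ _ := by gcongr
    have t4 : (X ^ (-1 : ℝ) * Y ^ (-(3 / 4 : ℝ))) ^ 2 ≤
        X ^ (-(7 / 2 : ℝ)) + Y ^ (-(7 / 2 : ℝ)) := by
      have := neg_rpow_mul_neg_rpow_le hX hY (s := 2) (t := 3 / 2) (by norm_num) (by norm_num)
      have e : (2 : ℝ) + 3 / 2 = 7 / 2 := by norm_num
      rw [e] at this
      refine le_trans (le_of_eq ?_) this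
      rw [← Real.rpow_two, Real.mul_rpow (by positivity) (by positivity), ← Real.rpow_mul hX.le,
        ← Real.rpow_mul hY.le]
      norm_num
    have t5 : Y ^ (5 / 4 : ℝ) * v y ≤ C * Y ^ (-(3 / 4 : ℝ)) := by
      calc Y ^ (5 / 4 : ℝ) * v y ≤ Y ^ (5 / 4 : ℝ) * (C * Y ^ (-(2 : ℝ))) := by
            gcongr; exact hvC y
        _ = C * (Y ^ (5 / 4 : ℝ) * Y ^ (-(2 : ℝ))) := by ring
        _ = _ := by rw [← Real.rpow_add hY]; norm_num
    have t6 : Y ^ (5 / 4 : ℝ) * (f x * v y) ≤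
        C * (F ^ 2 + (X ^ (-(7 / 2 : ℝ)) + Y ^ (-(7 / 2 : ℝ)))) := by
      have hfX : f x = F * X ^ (-1 : ℝ) := by
        rw [Real.rpow_neg_one, hF]; field_simp
      have hw : 0 ≤ X ^ (-1 : ℝ) * Y ^ (-(3 / 4 : ℝ)) := by positivity
      calc Y ^ (5 / 4 : ℝ) * (f x * v y) = f x * (Y ^ (5 / 4 : ℝ) * v y) := by ring
        _ ≤ f x * (C * Y ^ (-(3 / 4 : ℝ))) := by gcongr
        _ = C * (F * (X ^ (-1 : ℝ) * Y ^ (-(3 / 4 : ℝ)))) := by rw [hfX]; ring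
        _ ≤ C * (F ^ 2 + (X ^ (-1 : ℝ) * Y ^ (-(3 / 4 : ℝ))) ^ 2) := by
            gcongr
            nlinarith [sq_nonneg (F - X ^ (-1 : ℝ) * Y ^ (-(3 / 4 : ℝ)))]
        _ ≤ _ := by gcongr
    rw [add_mul]
    linarith
  · rw [integral_add i1 j2, integral_add j1 j2, integral_const_mul (C' + C)]
    gcongr

end ConvolutionBounds

/-! ### Analytic continuation in the first frequency variable. -/

section Strip

/-- The integrand of the analytic continuation of the Fourier transform in the first variable. -/
def stripKernel (f : R3 → ℝ) (c : ℝ) (ξ : R3) (z : ℂ) (x : R3) : ℂ :=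
  cexp (phase 0 ξ x + -(2 * Real.pi * I * (x 0 - c : ℝ)) * z) * (f x : ℂ)

theorem norm_stripKernel (f : R3 → ℝ) (c : ℝ) (ξ : R3) (z : ℂ) (x : R3) :
    ‖stripKernel f c ξ z x‖ = Real.exp (2 * Real.pi * z.im * (x 0 - c)) * |f x| := by
  rw [stripKernel, norm_mul, Complex.norm_exp, Complex.norm_real, Real.norm_eq_abs,
    Complex.add_re, phase_re]
  congr 2
  simp
  ring

theorem norm_stripKernel_le {f : R3 → ℝ} {c a : ℝ} {ξ : R3} {z : ℂ}
    (hz : |2 * Real.pi * z.im| ≤ a) (x : R3) :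
    ‖stripKernel f c ξ z x‖ ≤ Real.exp (a * |x 0 - c|) * |f x| := by
  rw [norm_stripKernel]
  refine mul_le_mul_of_nonneg_right (Real.exp_le_exp.2 ?_) (abs_nonneg _)
  calc 2 * Real.pi * z.im * (x 0 - c) ≤ |2 * Real.pi * z.im| * |x 0 - c| := by
        rw [← abs_mul]; exact le_abs_self _
    _ ≤ _ := by gcongr

theorem continuous_phase_add (c : ℝ) (ξ : R3) (z : ℂ) :
    Continuous fun x : R3 => cexp (phase 0 ξ x + -(2 * Real.pi * I * (x 0 - c : ℝ)) * z) := by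
  fun_prop

theorem aestronglyMeasurable_stripKernel {f : R3 → ℝ} (hf : AEStronglyMeasurable f volume)
    (c : ℝ) (ξ : R3) (z : ℂ) : AEStronglyMeasurable (stripKernel f c ξ z) volume :=
  (continuous_phase_add c ξ z).aestronglyMeasurable.mul
    (Complex.continuous_ofReal.comp_aestronglyMeasurable hf)

theorem integrable_exp_abs_mul {f : R3 → ℝ} (hfm : AEStronglyMeasurable f volume) {b c : ℝ}
    (h1 : Integrable (expWeight b f)) (h2 : Integrable (expWeight (-b) f)) :
    Integrable fun x => Real.exp (b * |x 0 - c|) * |f x| := by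
  refine ((h1.norm.const_mul (Real.exp (-(b * c)))).add
    (h2.norm.const_mul (Real.exp (b * c)))).mono'
    ((Continuous.aestronglyMeasurable (by fun_prop)).mul
      (by simpa only [Real.norm_eq_abs] using hfm.norm))
    (.of_forall fun x => ?_)
  simp only [norm_expWeight, Pi.add_apply]
  rw [Real.norm_of_nonneg (by positivity), ← mul_assoc, ← mul_assoc, ← add_mul, ← Real.exp_add,
    ← Real.exp_add]
  gcongr
  rcases abs_cases (x 0 - c) with ⟨h, _⟩ | ⟨h, _⟩ <;> rw [h]
  · refine le_add_of_le_of_nonneg (Real.exp_le_exp.2 ?_) (Real.exp_pos _).le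
    linarith
  · refine le_add_of_nonneg_of_le (Real.exp_pos _).le (Real.exp_le_exp.2 ?_)
    linarith

/-- Differentiation produces a factor |x₀ - c|. It is absorbed by the margin e^{(b/2)|x₀-c|} between
the width 3b/2 of the strip and the integrable weight 2b. -/
theorem differentiableAt_integral_stripKernel {f : R3 → ℝ} (hfm : AEStronglyMeasurable f volume)
    {b c : ℝ} (hb : 0 < b) (hH : Integrable fun x => Real.exp (2 * b * |x 0 - c|) * |f x|)
    (ξ : R3) {z : ℂ} (hz : |2 * Real.pi * z.im| < 3 / 2 * b) :
    DifferentiableAt ℂ (fun z => ∫ x, stripKernel f c ξ z x) z := by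
  have hopen : IsOpen {z : ℂ | |2 * Real.pi * z.im| < 3 / 2 * b} :=
    isOpen_lt (by fun_prop) continuous_const
  have hpi := Real.pi_pos
  refine (hasDerivAt_integral_of_dominated_loc_of_deriv_le (hopen.mem_nhds hz)
    (.of_forall fun z => aestronglyMeasurable_stripKernel hfm c ξ z)
    (hH.mono' (aestronglyMeasurable_stripKernel hfm c ξ z) (.of_forall fun x =>
      norm_stripKernel_le (by linarith) x))
    (F' := fun z x => -(2 * Real.pi * I * (x 0 - c : ℝ)) * stripKernel f c ξ z x)
    (bound := fun x => 4 * Real.pi / b * (Real.exp (2 * b * |x 0 - c|) * |f x|))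
    ((Continuous.aestronglyMeasurable (by fun_prop)).mul
      (aestronglyMeasurable_stripKernel hfm c ξ z))
    (.of_forall fun x z hz => ?_) (hH.const_mul _)
    (.of_forall fun x z _ => ?_)).2.differentiableAt
  · have hz' : |2 * Real.pi * z.im| ≤ 3 / 2 * b := le_of_lt hz
    have h1 : ‖-(2 * Real.pi * I * (x 0 - c : ℝ) : ℂ)‖ = 2 * Real.pi * |x 0 - c| := by
      rw [norm_neg, norm_mul, Complex.norm_real, Real.norm_eq_abs]
      simp [abs_of_pos hpi]
    rw [norm_mul, h1]
    refine (mul_le_mul_of_nonneg_left (norm_stripKernel_le hz' x) (by positivity)).trans ?_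
    have h2 : Real.exp (2 * b * |x 0 - c|) =
        Real.exp (b / 2 * |x 0 - c|) * Real.exp (3 / 2 * b * |x 0 - c|) := by
      rw [← Real.exp_add]; congr 1; ring
    have h3 : |x 0 - c| ≤ 2 / b * Real.exp (b / 2 * |x 0 - c|) := by
      rw [div_mul_eq_mul_div, le_div_iff₀ hb]
      linarith [Real.add_one_le_exp (b / 2 * |x 0 - c|)]
    rw [h2]
    calc 2 * Real.pi * |x 0 - c| * (Real.exp (3 / 2 * b * |x 0 - c|) * |f x|)
        ≤ 2 * Real.pi * (2 / b * Real.exp (b / 2 * |x 0 - c|)) *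
          (Real.exp (3 / 2 * b * |x 0 - c|) * |f x|) := by gcongr
      _ = _ := by ring
  · have h1 : HasDerivAt (fun z : ℂ => phase 0 ξ x + -(2 * Real.pi * I * (x 0 - c : ℝ)) * z)
        (-(2 * Real.pi * I * (x 0 - c : ℝ))) z := by
      have := ((hasDerivAt_id z).const_mul (-(2 * Real.pi * I * (x 0 - c : ℝ)))).const_add
        (phase 0 ξ x)
      simpa using this
    refine (h1.cexp.mul_const (f x : ℂ)).congr_deriv ?_
    simp only [stripKernel]; ring

/-- The imaginary part of z becomes an exponential weight β = 2π Im z and the real part a shift of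
frequency. Recentring at c gives the factor e^{-βc} that cancels the growth e^{βc} of the weighted
bounds. -/
theorem norm_integral_stripKernel (f : R3 → ℝ) (c : ℝ) (ξ : R3) (z : ℂ) :
    ‖∫ x, stripKernel f c ξ z x‖ = Real.exp (-(2 * Real.pi * z.im * c)) *
      ‖𝓕 (expWeight (2 * Real.pi * z.im) f) (ξ + z.re • ex)‖ := by
  have h1 : ∀ x, stripKernel f c ξ z x = cexp (2 * Real.pi * I * c * z) *
      (cexp (phase (2 * Real.pi * z.im) (ξ + z.re • ex) x) * (f x : ℂ)) := by
    intro x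
    rw [stripKernel, ← mul_assoc, ← Complex.exp_add]
    congr 2
    have h2 : ⟪ξ + z.re • ex, x⟫ = ⟪ξ, x⟫ + z.re * x 0 := by
      rw [inner_add_left, real_inner_smul_left, ex, EuclideanSpace.inner_single_left]
      simp
    rw [phase_apply, phase_apply, h2]
    conv_lhs => rw [← Complex.re_add_im z]
    conv_rhs => rw [← Complex.re_add_im z]
    simp only [Complex.add_re, Complex.add_im, Complex.ofReal_re, Complex.ofReal_im,
      Complex.re_ofReal_mul, Complex.im_ofReal_mul, Complex.I_re, Complex.I_im]
    push_cast
    linear_combination (-(2 * Real.pi * z.im * x 0) : ℂ) * I_sq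
  simp only [h1]
  rw [integral_const_mul, norm_mul, fourier_expWeight, Complex.norm_exp]
  congr 2
  simp
  ring

/-- Three lines theorem: the weights β = ±b live on the boundary of the strip and β = 0 at its
centre. -/
theorem norm_fourier_le_of_weighted {f : R3 → ℝ} (hfm : AEStronglyMeasurable f volume)
    {b c p C : ℝ} (hb : 0 < b) (hp : 0 ≤ p) (hC : 0 ≤ C)
    (h1 : Integrable (expWeight (2 * b) f)) (h2 : Integrable (expWeight (-(2 * b)) f))
    (hV : ∀ β, |β| = b → ∀ ξ, ‖𝓕 (expWeight β f) ξ‖ ≤ C * Real.exp (β * c) * (1 + ‖ξ‖) ^ (-p))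
    (ξ : R3) : ‖𝓕 (expWeight 0 f) ξ‖ ≤
      C * Real.exp (b ^ 2 + p ^ 2) * (1 + ‖ξ‖) ^ (-p) := by
  have hpi := Real.pi_gt_three
  have hpi0 := Real.pi_pos
  have hH := integrable_exp_abs_mul (c := c) hfm h1 h2
  set y₀ := b / (2 * Real.pi) with hy₀
  have hy₀0 : 0 < y₀ := by positivity
  have hy₀b : 2 * Real.pi * y₀ = b := by rw [hy₀]; field_simp
  have hyb : y₀ ≤ b := by rw [← hy₀b]; nlinarith
  -- Shifting ξ by Re z costs e^{p|Re z|} in the decay bound. The factor e^{-z²} compensates, since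
  -- p|Re z| - (Re z)² ≤ p².
  set G : ℂ → ℂ := fun z => (∫ x, stripKernel f c ξ z x) * cexp (-z ^ 2) with hG
  have hre : ∀ z : ℂ, (-z ^ 2).re = z.im ^ 2 - z.re ^ 2 := by
    intro z; simp [pow_two]
  have himle : ∀ z : ℂ, z.im ∈ Set.Icc (-y₀) y₀ → |2 * Real.pi * z.im| ≤ b := by
    intro z hz
    rw [abs_mul, abs_of_pos (by positivity : 0 < 2 * Real.pi), ← hy₀b]
    gcongr
    exact abs_le.2 hz
  have hsq : ∀ z : ℂ, z.im ∈ Set.Icc (-y₀) y₀ → z.im ^ 2 ≤ b ^ 2 := by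
    intro z hz
    exact sq_le_sq' (by linarith [hz.1]) (by linarith [hz.2])
  have hdiff : DiffContOnCl ℂ G (Complex.im ⁻¹' Set.Ioo (-y₀) y₀) := by
    apply DifferentiableOn.diffContOnCl
    intro z hz
    have hz' : z.im ∈ Set.Icc (-y₀) y₀ := by
      have hcl : closure (Complex.im ⁻¹' Set.Ioo (-y₀) y₀) ⊆ Complex.im ⁻¹' Set.Icc (-y₀) y₀ :=
        closure_minimal (Set.preimage_mono Set.Ioo_subset_Icc_self)
          (isClosed_Icc.preimage Complex.continuous_im)
      exact hcl hz
    have := differentiableAt_integral_stripKernel hfm hb hH ξ (z := z)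
      (by linarith [himle z hz'])
    exact (this.mul (by fun_prop)).differentiableWithinAt
  have hgrow : ∃ k < Real.pi / (y₀ - -y₀), ∃ B,
      G =O[comap (_root_.abs ∘ Complex.re) atTop ⊓ 𝓟 (Complex.im ⁻¹' Set.Ioo (-y₀) y₀)]
        fun z => Real.exp (B * Real.exp (k * |z.re|)) := by
    -- G is bounded on the strip, so the growth condition holds with trivial exponents.
    refine ⟨0, div_pos hpi0 (by linarith), 0, Asymptotics.IsBigO.of_bound
      ((∫ x, Real.exp (2 * b * |x 0 - c|) * |f x|) * Real.exp (b ^ 2)) ?_⟩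
    rw [eventually_inf_principal]
    refine .of_forall fun z hz => ?_
    have hz' : z.im ∈ Set.Icc (-y₀) y₀ := ⟨hz.1.le, hz.2.le⟩
    simp only [hG, norm_mul, Complex.norm_exp, hre, zero_mul, Real.exp_zero, norm_one, mul_one]
    refine mul_le_mul ?_ ?_ (Real.exp_pos _).le (integral_nonneg fun x => by positivity)
    · exact norm_integral_le_of_norm_le hH (.of_forall fun x =>
        norm_stripKernel_le (by linarith [himle z hz']) x)
    · exact Real.exp_le_exp.2 (by nlinarith [hsq z hz', sq_nonneg z.re])
  have hline : ∀ z : ℂ, |2 * Real.pi * z.im| = b → z.im ∈ Set.Icc (-y₀) y₀ →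
      ‖G z‖ ≤ C * Real.exp (b ^ 2 + p ^ 2) * (1 + ‖ξ‖) ^ (-p) := by
    intro z hzb hz
    set β := 2 * Real.pi * z.im with hβ
    simp only [hG, norm_mul, Complex.norm_exp, hre, norm_integral_stripKernel]
    have e1 := hV β hzb (ξ + z.re • ex)
    have hex : ‖ex‖ = 1 := by simp [ex]
    have e2 : (1 + ‖ξ + z.re • ex‖) ^ (-p) ≤ Real.exp (p * |z.re|) * (1 + ‖ξ‖) ^ (-p) := by
      have h3 : ‖ξ‖ ≤ ‖ξ + z.re • ex‖ + |z.re| := by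
        have := norm_sub_le (ξ + z.re • ex) (z.re • ex)
        rwa [add_sub_cancel_right, norm_smul, hex, mul_one, Real.norm_eq_abs] at this
      have h4 : 1 + ‖ξ‖ ≤ Real.exp |z.re| * (1 + ‖ξ + z.re • ex‖) := by
        have h5 := Real.add_one_le_exp |z.re|
        have h6 := norm_nonneg (ξ + z.re • ex)
        nlinarith [abs_nonneg z.re, mul_nonneg (abs_nonneg z.re) h6]
      have h7 := Real.rpow_le_rpow (by positivity) h4 hp
      rw [Real.mul_rpow (Real.exp_pos _).le (by positivity), ← Real.exp_mul] at h7
      rw [Real.rpow_neg (by positivity), Real.rpow_neg (by positivity), ← div_eq_mul_inv,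
        le_div_iff₀ (by positivity), inv_mul_le_iff₀ (by positivity), mul_comm _ (Real.exp _),
        mul_comm p]
      exact h7
    have e3 : Real.exp (-(β * c)) * Real.exp (β * c) = 1 := by
      rw [← Real.exp_add]; simp
    calc Real.exp (-(β * c)) * ‖𝓕 (expWeight β f) (ξ + z.re • ex)‖ *
          Real.exp (z.im ^ 2 - z.re ^ 2)
        ≤ Real.exp (-(β * c)) * (C * Real.exp (β * c) *
          (Real.exp (p * |z.re|) * (1 + ‖ξ‖) ^ (-p))) * Real.exp (z.im ^ 2 - z.re ^ 2) := by
          gcongr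
          exact e1.trans (by gcongr)
      _ = (Real.exp (-(β * c)) * Real.exp (β * c)) * (C * (Real.exp (p * |z.re|) *
          Real.exp (z.im ^ 2 - z.re ^ 2)) * (1 + ‖ξ‖) ^ (-p)) := by ring
      _ ≤ 1 * (C * Real.exp (b ^ 2 + p ^ 2) * (1 + ‖ξ‖) ^ (-p)) := by
          rw [e3, ← Real.exp_add]
          refine mul_le_mul_of_nonneg_left (mul_le_mul_of_nonneg_right
            (mul_le_mul_of_nonneg_left ?_ hC) (by positivity)) zero_le_one
          refine Real.exp_le_exp.2 ?_
          nlinarith [hsq z hz, sq_nonneg (|z.re| - p), sq_abs z.re, sq_nonneg (|z.re|),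
            sq_nonneg (2 * |z.re| - p)]
      _ = _ := one_mul _
  have key := PhragmenLindelof.horizontal_strip (f := G) (z := 0) hdiff hgrow
    (fun z hz => hline z ?_ ?_) (fun z hz => hline z ?_ ?_) (by simpa using hy₀0.le)
    (by simpa using hy₀0.le)
  · have h0 : ‖G 0‖ = ‖𝓕 (expWeight 0 f) ξ‖ := by
      simp [hG, norm_integral_stripKernel]
    rwa [h0] at key
  · rw [hz, mul_neg, abs_neg, hy₀b, abs_of_pos hb]
  · rw [hz]; constructor <;> linarith
  · rw [hz, hy₀b, abs_of_pos hb]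
  · rw [hz]; constructor <;> linarith

end Strip

/-! ### Bootstrapping the decay exponent. -/

section Bootstrap

variable {u : ℝ → Lp ℝ 2 (volume : Measure R3)} {ut : ℝ → 𝓢'(R3, ℂ)} {c : ℝ → R3}
  {κ K D b : ℝ}

/-- In e^{βx}u² = u · e^{βx}u only one factor carries the weight, so the other remains the
unweighted transform, to which the H¹ bound applies. -/
theorem UniformlyLocalized.norm_fQ_le_integral (hκ : 0 < κ) (hloc : UniformlyLocalized u c κ K D)
    {β : ℝ} (hβ : 4 * |β| ≤ κ) (t : ℝ) (ξ : R3) : ‖fQ u β t ξ‖ ≤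
      Real.exp (β * c t 0) *
        ∫ η, ‖fV u 0 t (ξ - η)‖ * (Real.exp (-(β * c t 0)) * ‖fV u β t η‖) := by
  obtain ⟨M, hM0, hM⟩ := hloc.exists_weightMem hκ
  obtain ⟨z1, -, z3, -⟩ := hM 0 (by simpa using hκ.le) t t (by simp)
  obtain ⟨w1, -, w3, -⟩ := hM β hβ t t (by simp)
  have he : (expWeight β fun x => u t x ^ 2) =
      fun x => expWeight 0 (u t) x * expWeight β (u t) x := by
    ext x
    simp only [expWeight, zero_mul, Real.exp_zero, one_mul]
    push_cast; ring
  have h1 : fQ u β t ξ = ∫ η, fV u 0 t (ξ - η) * fV u β t η := by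
    rw [fQ, he, fourier_mul_eq_integral z1 z3 w1 w3]; rfl
  rw [h1]
  refine (norm_integral_le_integral_norm _).trans (le_of_eq ?_)
  rw [← integral_const_mul]
  congr 1 with η
  rw [norm_mul, mul_left_comm, ← mul_assoc (Real.exp _) (Real.exp _), ← Real.exp_add,
    add_neg_cancel, Real.exp_zero, one_mul]

theorem UniformlyLocalized.hasWeightedDecay_fQ (hκ : 0 < κ) (hloc : UniformlyLocalized u c κ K D)
    (hb : 4 * b ≤ κ) {A q : ℝ} (hA : 0 ≤ A)
    (h : ∀ β, |β| = b → ∀ t ξ, ∫ η, ‖fV u 0 t (ξ - η)‖ *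
      (Real.exp (-(β * c t 0)) * ‖fV u β t η‖) ≤ A * (1 + ‖ξ‖) ^ (-q)) :
    HasWeightedDecay b c (fQ u) q := by
  refine ⟨A, hA, fun β hβ t ξ => ?_⟩
  refine (hloc.norm_fQ_le_integral hκ (by rw [hβ]; exact hb) t ξ).trans ?_
  calc _ ≤ Real.exp (β * c t 0) * (A * (1 + ‖ξ‖) ^ (-q)) := by gcongr; exact h β hβ t ξ
    _ = _ := by ring

theorem UniformlyLocalized.hasWeightedDecay_fQ_zero (hκ : 0 < κ)
    (hloc : UniformlyLocalized u c κ K D) (hb : 4 * b ≤ κ) :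
    HasWeightedDecay b c (fQ u) 0 := by
  obtain ⟨M, hM0, hM⟩ := hloc.exists_weightMem hκ
  refine ⟨M * M, by positivity, fun β hβ t ξ => ?_⟩
  obtain ⟨-, -, z3, z4⟩ := hM 0 (by simpa using hκ.le) t t (by simp)
  obtain ⟨-, -, w3, w4⟩ := hM β (by rw [hβ]; exact hb) t t (by simp)
  have h1 := (norm_fourier_le_integral _ ξ).trans (integrable_expWeight_sq w3 w4).2
  rw [Real.sqrt_sq (by positivity)] at h1
  have h2 : ‖u t‖ ≤ M := by
    rw [Lp_norm_eq_sqrt_integral]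
    simp only [expWeight_zero, Complex.norm_real, zero_mul, Real.exp_zero, one_mul] at z4
    exact Real.sqrt_le_iff.2 ⟨hM0, z4⟩
  rw [neg_zero, Real.rpow_zero, mul_one]
  refine h1.trans ?_
  calc Real.exp (β * c t 0) * M * ‖u t‖ ≤ Real.exp (β * c t 0) * M * M := by gcongr
    _ = _ := by ring

theorem HasWeightedDecay.normalized_le {W : ℝ → ℝ → R3 → ℂ} {p C β t : ℝ} {ξ : R3}
    (h : ‖W β t ξ‖ ≤ C * Real.exp (β * c t 0) * (1 + ‖ξ‖) ^ (-p)) :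
    Real.exp (-(β * c t 0)) * ‖W β t ξ‖ ≤ C * (1 + ‖ξ‖) ^ (-p) := by
  rw [Real.exp_neg, inv_mul_le_iff₀ (Real.exp_pos _)]
  linarith

theorem UniformlyLocalized.integral_normalized_sq_le (hκ : 0 < κ)
    (hloc : UniformlyLocalized u c κ K D) (hb : 4 * b ≤ κ) :
    ∃ M, 0 ≤ M ∧ ∀ β, |β| = b → ∀ t,
      Integrable (fun η => (Real.exp (-(β * c t 0)) * ‖fV u β t η‖) ^ 2) ∧
      ∫ η, (Real.exp (-(β * c t 0)) * ‖fV u β t η‖) ^ 2 ≤ M := by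
  obtain ⟨M, hM0, hM⟩ := hloc.exists_weightMem hκ
  refine ⟨M ^ 2, by positivity, fun β hβ t => ?_⟩
  obtain ⟨w1, -, w3, w4⟩ := hM β (by rw [hβ]; exact hb) t t (by simp)
  have hi : Integrable fun η => ‖fV u β t η‖ ^ 2 :=
    (memLp_fourier w1 w3).integrable_norm_pow (by norm_num)
  simp only [mul_pow]
  refine ⟨hi.const_mul _, ?_⟩
  have h1 : ∫ η, ‖fV u β t η‖ ^ 2 = ∫ x, ‖expWeight β (u t) x‖ ^ 2 :=
    integral_norm_fourier_sq w1 w3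
  rw [integral_const_mul, h1]
  calc _ ≤ Real.exp (-(β * c t 0)) ^ 2 * (Real.exp (β * c t 0) * M) ^ 2 := by gcongr
    _ = (Real.exp (-(β * c t 0)) * Real.exp (β * c t 0)) ^ 2 * M ^ 2 := by ring
    _ = M ^ 2 := by rw [← Real.exp_add]; simp

/-- The strip argument uses integrability of e^{±2bx}u, which is why 8b ≤ κ is required instead of
4b ≤ κ. -/
theorem UniformlyLocalized.exists_norm_fV_zero_le (hκ : 0 < κ)
    (hloc : UniformlyLocalized u c κ K D) (hb : 0 < b) (hbκ : 8 * b ≤ κ) {p : ℝ} (hp : 0 ≤ p)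
    (hV : HasWeightedDecay b c (fV u) p) :
    ∃ C, 0 ≤ C ∧ ∀ t ξ, ‖fV u 0 t ξ‖ ≤ C * (1 + ‖ξ‖) ^ (-p) := by
  obtain ⟨C, hC0, hC⟩ := hV
  obtain ⟨M, hM0, hM⟩ := hloc.exists_weightMem hκ
  refine ⟨C * Real.exp (b ^ 2 + p ^ 2), by positivity, fun t ξ => ?_⟩
  refine norm_fourier_le_of_weighted (c := c t 0) (Lp.aestronglyMeasurable (u t)) hb hp hC0
    (hM (2 * b) ?_ t t (by simp)).1 (hM (-(2 * b)) ?_ t t (by simp)).1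
    (fun β hβ ξ => hC β hβ t ξ) ξ
  · rw [abs_of_pos (by positivity)]; linarith
  · rw [abs_neg, abs_of_pos (by positivity)]; linarith

theorem UniformlyLocalized.hasWeightedDecay_fQ_of_sobolev (hκ : 0 < κ)
    (hloc : UniformlyLocalized u c κ K D) (hb : 4 * b ≤ κ) {B : ℝ} (hB : HOneBound u B) {p q : ℝ}
    (hq : 0 ≤ q) (hq1 : q ≤ 1) (hqp : 5 * q ≤ 3 * p) (hV : HasWeightedDecay b c (fV u) p) :
    HasWeightedDecay b c (fQ u) q := by
  obtain ⟨C, hC0, hC⟩ := hV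
  obtain ⟨M, hM0, hM⟩ := hloc.integral_normalized_sq_le hκ hb
  have hB0 : 0 ≤ B := (integral_nonneg fun ξ => by positivity).trans (hB 0).2
  obtain ⟨A, hA0, hA⟩ := exists_convolution_bound_of_sobolev hB0 hM0 hC0 hq hq1 hqp
  refine hloc.hasWeightedDecay_fQ hκ hb hA0 fun β hβ t => ?_
  have hBt := hB t
  rw [← expWeight_zero] at hBt
  exact hA (fun x => ‖fV u 0 t x‖) (fun x => Real.exp (-(β * c t 0)) * ‖fV u β t x‖)
    (fun x => by positivity) (fun x => by positivity) hBt.1 hBt.2 (hM β hβ t).1 (hM β hβ t).2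
    (fun x => HasWeightedDecay.normalized_le (hC β hβ t x))

/-- At p = 2 decay alone yields only q < 1, and the Sobolev estimate stops at q = 1; after the gain
of one order neither exceeds 2. Combining the H¹ bound with decay of both factors breaks the
deadlock. -/
theorem UniformlyLocalized.hasWeightedDecay_fQ_of_quadratic (hκ : 0 < κ)
    (hloc : UniformlyLocalized u c κ K D) (hb : 0 < b) (hbκ : 8 * b ≤ κ) {B : ℝ}
    (hB : HOneBound u B) (hV : HasWeightedDecay b c (fV u) 2) :
    HasWeightedDecay b c (fQ u) (5 / 4) := by
  obtain ⟨C₀, hC₀0, hC₀⟩ := hloc.exists_norm_fV_zero_le hκ hb hbκ (by norm_num) hV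
  obtain ⟨C, hC0, hC⟩ := hV
  have hB0 : 0 ≤ B := (integral_nonneg fun ξ => by positivity).trans (hB 0).2
  obtain ⟨A, hA0, hA⟩ := exists_convolution_bound_of_sobolev_of_decay hB0
    (show 0 ≤ max C C₀ by positivity)
  refine hloc.hasWeightedDecay_fQ hκ (by linarith) hA0 fun β hβ t => ?_
  have hBt := hB t
  rw [← expWeight_zero] at hBt
  refine hA (fun x => ‖fV u 0 t x‖) (fun x => Real.exp (-(β * c t 0)) * ‖fV u β t x‖)
    (fun x => by positivity) (fun x => by positivity) hBt.1 hBt.2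
    (fun x => (hC₀ t x).trans ?_)
    (fun x => (HasWeightedDecay.normalized_le (hC β hβ t x)).trans ?_)
  · gcongr; exact le_max_right _ _
  · gcongr; exact le_max_left _ _

theorem UniformlyLocalized.hasWeightedDecay_fQ_of_fast (hκ : 0 < κ)
    (hloc : UniformlyLocalized u c κ K D) (hb : 0 < b) (hbκ : 8 * b ≤ κ) {p q : ℝ}
    (hq : 0 ≤ q) (hqp : q ≤ p) (hr : 3 < 2 * p - q) (hV : HasWeightedDecay b c (fV u) p) :
    HasWeightedDecay b c (fQ u) q := by
  obtain ⟨C₀, hC₀0, hC₀⟩ := hloc.exists_norm_fV_zero_le hκ hb hbκ (hq.trans hqp) hV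
  obtain ⟨C, hC0, hC⟩ := hV
  obtain ⟨A, hA0, hA⟩ := exists_convolution_bound_of_decay (C := max C C₀) hq hqp hr
  refine hloc.hasWeightedDecay_fQ hκ (by linarith) hA0 fun β hβ t => ?_
  refine hA (fun x => ‖fV u 0 t x‖) (fun x => Real.exp (-(β * c t 0)) * ‖fV u β t x‖)
    (fun x => by positivity) (fun x => by positivity)
    (fun x => (hC₀ t x).trans ?_)
    (fun x => (HasWeightedDecay.normalized_le (hC β hβ t x)).trans ?_)
  · gcongr; exact le_max_right _ _
  · gcongr; exact le_max_left _ _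

theorem IsClassBWith.hasWeightedDecay_fV (h : IsClassBWith u ut) (hκ : 0 < κ)
    (hloc : UniformlyLocalized u c κ K D) (hb : 0 < b) (hbκ : 8 * b ≤ κ) {B : ℝ}
    (hB : HOneBound u B) (n : ℕ) : HasWeightedDecay b c (fV u) (9 / 4 + n / 8) := by
  have hb4 : 4 * b ≤ κ := by linarith
  have gain : ∀ q, 0 ≤ q → HasWeightedDecay b c (fQ u) q → HasWeightedDecay b c (fV u) (q + 1) :=
    fun q hq => h.hasWeightedDecay_add_one hκ hloc hb hb4 hq
  have low : ∀ p q, 0 ≤ q → q ≤ 1 → 5 * q ≤ 3 * p → HasWeightedDecay b c (fV u) p →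
      HasWeightedDecay b c (fV u) (q + 1) := fun p q h0 h1 h2 hV =>
    gain q h0 (hloc.hasWeightedDecay_fQ_of_sobolev hκ hb4 hB h0 h1 h2 hV)
  induction n with
  | zero =>
    -- The rule q = 3p/5, capped at 1, gives the orders 1, 8/5, 49/25, 2 for `fV`; the quadratic
    -- step then gives 9/4.
    have h1 := gain 0 le_rfl (hloc.hasWeightedDecay_fQ_zero hκ hb4)
    have h2 := low _ (3 / 5) (by norm_num) (by norm_num) (by norm_num) h1
    have h3 := low _ (24 / 25) (by norm_num) (by norm_num) (by norm_num) h2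
    have h4 := low _ 1 (by norm_num) (by norm_num) (by norm_num) h3
    rw [one_add_one_eq_two] at h4
    have h5 := gain _ (by norm_num) (hloc.hasWeightedDecay_fQ_of_quadratic hκ hb hbκ hB h4)
    norm_num at h5 ⊢
    exact h5
  | succ n ih =>
    have hn : (0 : ℝ) ≤ n := n.cast_nonneg
    -- With q = p - 7/8 the requirement 2p - q = p + 7/8 > 3 holds from p = 9/4 onwards, and the net
    -- gain is 1/8.
    have h1 := gain (9 / 4 + n / 8 - 7 / 8) (by linarith)
      (hloc.hasWeightedDecay_fQ_of_fast hκ hb hbκ (by linarith) (by linarith) (by linarith) ih)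
    have e : (9 / 4 + n / 8 - 7 / 8 + 1 : ℝ) = 9 / 4 + (n + 1 : ℕ) / 8 := by push_cast; ring
    rwa [e] at h1

/-- The Fourier transform decays rapidly, uniformly in time. -/
theorem IsClassBWith.exists_fourier_le (h : IsClassBWith u ut) (hκ : 0 < κ)
    (hloc : UniformlyLocalized u c κ K D) {B : ℝ} (hB : HOneBound u B) (p : ℝ) :
    ∃ C, 0 ≤ C ∧ ∀ t ξ, ‖𝓕 (fun x => (u t x : ℂ)) ξ‖ ≤ C * (1 + ‖ξ‖) ^ (-p) := by
  obtain ⟨n, hn⟩ := exists_nat_ge (8 * p)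
  have hn0 : (0 : ℝ) ≤ n := n.cast_nonneg
  obtain ⟨C, hC0, hC⟩ := hloc.exists_norm_fV_zero_le hκ (b := κ / 8) (by positivity)
    (by linarith) (p := 9 / 4 + n / 8) (by positivity)
    (h.hasWeightedDecay_fV hκ hloc (by positivity) (by linarith) hB n)
  refine ⟨C, hC0, fun t ξ => ?_⟩
  have := hC t ξ
  rw [fV, expWeight_zero] at this
  refine this.trans ?_
  gcongr
  · linarith [norm_nonneg ξ]
  · linarith

end Bootstrap

/-! ### Rapid decay in frequency and joint smoothness in time and space. -/

section TimeSmooth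

/-- Rapid decay in frequency, uniformly in time. -/
def RapidDecay (W : ℝ → R3 → ℂ) : Prop :=
  (∀ t, Continuous (W t)) ∧ (∀ ξ, Continuous fun t => W t ξ) ∧
    ∀ p : ℕ, ∃ C, ∀ t ξ, (1 + ‖ξ‖) ^ p * ‖W t ξ‖ ≤ C

/-- Functions with `k` time derivatives, all rapidly decaying in frequency. -/
def TimeSmooth : ℕ → (ℝ → R3 → ℂ) → Prop
  | 0, W => RapidDecay W
  | k + 1, W => RapidDecay W ∧
      ∃ W', TimeSmooth k W' ∧ ∀ t ξ, HasDerivAt (fun τ => W τ ξ) (W' t ξ) t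

/-- Convolution in frequency at fixed time. -/
def freqConv (W₁ W₂ : ℝ → R3 → ℂ) (t : ℝ) (ξ : R3) : ℂ := ∫ η, W₁ t (ξ - η) * W₂ t η

variable {W W₁ W₂ : ℝ → R3 → ℂ} {k : ℕ}

theorem TimeSmooth.rapidDecay (h : TimeSmooth k W) : RapidDecay W := by
  cases k with
  | zero => exact h
  | succ k => exact h.1

theorem TimeSmooth.of_succ (h : TimeSmooth (k + 1) W) : TimeSmooth k W := by
  induction k generalizing W with
  | zero => exact h.1
  | succ k ih =>
    obtain ⟨h1, W', h2, h3⟩ := h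
    exact ⟨h1, W', ih h2, h3⟩

theorem RapidDecay.add (h₁ : RapidDecay W₁) (h₂ : RapidDecay W₂) :
    RapidDecay fun t ξ => W₁ t ξ + W₂ t ξ := by
  refine ⟨fun t => (h₁.1 t).add (h₂.1 t), fun ξ => (h₁.2.1 ξ).add (h₂.2.1 ξ), fun p => ?_⟩
  obtain ⟨C₁, hC₁⟩ := h₁.2.2 p
  obtain ⟨C₂, hC₂⟩ := h₂.2.2 p
  refine ⟨C₁ + C₂, fun t ξ => ?_⟩
  calc (1 + ‖ξ‖) ^ p * ‖W₁ t ξ + W₂ t ξ‖ ≤ (1 + ‖ξ‖) ^ p * (‖W₁ t ξ‖ + ‖W₂ t ξ‖) := by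
        gcongr; exact norm_add_le _ _
    _ ≤ _ := by rw [mul_add]; exact add_le_add (hC₁ t ξ) (hC₂ t ξ)

theorem RapidDecay.symbol_mul {m : R3 → ℂ} (hm : Continuous m) {A : ℝ} {N : ℕ}
    (hmA : ∀ ξ, ‖m ξ‖ ≤ A * (1 + ‖ξ‖) ^ N) (h : RapidDecay W) :
    RapidDecay fun t ξ => m ξ * W t ξ := by
  refine ⟨fun t => hm.mul (h.1 t), fun ξ => (h.2.1 ξ).const_mul _, fun p => ?_⟩
  obtain ⟨C, hC⟩ := h.2.2 (p + N)
  have hA : 0 ≤ A := by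
    have := (norm_nonneg _).trans (hmA 0)
    simpa using this
  refine ⟨A * C, fun t ξ => ?_⟩
  rw [norm_mul]
  calc (1 + ‖ξ‖) ^ p * (‖m ξ‖ * ‖W t ξ‖) ≤ (1 + ‖ξ‖) ^ p * (A * (1 + ‖ξ‖) ^ N * ‖W t ξ‖) := by
        gcongr; exact hmA ξ
    _ = A * ((1 + ‖ξ‖) ^ (p + N) * ‖W t ξ‖) := by rw [pow_add]; ring
    _ ≤ _ := by gcongr; exact hC t ξ

theorem RapidDecay.exists_le (h : RapidDecay W) (p : ℕ) :
    ∃ C, 0 ≤ C ∧ ∀ t ξ, (1 + ‖ξ‖) ^ p * ‖W t ξ‖ ≤ C * (1 + ‖ξ‖) ^ (-(4 : ℝ)) := by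
  obtain ⟨C, hC⟩ := h.2.2 (p + 4)
  refine ⟨C, le_trans (by positivity) (hC 0 0), fun t ξ => ?_⟩
  have hX : 0 < 1 + ‖ξ‖ := by positivity
  have h4 : (1 + ‖ξ‖) ^ (4 : ℝ) = (1 + ‖ξ‖) ^ 4 := by norm_cast
  rw [Real.rpow_neg hX.le, h4, ← div_eq_mul_inv, le_div_iff₀ (by positivity)]
  calc _ = (1 + ‖ξ‖) ^ (p + 4) * ‖W t ξ‖ := by rw [pow_add]; ring
    _ ≤ C := hC t ξ

theorem one_add_norm_pow_le (p : ℕ) (ξ η : R3) :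
    (1 + ‖ξ‖) ^ p ≤ (1 + ‖ξ - η‖) ^ p * (1 + ‖η‖) ^ p := by
  rw [← mul_pow]
  gcongr
  have h3 : ‖ξ‖ ≤ ‖ξ - η‖ + ‖η‖ := by simpa using norm_add_le (ξ - η) η
  nlinarith [mul_nonneg (norm_nonneg (ξ - η)) (norm_nonneg η)]

theorem RapidDecay.exists_conv_integrand_le (h₁ : RapidDecay W₁) (h₂ : RapidDecay W₂) (p : ℕ) :
    ∃ C, ∀ t ξ η, (1 + ‖ξ‖) ^ p * ‖W₁ t (ξ - η) * W₂ t η‖ ≤ C * (1 + ‖η‖) ^ (-(4 : ℝ)) := by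
  obtain ⟨C₁, hC₁⟩ := h₁.2.2 p
  obtain ⟨C₂, hC₂0, hC₂⟩ := h₂.exists_le p
  have hC₁0 : 0 ≤ C₁ := le_trans (by positivity) (hC₁ 0 0)
  refine ⟨C₁ * C₂, fun t ξ η => ?_⟩
  rw [norm_mul]
  calc _ ≤ (1 + ‖ξ - η‖) ^ p * (1 + ‖η‖) ^ p * (‖W₁ t (ξ - η)‖ * ‖W₂ t η‖) := by
        gcongr; exact one_add_norm_pow_le p ξ η
    _ = ((1 + ‖ξ - η‖) ^ p * ‖W₁ t (ξ - η)‖) * ((1 + ‖η‖) ^ p * ‖W₂ t η‖) := by ring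
    _ ≤ C₁ * (C₂ * (1 + ‖η‖) ^ (-(4 : ℝ))) :=
        mul_le_mul (hC₁ t _) (hC₂ t η) (by positivity) hC₁0
    _ = _ := by ring

theorem RapidDecay.continuous_conv_integrand (h₁ : RapidDecay W₁) (h₂ : RapidDecay W₂) (t : ℝ)
    (ξ : R3) : Continuous fun η => W₁ t (ξ - η) * W₂ t η :=
  ((h₁.1 t).comp (by fun_prop)).mul (h₂.1 t)

theorem RapidDecay.integrable_conv_integrand (h₁ : RapidDecay W₁) (h₂ : RapidDecay W₂) (t : ℝ)
    (ξ : R3) : Integrable fun η => W₁ t (ξ - η) * W₂ t η := by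
  obtain ⟨C, hC⟩ := h₁.exists_conv_integrand_le h₂ 0
  exact (integrable_one_add_norm_neg_four.const_mul C).mono'
    (h₁.continuous_conv_integrand h₂ t ξ).aestronglyMeasurable
    (.of_forall fun η => by simpa using hC t ξ η)

theorem RapidDecay.freqConv (h₁ : RapidDecay W₁) (h₂ : RapidDecay W₂) :
    RapidDecay (freqConv W₁ W₂) := by
  obtain ⟨C, hC⟩ := h₁.exists_conv_integrand_le h₂ 0
  have hbi := integrable_one_add_norm_neg_four.const_mul C
  refine ⟨fun t => ?_, fun ξ => ?_, fun p => ?_⟩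
  · refine continuous_of_dominated (bound := fun η => C * (1 + ‖η‖) ^ (-(4 : ℝ)))
      (fun ξ => (h₁.continuous_conv_integrand h₂ t ξ).aestronglyMeasurable)
      (fun ξ => .of_forall fun η => by simpa using hC t ξ η) hbi
      (.of_forall fun η => ?_)
    exact ((h₁.1 t).comp (by fun_prop)).mul continuous_const
  · refine continuous_of_dominated (bound := fun η => C * (1 + ‖η‖) ^ (-(4 : ℝ)))
      (fun t => (h₁.continuous_conv_integrand h₂ t ξ).aestronglyMeasurable)
      (fun t => .of_forall fun η => by simpa using hC t ξ η) hbi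
      (.of_forall fun η => ?_)
    exact (h₁.2.1 _).mul (h₂.2.1 _)
  · obtain ⟨C, hC⟩ := h₁.exists_conv_integrand_le h₂ p
    refine ⟨∫ η : R3, C * (1 + ‖η‖) ^ (-(4 : ℝ)), fun t ξ => ?_⟩
    rw [ZK.freqConv]
    have hX : 0 ≤ (1 + ‖ξ‖) ^ p := by positivity
    calc (1 + ‖ξ‖) ^ p * ‖∫ η, W₁ t (ξ - η) * W₂ t η‖
        ≤ (1 + ‖ξ‖) ^ p * ∫ η, ‖W₁ t (ξ - η) * W₂ t η‖ := by
          gcongr; exact norm_integral_le_integral_norm _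
      _ = ∫ η, (1 + ‖ξ‖) ^ p * ‖W₁ t (ξ - η) * W₂ t η‖ := (integral_const_mul _ _).symm
      _ ≤ _ := integral_mono ((h₁.integrable_conv_integrand h₂ t ξ).norm.const_mul _)
          (integrable_one_add_norm_neg_four.const_mul C) (hC t ξ)

theorem hasDerivAt_freqConv {W₁' W₂' : ℝ → R3 → ℂ} (h₁ : RapidDecay W₁) (h₂ : RapidDecay W₂)
    (h₁' : RapidDecay W₁') (h₂' : RapidDecay W₂')
    (hd₁ : ∀ t ξ, HasDerivAt (fun τ => W₁ τ ξ) (W₁' t ξ) t)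
    (hd₂ : ∀ t ξ, HasDerivAt (fun τ => W₂ τ ξ) (W₂' t ξ) t) (t : ℝ) (ξ : R3) :
    HasDerivAt (fun τ => freqConv W₁ W₂ τ ξ)
      (freqConv W₁' W₂ t ξ + freqConv W₁ W₂' t ξ) t := by
  obtain ⟨A, hA⟩ := h₁'.exists_conv_integrand_le h₂ 0
  obtain ⟨B, hB⟩ := h₁.exists_conv_integrand_le h₂' 0
  have key := (hasDerivAt_integral_of_dominated_loc_of_deriv_le (s := Set.univ) (x₀ := t)
    (F := fun τ η => W₁ τ (ξ - η) * W₂ τ η)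
    (F' := fun τ η => W₁' τ (ξ - η) * W₂ τ η + W₁ τ (ξ - η) * W₂' τ η)
    (bound := fun η => (A + B) * (1 + ‖η‖) ^ (-(4 : ℝ))) (μ := volume) univ_mem
    (.of_forall fun τ => (h₁.continuous_conv_integrand h₂ τ ξ).aestronglyMeasurable)
    (h₁.integrable_conv_integrand h₂ t ξ)
    ((h₁'.continuous_conv_integrand h₂ t ξ).add
      (h₁.continuous_conv_integrand h₂' t ξ)).aestronglyMeasurable
    (.of_forall fun η τ _ => ?_) (integrable_one_add_norm_neg_four.const_mul _)
    (.of_forall fun η τ _ => (hd₁ τ (ξ - η)).mul (hd₂ τ η))).2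
  · rw [integral_add (h₁'.integrable_conv_integrand h₂ t ξ)
      (h₁.integrable_conv_integrand h₂' t ξ)] at key
    exact key
  · rw [add_mul]
    refine (norm_add_le _ _).trans (add_le_add ?_ ?_)
    · simpa using hA τ ξ η
    · simpa using hB τ ξ η

theorem TimeSmooth.add (h₁ : TimeSmooth k W₁) (h₂ : TimeSmooth k W₂) :
    TimeSmooth k fun t ξ => W₁ t ξ + W₂ t ξ := by
  induction k generalizing W₁ W₂ with
  | zero => exact RapidDecay.add h₁ h₂
  | succ k ih =>
    obtain ⟨r₁, W₁', s₁, d₁⟩ := h₁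
    obtain ⟨r₂, W₂', s₂, d₂⟩ := h₂
    exact ⟨r₁.add r₂, _, ih s₁ s₂, fun t ξ => (d₁ t ξ).add (d₂ t ξ)⟩

theorem TimeSmooth.symbol_mul {m : R3 → ℂ} (hm : Continuous m) {A : ℝ} {N : ℕ}
    (hmA : ∀ ξ, ‖m ξ‖ ≤ A * (1 + ‖ξ‖) ^ N) (h : TimeSmooth k W) :
    TimeSmooth k fun t ξ => m ξ * W t ξ := by
  induction k generalizing W with
  | zero => exact RapidDecay.symbol_mul hm hmA h
  | succ k ih =>
    obtain ⟨r, W', s, d⟩ := h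
    exact ⟨r.symbol_mul hm hmA, _, ih s, fun t ξ => (d t ξ).const_mul (m ξ)⟩

theorem TimeSmooth.freqConv (h₁ : TimeSmooth k W₁) (h₂ : TimeSmooth k W₂) :
    TimeSmooth k (freqConv W₁ W₂) := by
  induction k generalizing W₁ W₂ with
  | zero => exact RapidDecay.freqConv h₁ h₂
  | succ k ih =>
    have g₁ := h₁.of_succ
    have g₂ := h₂.of_succ
    obtain ⟨r₁, W₁', s₁, d₁⟩ := h₁
    obtain ⟨r₂, W₂', s₂, d₂⟩ := h₂
    exact ⟨r₁.freqConv r₂, _, (ih s₁ g₂).add (ih g₁ s₂),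
      hasDerivAt_freqConv r₁ r₂ s₁.rapidDecay s₂.rapidDecay d₁ d₂⟩

/-- The inverse Fourier transform in space, as a function of time and space. -/
def spaceInv (W : ℝ → R3 → ℂ) (y : ℝ × R3) : ℂ :=
  ∫ ξ, cexp ((2 * Real.pi * ⟪ξ, y.2⟫ : ℝ) * I) * W y.1 ξ

theorem norm_cexp_mul_I_mul (r : ℝ) (z : ℂ) : ‖cexp (r * I) * z‖ = ‖z‖ := by
  rw [norm_mul, Complex.norm_exp_ofReal_mul_I, one_mul]

theorem RapidDecay.continuous_spaceInv_integrand (h : RapidDecay W) (y : ℝ × R3) :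
    Continuous fun ξ : R3 => cexp ((2 * Real.pi * ⟪ξ, y.2⟫ : ℝ) * I) * W y.1 ξ :=
  Continuous.mul (by fun_prop) (h.1 y.1)

theorem RapidDecay.continuous_spaceInv (h : RapidDecay W) : Continuous (spaceInv W) := by
  obtain ⟨C, hC0, hC⟩ := h.exists_le 0
  refine continuous_of_dominated (bound := fun ξ => C * (1 + ‖ξ‖) ^ (-(4 : ℝ)))
    (fun y => (h.continuous_spaceInv_integrand y).aestronglyMeasurable)
    (fun y => .of_forall fun ξ => ?_) (integrable_one_add_norm_neg_four.const_mul C)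
    (.of_forall fun ξ => ?_)
  · rw [norm_cexp_mul_I_mul]; simpa using hC y.1 ξ
  · exact Continuous.mul (by fun_prop) ((h.2.1 ξ).comp continuous_fst)

/-- The Fréchet derivative of the integrand of `spaceInv`. -/
def spaceInvDeriv (W W' : ℝ → R3 → ℂ) (y : ℝ × R3) (ξ : R3) : ℝ × R3 →L[ℝ] ℂ :=
  (ContinuousLinearMap.fst ℝ ℝ R3).smulRight
      (cexp ((2 * Real.pi * ⟪ξ, y.2⟫ : ℝ) * I) * W' y.1 ξ) +
    ((innerSL ℝ ξ).comp (ContinuousLinearMap.snd ℝ ℝ R3)).smulRight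
      (2 * Real.pi * I * (cexp ((2 * Real.pi * ⟪ξ, y.2⟫ : ℝ) * I) * W y.1 ξ))

theorem spaceInvDeriv_apply (W W' : ℝ → R3 → ℂ) (y v : ℝ × R3) (ξ : R3) :
    spaceInvDeriv W W' y ξ v = cexp ((2 * Real.pi * ⟪ξ, y.2⟫ : ℝ) * I) *
      ((v.1 : ℂ) * W' y.1 ξ + (2 * Real.pi * I * (⟪ξ, v.2⟫ : ℝ)) * W y.1 ξ) := by
  simp only [spaceInvDeriv, add_apply, ContinuousLinearMap.smulRight_apply,
    ContinuousLinearMap.comp_apply, ContinuousLinearMap.coe_fst', ContinuousLinearMap.coe_snd',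
    innerSL_apply_apply, Complex.real_smul]
  ring

theorem norm_spaceInvDeriv_le (W W' : ℝ → R3 → ℂ) (y : ℝ × R3) (ξ : R3) :
    ‖spaceInvDeriv W W' y ξ‖ ≤ ‖W' y.1 ξ‖ + 2 * Real.pi * (‖ξ‖ * ‖W y.1 ξ‖) := by
  refine ContinuousLinearMap.opNorm_le_bound _ (by positivity) fun v => ?_
  rw [spaceInvDeriv_apply, norm_cexp_mul_I_mul]
  refine (norm_add_le _ _).trans ?_
  have h1 : ‖(v.1 : ℂ)‖ ≤ ‖v‖ := by
    rw [Complex.norm_real]; exact norm_fst_le v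
  have h2 : |⟪ξ, v.2⟫| ≤ ‖ξ‖ * ‖v‖ :=
    (abs_real_inner_le_norm _ _).trans (by gcongr; exact norm_snd_le v)
  have h3 : ‖(2 * Real.pi * I * (⟪ξ, v.2⟫ : ℝ) : ℂ)‖ = 2 * Real.pi * |⟪ξ, v.2⟫| := by
    rw [norm_mul, Complex.norm_real, Real.norm_eq_abs]
    simp [abs_of_pos Real.pi_pos]
  rw [norm_mul, norm_mul, h3]
  have hpi := Real.pi_pos
  calc ‖(v.1 : ℂ)‖ * ‖W' y.1 ξ‖ + 2 * Real.pi * |⟪ξ, v.2⟫| * ‖W y.1 ξ‖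
      ≤ ‖v‖ * ‖W' y.1 ξ‖ + 2 * Real.pi * (‖ξ‖ * ‖v‖) * ‖W y.1 ξ‖ := by gcongr
    _ = _ := by ring

theorem hasFDerivAt_spaceInv_integrand {W' : ℝ → R3 → ℂ}
    (hd : ∀ t ξ, HasDerivAt (fun τ => W τ ξ) (W' t ξ) t) (y : ℝ × R3) (ξ : R3) :
    HasFDerivAt (fun y : ℝ × R3 => cexp ((2 * Real.pi * ⟪ξ, y.2⟫ : ℝ) * I) * W y.1 ξ)
      (spaceInvDeriv W W' y ξ) y := by
  have h1 : HasFDerivAt (fun y : ℝ × R3 => W y.1 ξ)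
      ((ContinuousLinearMap.fst ℝ ℝ R3).smulRight (W' y.1 ξ)) y := by
    have := (hd y.1 ξ).hasFDerivAt.comp y (hasFDerivAt_fst (𝕜 := ℝ) (p := y))
    refine this.congr_fderiv ?_
    ext v <;> simp
  have h2 : HasFDerivAt (fun y : ℝ × R3 => ((2 * Real.pi * ⟪ξ, y.2⟫ : ℝ) : ℂ) * I)
      (((innerSL ℝ ξ).comp (ContinuousLinearMap.snd ℝ ℝ R3)).smulRight
        (2 * Real.pi * I : ℂ)) y := by
    have := (((innerSL ℝ ξ).comp (ContinuousLinearMap.snd ℝ ℝ R3)).smulRight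
        (2 * Real.pi * I : ℂ)).hasFDerivAt (x := y)
    refine this.congr_of_eventuallyEq (.of_forall fun z => ?_)
    simp only [ContinuousLinearMap.smulRight_apply, ContinuousLinearMap.comp_apply,
      ContinuousLinearMap.coe_snd', innerSL_apply_apply, Complex.real_smul]
    push_cast; ring
  refine (h2.cexp.mul h1).congr_fderiv ?_
  refine ContinuousLinearMap.ext fun v => ?_
  rw [spaceInvDeriv_apply]
  simp only [add_apply, smul_apply,
    ContinuousLinearMap.smulRight_apply, ContinuousLinearMap.comp_apply,
    ContinuousLinearMap.coe_fst', ContinuousLinearMap.coe_snd', innerSL_apply_apply,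
    Complex.real_smul, smul_eq_mul]
  ring

theorem hasFDerivAt_spaceInv {W' : ℝ → R3 → ℂ} (h : RapidDecay W) (h' : RapidDecay W')
    (hd : ∀ t ξ, HasDerivAt (fun τ => W τ ξ) (W' t ξ) t) (y : ℝ × R3) :
    Integrable (spaceInvDeriv W W' y) ∧
      HasFDerivAt (spaceInv W) (∫ ξ, spaceInvDeriv W W' y ξ) y := by
  obtain ⟨A, hA0, hA⟩ := h'.exists_le 0
  obtain ⟨B, hB0, hB⟩ := h.exists_le 1
  obtain ⟨C, hC0, hC⟩ := h.exists_le 0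
  have hpi := Real.pi_pos
  have hbound : ∀ z : ℝ × R3, ∀ ξ, ‖spaceInvDeriv W W' z ξ‖ ≤
      (A + 2 * Real.pi * B) * (1 + ‖ξ‖) ^ (-(4 : ℝ)) := by
    intro z ξ
    refine (norm_spaceInvDeriv_le W W' z ξ).trans ?_
    have h1 := hA z.1 ξ
    have h2 := hB z.1 ξ
    rw [pow_zero, one_mul] at h1
    rw [pow_one] at h2
    have h3 : ‖ξ‖ * ‖W z.1 ξ‖ ≤ B * (1 + ‖ξ‖) ^ (-(4 : ℝ)) :=
      le_trans (by gcongr; linarith) h2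
    rw [add_mul, mul_assoc (2 * Real.pi)]
    gcongr
  have hbi := integrable_one_add_norm_neg_four.const_mul (A + 2 * Real.pi * B)
  have hm : AEStronglyMeasurable (spaceInvDeriv W W' y) volume := by
    have c1 := h.continuous_spaceInv_integrand y
    have c2 := h'.continuous_spaceInv_integrand y
    refine Continuous.aestronglyMeasurable ?_
    rw [show spaceInvDeriv W W' y = fun ξ => spaceInvDeriv W W' y ξ from rfl,
      continuous_clm_apply]
    intro v
    simp only [spaceInvDeriv_apply]
    have c3 := h.1 y.1
    have c4 := h'.1 y.1
    fun_prop
  refine ⟨hbi.mono' hm (.of_forall (hbound y)), ?_⟩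
  refine hasFDerivAt_integral_of_dominated_of_fderiv_le (s := Set.univ)
    (bound := fun ξ => (A + 2 * Real.pi * B) * (1 + ‖ξ‖) ^ (-(4 : ℝ))) univ_mem
    (.of_forall fun z => (h.continuous_spaceInv_integrand z).aestronglyMeasurable)
    ((integrable_one_add_norm_neg_four.const_mul C).mono'
      (h.continuous_spaceInv_integrand y).aestronglyMeasurable (.of_forall fun ξ => ?_)) hm
    (.of_forall fun ξ z _ => hbound z ξ) hbi
    (.of_forall fun ξ z _ => hasFDerivAt_spaceInv_integrand hd z ξ)
  rw [norm_cexp_mul_I_mul]; simpa using hC y.1 ξ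

theorem norm_inner_symbol_le (v ξ : R3) :
    ‖(2 * Real.pi * I * (⟪ξ, v⟫ : ℝ) : ℂ)‖ ≤ 2 * Real.pi * ‖v‖ * (1 + ‖ξ‖) ^ 1 := by
  have h3 : ‖(2 * Real.pi * I * (⟪ξ, v⟫ : ℝ) : ℂ)‖ = 2 * Real.pi * |⟪ξ, v⟫| := by
    rw [norm_mul, Complex.norm_real, Real.norm_eq_abs]
    simp [abs_of_pos Real.pi_pos]
  have hpi := Real.pi_pos
  rw [h3, pow_one, mul_assoc (2 * Real.pi)]
  refine mul_le_mul_of_nonneg_left ((abs_real_inner_le_norm ξ v).trans ?_) (by positivity)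
  rw [mul_comm]
  gcongr
  linarith

/-- A directional derivative of `spaceInv W` is again `spaceInv` of a function in the class one
level lower: time derivatives replace W by W', space derivatives multiply by a linear symbol.
Induction on k follows. -/
theorem TimeSmooth.contDiff_spaceInv (h : TimeSmooth k W) : ContDiff ℝ k (spaceInv W) := by
  induction k generalizing W with
  | zero => exact contDiff_zero.2 (RapidDecay.continuous_spaceInv h)
  | succ k ih =>
    have hk := h.of_succ
    obtain ⟨r, W', s, d⟩ := h
    have hder := fun y => hasFDerivAt_spaceInv r s.rapidDecay d y
    rw [Nat.cast_add, Nat.cast_one, contDiff_succ_iff_hasFDerivAt]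
    refine ⟨fun y => ∫ ξ, spaceInvDeriv W W' y ξ, ?_, fun y => (hder y).2⟩
    rw [contDiff_clm_apply_iff]
    intro v
    have hs : TimeSmooth k fun t ξ => (fun _ : R3 => (v.1 : ℂ)) ξ * W' t ξ +
        (fun ξ : R3 => (2 * Real.pi * I * (⟪ξ, v.2⟫ : ℝ) : ℂ)) ξ * W t ξ :=
      (s.symbol_mul (m := fun _ : R3 => (v.1 : ℂ)) (A := ‖(v.1 : ℂ)‖) (N := 0) continuous_const
        (fun ξ => by simp)).add
      (hk.symbol_mul (by fun_prop) (norm_inner_symbol_le v.2))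
    have he : (fun y => (∫ ξ, spaceInvDeriv W W' y ξ) v) =
        spaceInv fun t ξ => (fun _ : R3 => (v.1 : ℂ)) ξ * W' t ξ +
          (fun ξ : R3 => (2 * Real.pi * I * (⟪ξ, v.2⟫ : ℝ) : ℂ)) ξ * W t ξ := funext fun y => by
      rw [ContinuousLinearMap.integral_apply (hder y).1]
      simp only [spaceInvDeriv_apply]
      rfl
    rw [he]
    exact ih hs

end TimeSmooth

/-! ### Smooth representative and Sobolev bounds. -/

section Conclusion

variable {u : ℝ → Lp ℝ 2 (volume : Measure R3)} {ut : ℝ → 𝓢'(R3, ℂ)} {c : ℝ → R3}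
  {κ K D : ℝ}

theorem fourierInv_fourier_ae_eq {f : R3 → ℂ} (h1 : Integrable f) (hF : Integrable (𝓕 f)) :
    f =ᵐ[volume] 𝓕⁻ (𝓕 f) := by
  have hcont : Continuous (𝓕⁻ (𝓕 f)) := by
    have : 𝓕⁻ (𝓕 f) = fun x => 𝓕 (𝓕 f) (-x) := funext fun x =>
      Real.fourierInv_eq_fourier_neg _ _
    rw [this]
    exact (continuous_fourier hF).comp continuous_neg
  apply ae_eq_of_integral_contDiff_smul_eq h1.locallyIntegrable hcont.locallyIntegrable
  intro g g_smooth g_cpt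
  have hg₁ : HasCompactSupport (Complex.ofRealCLM ∘ g) := g_cpt.comp_left rfl
  have hg₂ : ContDiff ℝ ∞ (Complex.ofRealCLM ∘ g) := by fun_prop
  set φ : 𝓢(R3, ℂ) := hg₁.toSchwartzMap hg₂ with hφ
  have hφa : ∀ x, φ x = (g x : ℂ) := fun x => by simp [hφ]
  symm
  calc ∫ x, g x • 𝓕⁻ (𝓕 f) x = ∫ x, 𝓕 (𝓕 f) (-x) * φ x := by
        congr 1 with x
        rw [Real.fourierInv_eq_fourier_neg, hφa, Complex.real_smul, mul_comm]
    _ = ∫ x, 𝓕 (𝓕 f) x * φ (-x) := by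
        rw [← integral_neg_eq_self fun x => 𝓕 (𝓕 f) x * φ (-x)]
        simp only [neg_neg]
    _ = ∫ ξ, 𝓕 f ξ * 𝓕 (fun x => φ (-x)) ξ := integral_fourier_mul_eq hF φ.integrable.comp_neg
    _ = ∫ ξ, 𝓕 f ξ * (𝓕⁻ φ) ξ := by
        congr 1 with ξ
        rw [SchwartzMap.fourierInv_coe, Real.fourierInv_eq_fourier_comp_neg]
    _ = ∫ x, f x * 𝓕 (𝓕⁻ φ : 𝓢(R3, ℂ)) x := by
        rw [integral_fourier_mul_eq h1 (𝓕⁻ φ).integrable, SchwartzMap.fourier_coe]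
    _ = ∫ x, g x • f x := by
        congr 1 with x
        rw [fourier_fourierInv_eq, hφa, Complex.real_smul, mul_comm]

theorem norm_symXLap_zero_le (ξ : R3) :
    ‖symXLap 0 ξ‖ ≤ 8 * Real.pi ^ 3 * (1 + ‖ξ‖) ^ 3 := by
  have hpi := Real.pi_pos
  have h1 := norm_symX_le 0 ξ
  rw [abs_zero, zero_add] at h1
  have h2 : symXLap 0 ξ = symX 0 ξ * ((-(4 * Real.pi ^ 2 * ‖ξ‖ ^ 2) : ℝ) : ℂ) := by
    rw [symXLap]; push_cast; ring
  rw [h2, norm_mul, Complex.norm_real, norm_neg, Real.norm_of_nonneg (by positivity)]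
  calc ‖symX 0 ξ‖ * (4 * Real.pi ^ 2 * ‖ξ‖ ^ 2)
      ≤ 2 * Real.pi * (1 + ‖ξ‖) * (4 * Real.pi ^ 2 * (1 + ‖ξ‖) ^ 2) := by
        gcongr; linarith
    _ = _ := by ring

/-- The equation expresses ∂ₜû through û itself by polynomial symbols and a convolution, operations
that preserve `TimeSmooth k`. Each pass through the equation therefore raises k by one. -/
theorem IsClassBWith.timeSmooth_fourier (h : IsClassBWith u ut) (hκ : 0 < κ)
    (hloc : UniformlyLocalized u c κ K D) {B : ℝ} (hB : HOneBound u B) (k : ℕ) :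
    TimeSmooth k fun t => 𝓕 fun x => (u t x : ℂ) := by
  obtain ⟨M, hM0, hM⟩ := hloc.exists_weightMem hκ
  have hmem : ∀ t, Integrable (fun x => (u t x : ℂ)) ∧ MemLp (fun x => (u t x : ℂ)) 2 volume := by
    intro t
    have := hM 0 (by simpa using hκ.le) t t (by simp)
    rw [expWeight_zero] at this
    exact ⟨this.1, this.2.2.1⟩
  set F : ℝ → R3 → ℂ := fun t => 𝓕 fun x => (u t x : ℂ) with hF
  have hd : ∀ t ξ, HasDerivAt (fun τ => F τ ξ)
      (symXLap 0 ξ * F t ξ + symX 0 ξ * freqConv F F t ξ) t := by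
    intro t ξ
    have h1 := h.hasDerivAt_fourier_expWeight
      (hloc.locallyBoundedWeight hκ (b := 0) (by simpa using hκ.le)) ξ t
    have h2 : freqConv F F t ξ = 𝓕 (fun x => ((u t x ^ 2 : ℝ) : ℂ)) ξ := by
      rw [freqConv, ← fourier_mul_eq_integral (hmem t).1 (hmem t).2 (hmem t).1 (hmem t).2]
      simp only [pow_two, Complex.ofReal_mul]
    rw [h2]
    simpa only [expWeight_zero] using h1
  have hr : RapidDecay F := by
    refine ⟨fun t => continuous_fourier (hmem t).1, fun ξ =>
      continuous_iff_continuousAt.2 fun t => (hd t ξ).continuousAt, fun p => ?_⟩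
    obtain ⟨C, -, hC⟩ := h.exists_fourier_le hκ hloc hB p
    refine ⟨C, fun t ξ => ?_⟩
    have h1 := hC t ξ
    rw [Real.rpow_neg (by positivity), Real.rpow_natCast, ← div_eq_mul_inv,
      le_div_iff₀ (by positivity)] at h1
    linarith
  induction k with
  | zero => exact hr
  | succ k ih =>
    exact ⟨hr, _, (ih.symbol_mul (continuous_symXLap 0) norm_symXLap_zero_le).add
      ((ih.freqConv ih).symbol_mul (continuous_symX 0) (N := 1)
        (fun ξ => by simpa using norm_symX_le 0 ξ)), hd⟩

theorem IsClassBWith.exists_contDiff (h : IsClassBWith u ut) (hκ : 0 < κ)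
    (hloc : UniformlyLocalized u c κ K D) {B : ℝ} (hB : HOneBound u B) :
    ∃ U : ℝ × R3 → ℝ, ContDiff ℝ ∞ U ∧
      ∀ t : ℝ, (u t : R3 → ℝ) =ᵐ[volume] fun x => U (t, x) := by
  have hs := h.timeSmooth_fourier hκ hloc hB
  refine ⟨fun y => (spaceInv (fun t => 𝓕 fun x => (u t x : ℂ)) y).re, ?_, fun t => ?_⟩
  · exact Complex.reCLM.contDiff.comp (contDiff_infty.2 fun n => (hs n).contDiff_spaceInv)
  · obtain ⟨M, hM0, hM⟩ := hloc.exists_weightMem hκ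
    have hi := (hM 0 (by simpa using hκ.le) t t (by simp)).1
    rw [expWeight_zero] at hi
    obtain ⟨C, hC0, hC⟩ := h.exists_fourier_le hκ hloc hB 4
    have hFi : Integrable (𝓕 fun x => (u t x : ℂ)) :=
      (integrable_one_add_norm_neg_four.const_mul C).mono'
        (continuous_fourier hi).aestronglyMeasurable (.of_forall (hC t))
    filter_upwards [fourierInv_fourier_ae_eq hi hFi] with x hx
    have h1 : spaceInv (fun t => 𝓕 fun x => (u t x : ℂ)) (t, x) = (u t x : ℂ) := by
      rw [hx, Real.fourierInv_eq']; rfl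
    rw [h1, Complex.ofReal_re]

theorem one_add_sq_rpow_le (s : ℝ) (ξ : R3) :
    (1 + ‖ξ‖ ^ 2) ^ (s / 2) ≤ (1 + ‖ξ‖) ^ |s| := by
  have h1 : 1 ≤ 1 + ‖ξ‖ ^ 2 := by nlinarith [sq_nonneg ‖ξ‖]
  calc (1 + ‖ξ‖ ^ 2) ^ (s / 2) ≤ (1 + ‖ξ‖ ^ 2) ^ (|s| / 2) := by
        gcongr
        exact le_abs_self s
    _ ≤ ((1 + ‖ξ‖) ^ (2 : ℝ)) ^ (|s| / 2) := by
        gcongr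
        rw [Real.rpow_two]
        nlinarith [norm_nonneg ξ]
    _ = _ := by
        rw [← Real.rpow_mul (by positivity)]
        congr 1; ring

/-- Decay of order |s| + 2 leaves (1 + |ξ|)^{-2} after the Bessel weight. This is square integrable
in dimension three and independent of time. -/
theorem IsClassBWith.memSobolev_and_iSup_lt_top (h : IsClassBWith u ut) (hκ : 0 < κ)
    (hloc : UniformlyLocalized u c κ K D) {B : ℝ} (hB : HOneBound u B) (s : ℝ) :
    (∀ t : ℝ, MemSobolev s 2 (toDist (u t))) ∧ (⨆ t : ℝ, hsNorm s (toDist (u t))) < ⊤ := by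
  obtain ⟨M, hM0, hM⟩ := hloc.exists_weightMem hκ
  obtain ⟨C, hC0, hC⟩ := h.exists_fourier_le hκ hloc hB (|s| + 2)
  have hi : ∀ t, Integrable (fun x => (u t x : ℂ)) := fun t => by
    have := (hM 0 (by simpa using hκ.le) t t (by simp)).1
    rwa [expWeight_zero] at this
  set k : R3 → ℝ := fun ξ => C * (1 + ‖ξ‖) ^ (-(2 : ℝ)) with hk
  have hkm : MemLp k 2 volume := by
    have hkc : AEStronglyMeasurable k volume :=
      (Continuous.aestronglyMeasurable (Continuous.const_mul
        (Continuous.rpow_const (by fun_prop) fun ξ => Or.inl (by positivity)) C))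
    rw [memLp_two_iff_integrable_sq hkc]
    refine (integrable_one_add_norm_neg_four.const_mul (C ^ 2)).congr (.of_forall fun ξ => ?_)
    simp only [hk]
    rw [mul_pow, ← Real.rpow_mul_natCast (by positivity)]
    norm_num
  have hle : ∀ t ξ, ‖(((1 + ‖ξ‖ ^ 2) ^ (s / 2) : ℝ) : ℂ) * 𝓕 (fun x => (u t x : ℂ)) ξ‖ ≤ k ξ := by
    intro t ξ
    have hX : 0 < 1 + ‖ξ‖ := by positivity
    rw [norm_mul, Complex.norm_real, Real.norm_of_nonneg (by positivity)]
    calc _ ≤ (1 + ‖ξ‖) ^ |s| * (C * (1 + ‖ξ‖) ^ (-(|s| + 2))) := by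
          gcongr
          · exact one_add_sq_rpow_le s ξ
          · exact hC t ξ
      _ = C * ((1 + ‖ξ‖) ^ |s| * (1 + ‖ξ‖) ^ (-(|s| + 2))) := by ring
      _ = k ξ := by rw [← Real.rpow_add hX]; simp only [hk]; congr 2; ring
  have hmem : ∀ t, MemLp (fun ξ : R3 => (((1 + ‖ξ‖ ^ 2) ^ (s / 2) : ℝ) : ℂ) *
      𝓕 (fun x => (u t x : ℂ)) ξ) 2 volume := by
    intro t
    refine hkm.mono' (Continuous.aestronglyMeasurable (Continuous.mul
      (Complex.continuous_ofReal.comp (Continuous.rpow_const (by fun_prop)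
        fun ξ => Or.inl (by positivity))) (continuous_fourier (hi t)))) (.of_forall (hle t))
  have hri : ∀ t, Integrable (u t : R3 → ℝ) := fun t => by simpa using (hi t).re
  have hfin := fun t => memSobolev_and_hsNorm_le s (u t) (hri t) (hmem t)
  refine ⟨fun t => (hfin t).1, lt_of_le_of_lt (iSup_le fun t => (hfin t).2.trans ?_)
    hkm.eLpNorm_lt_top⟩
  exact eLpNorm_mono_real (hle t)

theorem IsClassBWith.exists_hOneBound_of_localized (h : IsClassBWith u ut) (hκ : 0 < κ)
    (hloc : UniformlyLocalized u c κ K D) : ∃ B, HOneBound u B := by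
  obtain ⟨M, hM0, hM⟩ := hloc.exists_weightMem hκ
  refine h.exists_hOneBound fun t => ?_
  have := (hM 0 (by simpa using hκ.le) t t (by simp)).1
  rw [expWeight_zero] at this
  simpa using this.re

end Conclusion

end ZK

end

theorem lemma2p9 (u : ℝ → Lp ℝ 2 (volume : Measure ZK.R3)) (hu : ZK.IsClassB u)
    (a : ℝ → ZK.R3) (κ C : ℝ) (hκ : 0 < κ) (hdecay : ZK.HasExpDecay u a κ C) :
    (∃ U : ℝ × ZK.R3 → ℝ, ContDiff ℝ ∞ U ∧
      ∀ t : ℝ, (u t : ZK.R3 → ℝ) =ᵐ[volume] fun x => U (t, x)) ∧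
    ∀ s : ℝ, (∀ t : ℝ, MemSobolev s 2 (ZK.toDist (u t))) ∧
      (⨆ t : ℝ, ZK.hsNorm s (ZK.toDist (u t))) < (⊤ : ℝ≥0∞) := by
  obtain ⟨ut, h⟩ := hu
  obtain ⟨c, K, D, hloc⟩ := h.exists_uniformlyLocalized hκ hdecay
  obtain ⟨B, hB⟩ := h.exists_hOneBound_of_localized hκ hloc
  exact ⟨h.exists_contDiff hκ hloc hB, h.memSobolev_and_iSup_lt_top hκ hloc hB⟩
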